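/- Let $K$ be a differential field with derivation $\partial$ (also written $'$) and field of constants $\mathbb C$, and let $K[\partial]$ be the ring of linear differential operators over $K$. Let $L=\partial^3+u_1\partial+u_0\in K[\partial]$ be a Boussinesq operator, that is: with $q_1=u_1$, $q_0=u_0-\tfrac12u_1'$, for some $i\in\{1,2\}$ and $s\ge 0$ there are $f_0,\dots,f_s,g_0,\dots,g_s\in K$ with $(f_0,g_0)=(0,1)$ if $i=1$, $f_0=1$, $g_0\in\mathbb C$ if $i=2$, with $3f_{n}'=F(f_{n-1},g_{n-1})$ and $3g_{n}'=G(f_{n-1},g_{n-1})$ for $1\le n\le s$ (the antiderivatives being determined up to integration constants), and with $F(f_s,g_s)=G(f_s,g_s)=0$, where $$F(f,g)=2g'''+2q_1g'+q_1'g+3q_0f'+2q_0'f,$$ $$G(f,g)=3q_0g'+q_0'g-\tfrac16f^{(5)}-\tfrac56q_1f'''-\tfrac54q_1'f''-\left(\tfrac34q_1''+\tfrac23q_1^2\right)f'-\left(\tfrac16q_1'''+\tfrac23q_1q_1'\right)f.$$ For a sequence $(f_n,g_n)$ of this kind (without the last condition) put $P_i=L_{0,i}$, $P_{3n+i}=P_{3(n-1)+i}L+L_{n,i}$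 with $L_{n,i}=f_n\partial^2+(g_n-\tfrac12f_n')\partial+(\tfrac16f_n''-g_n'+\tfrac23q_1f_n)$ (the Boussinesq differential operators of the branch $i$). For $i=1,2$ let $A_i$ be an operator of minimal order among the operators in the centralizer $\mathcal C_K(L)$ of $L$ whose order is congruent to $i$ modulo $3$. Let $f_1=\partial\mathrm{Res}(L-\lambda,A_1-\mu)$, $f_2=\partial\mathrm{Res}(L-\lambda,A_2-\gamma)$, $f_3=\partial\mathrm{Res}(A_1-\mu,A_2-\gamma)$ be the differential resultants, $I(L)$ the ideal of $\mathbb C[\lambda,\mu,\gamma]$ generated by them, and $\Gamma\subset\mathbb C^3$ its zero set. Let $\phi_{k,1}\partial+\phi_{k,0}$, $k=1,2,3$, be the first differential subresultants of the same three pairs, $\phi_k=\phi_{k,0}/\phi_{k,1}$, and let $Z\subset\Gamma$ consist of the singular points of $\Gamma$ and of the points at which some $\phi_{k,1}$ vanishes. The SpF algorithm, on input $L$ and $\lambda_0\in\mathbb C$, computes such $A_1,A_2$ by means of Boussinesq differential operators, and then $I(L)$. If $I(L)$ is not prime, it returns "$L$ is not geometrically reducible". Otherwise it searches the points of $\Gamma$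 with first coordinate $\lambda_0$ for a point $P_0=(\lambda_0,\mu_0,\gamma_0)\notin Z$; if there is none, it returns "a spectral factorization of $L-\lambda_0$ cannot be obtained", and else it returns $[I(L),P_0,\partial+\phi_1(P_0)]$. Theorem. (1) Operators $A_1,A_2$ as above exist, and they can be chosen among the Boussinesq differential operators of the branches $1$ and $2$. For every choice of $A_1,A_2$ as above the following holds. $\mathcal C_K(L)=\mathbb C[L,A_1,A_2]$, $f_1,f_2,f_3\in\mathbb C[\lambda,\mu,\gamma]$, and the algorithm always returns an output. (2) If $I(L)$ is not prime, the output is "$L$ is not geometrically reducible". (3) If $I(L)$ is prime, then, unless no point of $\Gamma\setminus Z$ has first coordinate $\lambda_0$ (when the algorithm reports that no spectral factorization can be obtained), the output is $[I(L),P_0,\partial+\phi_1(P_0)]$ with $P_0=(\lambda_0,\mu_0,\gamma_0)\in\Gamma\setminus Z$ and $$\partial+\phi_1(P_0)=\gcd(L-\lambda_0,\,A_1-\mu_0,\,A_2-\gamma_0),$$ the monic greatest common right divisor. (4) If $I(L)$ is prime, or if at least the radical of $I(L)$ is prime and $f_3$ is squarefree, then $Z$ is finite, and for every $P_0=(\lambda_0,\mu_0,\gamma_0)\in\Gamma\setminus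 Z$ (hence for all but finitely many points of $\Gamma$) one has $\phi_1(P_0)=\phi_2(P_0)=\phi_3(P_0)=:\phi_0$, $\partial+\phi_0=\gcd(L-\lambda_0,A_1-\mu_0,A_2-\gamma_0)$, and the spectral factorization $$L-\lambda_0=(\partial^2-\phi_0\,\partial+\phi_0^2-2\phi_0'+u_1)\cdot(\partial+\phi_0).$$ -/

import Mathlib

open scoped Differential

noncomputable section

/-! ### The ring `R[∂]` of linear differential operators over a differential ring -/

/-- Formal linear differential operators `∑ aᵢ ∂ⁱ` with coefficients `aᵢ` in `R`, written on the
left. The underlying left `R`-module is that of the polynomials in `∂`; the product is the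
composition of operators (see `DiffOp.partial_mul_const`). -/
def DiffOp (R : Type*) [CommRing R] : Type _ := Polynomial R

namespace DiffOp

section Basic

variable {R : Type*} [CommRing R]

instance : AddCommGroup (DiffOp R) := inferInstanceAs (AddCommGroup (Polynomial R))

/-- The polynomial `∑ aᵢ Xⁱ` of the coefficients of `∑ aᵢ ∂ⁱ`. -/
def toPoly (P : DiffOp R) : Polynomial R := P

/-- The operator `∑ aᵢ ∂ⁱ` with a given polynomial of coefficients. -/
def ofPoly (p : Polynomial R) : DiffOp R := p

/-- The coefficient of `∂ⁱ`. -/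
def coeff (P : DiffOp R) (i : ℕ) : R := P.toPoly.coeff i

/-- The order of a differential operator (`0` for the zero operator). -/
def order (P : DiffOp R) : ℕ := P.toPoly.natDegree

/-- The leading coefficient is `1`. -/
def IsMonic (P : DiffOp R) : Prop := P.toPoly.Monic

/-- The operator of order zero given by an element of `R`. -/
def const (a : R) : DiffOp R := ofPoly (Polynomial.C a)

/-- Apply a ring homomorphism to all the coefficients. -/
def mapCoeff {S : Type*} [CommRing S] (φ : R →+* S) (P : DiffOp R) : DiffOp S :=
  ofPoly (P.toPoly.map φ)

theorem smul_end_apply (a : R) (p : Polynomial R) :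
    Module.toAddMonoidEnd R (Polynomial R) a p = Polynomial.C a * p :=
  Polynomial.smul_eq_C_mul a

theorem end_mul_apply (f g : AddMonoid.End (Polynomial R)) (p : Polynomial R) :
    (f * g) p = f (g p) := rfl

theorem end_add_apply (f g : AddMonoid.End (Polynomial R)) (p : Polynomial R) :
    (f + g) p = f p + g p := rfl

end Basic

section Mul

variable {R : Type*} [CommRing R] [Differential R]

/-- Left multiplication by `∂`, that is `∂ · ∑ aᵢ ∂ⁱ = ∑ aᵢ ∂ⁱ⁺¹ + ∑ aᵢ′ ∂ⁱ`. -/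
def shift : AddMonoid.End (Polynomial R) where
  toFun p := Polynomial.X * p + Differential.mapCoeffs p
  map_zero' := by simp
  map_add' p q := by rw [mul_add, map_add]; abel

/-- Left multiplication by `∑ aᵢ ∂ⁱ`, that is `∑ aᵢ · shiftⁱ`. -/
def act (p : Polynomial R) : AddMonoid.End (Polynomial R) :=
  p.eval₂ (Module.toAddMonoidEnd R (Polynomial R)) shift

instance : Mul (DiffOp R) := ⟨fun P Q => ofPoly (act P.toPoly Q.toPoly)⟩

instance : One (DiffOp R) := ⟨ofPoly 1⟩

/-- The derivation `∂`, as an operator of order one. -/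
def partial' : DiffOp R := ofPoly Polynomial.X

theorem shift_apply (p : Polynomial R) :
    shift p = Polynomial.X * p + Differential.mapCoeffs p := rfl

theorem act_add (p q : Polynomial R) : act (p + q) = act p + act q :=
  Polynomial.eval₂_add _ _

theorem act_monomial (n : ℕ) (a : R) :
    act (Polynomial.monomial n a) = Module.toAddMonoidEnd R (Polynomial R) a * shift ^ n :=
  Polynomial.eval₂_monomial _ _

theorem act_C_mul (a : R) (q : Polynomial R) :
    act (Polynomial.C a * q) = Module.toAddMonoidEnd R (Polynomial R) a * act q := by
  induction q using Polynomial.induction_on' with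
  | add p q hp hq => rw [mul_add, act_add, act_add, hp, hq, mul_add]
  | monomial n b =>
    rw [Polynomial.C_mul_monomial, act_monomial, act_monomial, map_mul, mul_assoc]

theorem shift_smul (a : R) :
    (shift : AddMonoid.End (Polynomial R)) * Module.toAddMonoidEnd R (Polynomial R) a =
      Module.toAddMonoidEnd R (Polynomial R) a * shift +
        Module.toAddMonoidEnd R (Polynomial R) a′ := by
  ext1 p
  simp only [end_mul_apply, end_add_apply, smul_end_apply, shift_apply, Derivation.leibniz,
    Differential.mapCoeffs_C, smul_eq_mul]
  ring

theorem act_shift (q : Polynomial R) : act (shift q) = shift * act q := by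
  induction q using Polynomial.induction_on' with
  | add p q hp hq => rw [map_add, act_add, act_add, hp, hq, mul_add]
  | monomial n b =>
    have h : shift (Polynomial.monomial n b) =
        Polynomial.monomial (n + 1) b + Polynomial.monomial n b′ := by
      simp [shift_apply, Polynomial.X_mul_monomial]
    rw [h, act_add, act_monomial, act_monomial, act_monomial, ← mul_assoc, shift_smul, add_mul,
      pow_succ', mul_assoc]

theorem act_act (p q : Polynomial R) : act (act p q) = act p * act q := by
  induction p using Polynomial.induction_on' with
  | add p₁ p₂ h₁ h₂ => rw [act_add, end_add_apply, act_add, h₁, h₂, add_mul]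
  | monomial n a =>
    rw [act_monomial, end_mul_apply, smul_end_apply, act_C_mul, mul_assoc]
    congr 1
    induction n with
    | zero => simp
    | succ n ih => rw [pow_succ', end_mul_apply, act_shift, ih, mul_assoc]

theorem act_one (p : Polynomial R) : act p 1 = p := by
  induction p using Polynomial.induction_on' with
  | add p₁ p₂ h₁ h₂ => rw [act_add, end_add_apply, h₁, h₂]
  | monomial n a =>
    have h : ∀ n : ℕ, (shift ^ n : AddMonoid.End (Polynomial R)) 1 = Polynomial.X ^ n := by
      intro n
      induction n with
      | zero => simp
      | succ n ih =>
        rw [pow_succ', end_mul_apply, ih]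
        simp [shift_apply, pow_succ', Derivation.leibniz_pow]
    rw [act_monomial, end_mul_apply, h, smul_end_apply,
      Polynomial.C_mul_X_pow_eq_monomial]

theorem one_act (q : Polynomial R) : act 1 q = q := by
  rw [← Polynomial.monomial_zero_one, act_monomial]
  simp

instance : Ring (DiffOp R) :=
  { (inferInstance : AddCommGroup (DiffOp R)), (inferInstance : Mul (DiffOp R)),
    (inferInstance : One (DiffOp R)) with
    left_distrib := fun P Q S => map_add (act P.toPoly) Q.toPoly S.toPoly
    right_distrib := fun P Q S => DFunLike.congr_fun (act_add P.toPoly Q.toPoly) S.toPoly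
    zero_mul := fun P =>
      DFunLike.congr_fun
        (Polynomial.eval₂_zero (Module.toAddMonoidEnd R (Polynomial R)) shift) P.toPoly
    mul_zero := fun P => map_zero (act P.toPoly)
    mul_assoc := fun P Q S => DFunLike.congr_fun (act_act P.toPoly Q.toPoly) S.toPoly
    one_mul := fun P => one_act P.toPoly
    mul_one := fun P => act_one P.toPoly }

/-- The defining commutation rule `∂ a = a ∂ + a′`. -/
theorem partial_mul_const (a : R) :
    partial' * const a = const a * partial' + const a′ := by
  change act Polynomial.X (Polynomial.C a) =
    act (Polynomial.C a) Polynomial.X + Polynomial.C a′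
  rw [← Polynomial.monomial_one_one_eq_X, ← Polynomial.monomial_zero_left, act_monomial,
    act_monomial]
  simp [shift_apply, smul_end_apply, Polynomial.X_mul_C, Polynomial.C_mul_X_eq_monomial]

end Mul

/-! ### Right divisors, differential resultants and first subresultants -/

section Divisors

variable {R : Type*} [CommRing R] [Differential R]

/-- `G` is a right divisor of `P`. -/
def IsRightDivisor (G P : DiffOp R) : Prop := ∃ Q : DiffOp R, P = Q * G

/-- `G` is the monic greatest common right divisor of the operators in `S`. -/
def IsGCRD (G : DiffOp R) (S : Set (DiffOp R)) : Prop :=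
  G.IsMonic ∧ (∀ P ∈ S, IsRightDivisor G P) ∧
    ∀ H : DiffOp R, (∀ P ∈ S, IsRightDivisor H P) → IsRightDivisor H G

/-- The extended system `∂^(m-1-k) P, …, ∂ P, P, ∂^(n-1-k) Q, …, ∂ Q, Q` with `n + m - 2k`
members, where `n` and `m` are the orders of `P` and `Q`. -/
def extendedSystem (k : ℕ) (P Q : DiffOp R) (r : ℕ) : DiffOp R :=
  if r < Q.order - k then partial' ^ (Q.order - 1 - k - r) * P
  else partial' ^ (P.order - 1 - k - (r - (Q.order - k))) * Q

/-- The differential resultant: the determinant of the matrix of coefficients of the extended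
system with `k = 0`; its columns are indexed by `∂^(n+m-1), …, ∂, 1`. -/
def dRes (P Q : DiffOp R) : R :=
  Matrix.det (Matrix.of fun r c : Fin (P.order + Q.order) =>
    (extendedSystem 0 P Q r).coeff (P.order + Q.order - 1 - c))

/-- The coefficients `det S₁⁰` (for `j = 0`) and `det S₁¹` (for `j = 1`) of the first differential
subresultant `det S₁⁰ + det S₁¹ ∂`. The coefficient matrix of the extended system with `k = 1` has
`n + m - 2` rows and columns indexed by `∂^(n+m-2), …, ∂, 1`; in `S₁⁰` the column of `∂` is
removed, in `S₁¹` the column of `1`. -/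
def subres (P Q : DiffOp R) (j : Fin 2) : R :=
  Matrix.det (Matrix.of fun r c : Fin (P.order + Q.order - 2) =>
    (extendedSystem 1 P Q r).coeff
      (if j = 0 ∧ (c : ℕ) + 1 = P.order + Q.order - 2 then 0 else P.order + Q.order - 2 - c))

end Divisors

end DiffOp

/-! ### Polynomials over a differential ring, with constant variables -/

namespace MvPolyDeriv

variable {σ R : Type*} [CommRing R] [Differential R]

/-- Differentiate all the coefficients of a polynomial. -/
def derivCoeff (p : MvPolynomial σ R) : MvPolynomial σ R :=
  ∑ s ∈ p.support, MvPolynomial.monomial s (p.coeff s)′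

theorem coeff_derivCoeff (p : MvPolynomial σ R) (s : σ →₀ ℕ) :
    (derivCoeff p).coeff s = (p.coeff s)′ := by
  classical
  rw [derivCoeff, MvPolynomial.coeff_sum]
  simp only [MvPolynomial.coeff_monomial]
  rw [Finset.sum_ite_eq']
  split_ifs with h
  · rfl
  · rw [MvPolynomial.notMem_support_iff.1 h, map_zero]

/-- Polynomials over a differential ring form a differential ring, the variables being constants. -/
instance : Differential (MvPolynomial σ R) where
  deriv := Derivation.mk'
    (AddMonoidHom.toIntLinearMap
      { toFun := derivCoeff
        map_zero' := by ext s; simp [coeff_derivCoeff]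
        map_add' := fun p q => by ext s; simp [coeff_derivCoeff] })
    (fun p q => by
      classical
      ext s
      simp only [AddMonoidHom.coe_toIntLinearMap, AddMonoidHom.coe_mk, ZeroHom.coe_mk,
        coeff_derivCoeff, smul_eq_mul, MvPolynomial.coeff_add, MvPolynomial.coeff_mul, map_sum,
        Derivation.leibniz]
      rw [Finset.sum_add_distrib]
      congr 1
      exact Finset.sum_equiv (Equiv.prodComm _ _)
        (by simp [add_comm]) (by simp))

end MvPolyDeriv

/-! ### Boussinesq systems and operators -/

namespace Bsq

open DiffOp

section Operators

variable {K : Type*} [Field K] [Differential K]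

/-- `L = ∂³ + u₁ ∂ + u₀`. -/
def opL (u₁ u₀ : K) : DiffOp K := partial' ^ 3 + const u₁ * partial' + const u₀

/-- The right-hand side of the recursion for `3 ∂(f_{n+1})`. -/
def rhsF (q₁ q₀ f g : K) : K :=
  2 * g′′′ + 2 * q₁ * g′ + q₁′ * g + 3 * q₀ * f′ + 2 * q₀′ * f

/-- The right-hand side of the recursion for `3 ∂(g_{n+1})`. -/
def rhsG (q₁ q₀ f g : K) : K :=
  3 * q₀ * g′ + q₀′ * g - 1 / 6 * f′′′′′ - 5 / 6 * q₁ * f′′′ - 5 / 4 * q₁′ * f′′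
    - (3 / 4 * q₁′′ + 2 / 3 * q₁ ^ 2) * f′ - (1 / 6 * q₁′′′ + 2 / 3 * q₁ * q₁′) * f

/-- `f₀, …, fₙ` and `g₀, …, gₙ` solve the Boussinesq recursion of the branch `i ∈ {1, 2}` for the
potentials `u₁ = q₁` and `u₀ = q₁′ / 2 + q₀`. At every step `f` and `g` are antiderivatives, so that
each is determined up to an additive constant: these are the integration constants. -/
structure IsBsqSequence [Algebra ℂ K] (u₁ u₀ : K) (i n : ℕ) (f g : ℕ → K) : Prop where
  init : (i = 1 ∧ f 0 = 0 ∧ g 0 = 1) ∨ (i = 2 ∧ f 0 = 1 ∧ ∃ c : ℂ, g 0 = algebraMap ℂ K c)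
  stepF : ∀ k < n, 3 * (f (k + 1))′ = rhsF u₁ (u₀ - 1 / 2 * u₁′) (f k) (g k)
  stepG : ∀ k < n, 3 * (g (k + 1))′ = rhsG u₁ (u₀ - 1 / 2 * u₁′) (f k) (g k)

/-- `∂³ + u₁ ∂ + u₀` is a Boussinesq operator: `u₁, u₀` satisfy the `n`-th stationary Boussinesq
system `3 (∂ f_{n+1}, ∂ g_{n+1}) = (0, 0)` of the branch `i` for some `n`, some `i ∈ {1, 2}` and
some integration constants. -/
def IsBoussinesq [Algebra ℂ K] (u₁ u₀ : K) : Prop :=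
  ∃ (i n : ℕ) (f g : ℕ → K), IsBsqSequence u₁ u₀ i n f g ∧
    rhsF u₁ (u₀ - 1 / 2 * u₁′) (f n) (g n) = 0 ∧ rhsG u₁ (u₀ - 1 / 2 * u₁′) (f n) (g n) = 0

/-- The operator `f ∂² + (g - f′/2) ∂ + (f′′/6 - g′ + 2 u₁ f / 3)`. -/
def bsqStep (u₁ f g : K) : DiffOp K :=
  const f * partial' ^ 2 + const (g - 1 / 2 * f′) * partial'
    + const (1 / 6 * f′′ - g′ + 2 / 3 * u₁ * f)

/-- The operators `P_i = L_{0,i}`, `P_{3n+i} = P_{3n-3+i} L + L_{n,i}`. -/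
def bsqOp (u₁ u₀ : K) (f g : ℕ → K) : ℕ → DiffOp K
  | 0 => bsqStep u₁ (f 0) (g 0)
  | n + 1 => bsqOp u₁ u₀ f g n * opL u₁ u₀ + bsqStep u₁ (f (n + 1)) (g (n + 1))

/-- `A = P_{3n+i}` for some `n` and some integration constants. -/
def IsBsqOperator [Algebra ℂ K] (u₁ u₀ : K) (i : ℕ) (A : DiffOp K) : Prop :=
  ∃ (n : ℕ) (f g : ℕ → K), IsBsqSequence u₁ u₀ i n f g ∧ A = bsqOp u₁ u₀ f g n

/-- `A` has minimal order among the operators of order congruent to `i` modulo `3` that commute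
with `L`. -/
def IsMinimalCommuting (L : DiffOp K) (i : ℕ) (A : DiffOp K) : Prop :=
  A * L = L * A ∧ A.order % 3 = i ∧
    ∀ B : DiffOp K, B * L = L * B → B.order % 3 = i → A.order ≤ B.order

/-- The subring `ℂ[L, A₁, A₂]` of `K[∂]`. -/
def generatedRing [Algebra ℂ K] (L A₁ A₂ : DiffOp K) : Subring (DiffOp K) :=
  Subring.closure (Set.range (fun c : ℂ => const (algebraMap ℂ K c)) ∪ {L, A₁, A₂})

end Operators

/-! ### The ideal of Burchnall-Chaundy polynomials and the spectral curve

The variables `λ, μ, γ` are `X 0, X 1, X 2`, and a point `(λ₀, μ₀, γ₀)` is a map `Fin 3 → ℂ`. -/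

section Curve

variable {K : Type*} [Field K] [Differential K]

/-- `A - X k`, as an operator over the differential ring `K[λ, μ, γ]`. -/
def pencil (A : DiffOp K) (k : Fin 3) : DiffOp (MvPolynomial (Fin 3) K) :=
  A.mapCoeff MvPolynomial.C - const (MvPolynomial.X k)

/-- The pairs `(L - λ, A₁ - μ)`, `(L - λ, A₂ - γ)`, `(A₁ - μ, A₂ - γ)`. -/
def pencilPair (L A₁ A₂ : DiffOp K) :
    Fin 3 → DiffOp (MvPolynomial (Fin 3) K) × DiffOp (MvPolynomial (Fin 3) K) :=
  ![(pencil L 0, pencil A₁ 1), (pencil L 0, pencil A₂ 2), (pencil A₁ 1, pencil A₂ 2)]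

/-- The three differential resultants, in `K[λ, μ, γ]`. -/
def bcRes (L A₁ A₂ : DiffOp K) (i : Fin 3) : MvPolynomial (Fin 3) K :=
  dRes (pencilPair L A₁ A₂ i).1 (pencilPair L A₁ A₂ i).2

/-- The coefficients `φ_{i,j}` of the three first differential subresultants, in `K[λ, μ, γ]`. -/
def phiPoly (L A₁ A₂ : DiffOp K) (i : Fin 3) (j : Fin 2) : MvPolynomial (Fin 3) K :=
  subres (pencilPair L A₁ A₂ i).1 (pencilPair L A₁ A₂ i).2 j

variable [Algebra ℂ K]

/-- The ideal of `ℂ[λ, μ, γ]` generated by the three differential resultants. -/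
def bcIdeal (L A₁ A₂ : DiffOp K) : Ideal (MvPolynomial (Fin 3) ℂ) :=
  Ideal.span {p | ∃ i, MvPolynomial.map (algebraMap ℂ K) p = bcRes L A₁ A₂ i}

/-- The value in `K` of a polynomial over `K` at a point of `ℂ³`. -/
def evalAt (P : Fin 3 → ℂ) (p : MvPolynomial (Fin 3) K) : K :=
  MvPolynomial.eval (fun k => algebraMap ℂ K (P k)) p

/-- The value `φ_i(P) = φ_{i,0}(P) / φ_{i,1}(P)`, where `φ_{i,1}(P) ≠ 0`. -/
def phi (L A₁ A₂ : DiffOp K) (i : Fin 3) (P : Fin 3 → ℂ) : K :=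
  evalAt P (phiPoly L A₁ A₂ i 0) / evalAt P (phiPoly L A₁ A₂ i 1)

/-- The curve `Γ` in `ℂ³` defined by the ideal. -/
def curve (L A₁ A₂ : DiffOp K) : Set (Fin 3 → ℂ) :=
  MvPolynomial.zeroLocus ℂ (bcIdeal L A₁ A₂)

/-- The Zariski tangent space at `P` of the subscheme of `ℂ³` defined by `I`. -/
def tangentSpace (I : Ideal (MvPolynomial (Fin 3) ℂ)) (P : Fin 3 → ℂ) :
    Submodule ℂ (Fin 3 → ℂ) where
  carrier := {v | ∀ p ∈ I, ∑ k, v k * MvPolynomial.eval P (MvPolynomial.pderiv k p) = 0}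
  zero_mem' p _ := by simp
  add_mem' {v w} hv hw p hp := by
    simp only [Pi.add_apply, add_mul, Finset.sum_add_distrib, hv p hp, hw p hp, add_zero]
  smul_mem' c v hv p hp := by
    simp only [Pi.smul_apply, smul_eq_mul, mul_assoc, ← Finset.mul_sum, hv p hp, mul_zero]

/-- The singular points of the curve: the tangent space, computed from all the polynomials that
vanish on the curve, has dimension greater than one. -/
def singularSet (L A₁ A₂ : DiffOp K) : Set (Fin 3 → ℂ) :=
  {P ∈ curve L A₁ A₂ |
    1 < Module.finrank ℂ (tangentSpace (MvPolynomial.vanishingIdeal ℂ (curve L A₁ A₂)) P)}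

/-- The set `Z`: the singular points, and the points where some `φ_i` is not well defined. -/
def exceptionalSet (L A₁ A₂ : DiffOp K) : Set (Fin 3 → ℂ) :=
  singularSet L A₁ A₂ ∪ {P ∈ curve L A₁ A₂ | ∃ i, evalAt P (phiPoly L A₁ A₂ i 1) = 0}

end Curve

/-! ### The algorithm -/

/-- The possible outputs of the algorithm. -/
inductive SpFOutput (K : Type*) [Field K] where
  /-- `L` is not geometrically reducible. -/
  | notGeometricallyReducible : SpFOutput K
  /-- A spectral factorization of `L - λ₀` cannot be obtained. -/
  | noFactorization : SpFOutput K
  /-- A list consisting of an ideal, a point, and a right factor. -/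
  | result (I : Ideal (MvPolynomial (Fin 3) ℂ)) (P₀ : Fin 3 → ℂ) (R : DiffOp K) : SpFOutput K

/-- `SpFRun L lam₀ A₁ A₂ out`: the algorithm on input `L, λ₀` can return `out`, once the operators
`A₁, A₂` have been computed. It computes the ideal and tests whether it is prime; then it searches
the points of `Γ` over `λ₀` for one outside `Z`, gives up if there is none, and else returns the
ideal, the point `P₀` found, and `∂ + φ_{1,0}(P₀) / φ_{1,1}(P₀)`. -/
inductive SpFRun {K : Type*} [Field K] [Differential K] [Algebra ℂ K]
    (L : DiffOp K) (lam₀ : ℂ) (A₁ A₂ : DiffOp K) : SpFOutput K → Prop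
  | notPrime (h : ¬ (bcIdeal L A₁ A₂).IsPrime) :
      SpFRun L lam₀ A₁ A₂ SpFOutput.notGeometricallyReducible
  | giveUp (h : (bcIdeal L A₁ A₂).IsPrime) (P₀ : Fin 3 → ℂ) (hP₀ : P₀ ∈ curve L A₁ A₂)
      (hlam : P₀ 0 = lam₀)
      (hZ : ∀ P ∈ curve L A₁ A₂, P 0 = lam₀ → P ∈ exceptionalSet L A₁ A₂) :
      SpFRun L lam₀ A₁ A₂ SpFOutput.noFactorization
  | factor (h : (bcIdeal L A₁ A₂).IsPrime) (P₀ : Fin 3 → ℂ) (hP₀ : P₀ ∈ curve L A₁ A₂)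
      (hlam : P₀ 0 = lam₀) (hZ : P₀ ∉ exceptionalSet L A₁ A₂) :
      SpFRun L lam₀ A₁ A₂
        (SpFOutput.result (bcIdeal L A₁ A₂) P₀ (partial' + const (phi L A₁ A₂ 0 P₀)))

end Bsq

end

open scoped Differential

noncomputable section

set_option linter.unusedSectionVars false

/-! ### Coefficients and orders of differential operators -/

namespace DiffOp

section Coefficients

variable {R : Type*} [CommRing R] [Differential R]

/-! Commutators with `L` drive the first half. For an operator R of order at most two, [R, L] equals
a remainder minus a left multiple of L. The Boussinesq recursion says that the remainder of one
base-L digit is the quotient of the next, so [P_{3n+i}, L] telescopes to the last remainder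
(`bsqOp_commutator`). Conversely, reading the base-L digits of a monic operator whose commutator
with L has order at most one recovers such a sequence, up to a polynomial in L
(`exists_eq_bsqOp_add`). A Boussinesq operator L therefore commutes with some P_{3n+i}; its square
has the other nonzero residue modulo 3, so minimal operators of both residues exist and can be taken
of Boussinesq type. Leading coefficients in the centralizer are complex, hence the centralizer is
free over ℂ[L] on 1, A₁, A₂. Since A₁² involves A₂ with a nonzero coefficient, it is commutative: a
domain S, finite over ℂ[L].

Each differential resultant is, up to a nonzero scalar, the characteristic polynomial of right
multiplication by one operator modulo the other (`dRes_eq_det`). The matrix satisfies a Lax equation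
because the operators commute, so its coefficients are complex (`deriv_coeff_charpoly_of_lax`).

The pivot of the second half is `one_notMem_leftIdeal`: at every point of Spec S the left ideal
generated by the operators Aᵢ - Pᵢ is proper. Were 1 in it, right multiplication by an element of S
representing a socle element of S/(L - P₀) would put that element into (L - P₀)S. Properness shows
that the resultants vanish on Spec S and that the left ideal contains at most one ∂ + φ, which then
generates it. The first subresultant lies in this left ideal, so wherever its leading coefficient is
nonzero it yields the greatest common divisor and the factorization.

When the radical of I(L) is prime, Γ is Spec S, since both ideals meet ℂ[λ] in zero and the
quotients are integral over ℂ[λ]. It remains that no φ_{k,1} vanishes identically on Γ. If it did,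
the kernel of the multiplication matrix would have dimension two at all points, and the curve
polynomial and its derivative would both vanish in S. For the pairs containing L a degree count
forbids this. For (A₁, A₂) the polynomial would have a repeated factor, against squarefreeness. If
instead I(L) is prime, f₁ and f₂ would generate all relations near Γ, making the derivative of the
cubic of A₂ a unit of S; but units of S are complex scalars and this derivative has degree two in A₂
(`exists_subres_one_two_ne_zero_of_relations_le`). -/

theorem ext_coeff {P Q : DiffOp R} (h : ∀ k, P.coeff k = Q.coeff k) : P = Q :=
  Polynomial.ext h

theorem toPoly_injective : Function.Injective (toPoly : DiffOp R → Polynomial R) := fun _ _ h => h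

theorem toPoly_add (P Q : DiffOp R) : (P + Q).toPoly = P.toPoly + Q.toPoly := rfl
theorem toPoly_sub (P Q : DiffOp R) : (P - Q).toPoly = P.toPoly - Q.toPoly := rfl

theorem toPoly_const (a : R) : (const a).toPoly = Polynomial.C a := rfl

theorem toPoly_partial : (partial' : DiffOp R).toPoly = Polynomial.X := rfl

theorem toPoly_const_mul (a : R) (P : DiffOp R) :
    (const a * P).toPoly = Polynomial.C a * P.toPoly := by
  change act (Polynomial.C a) P.toPoly = _
  rw [← Polynomial.monomial_zero_left, act_monomial, end_mul_apply, smul_end_apply]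
  simp

theorem toPoly_partial_mul (P : DiffOp R) :
    (partial' * P).toPoly = Polynomial.X * P.toPoly + Differential.mapCoeffs P.toPoly := by
  change act Polynomial.X P.toPoly = _
  rw [← Polynomial.monomial_one_one_eq_X, act_monomial, end_mul_apply, smul_end_apply]
  simp [shift_apply, Polynomial.monomial_one_one_eq_X]

theorem coeff_add (P Q : DiffOp R) (k : ℕ) : (P + Q).coeff k = P.coeff k + Q.coeff k :=
  Polynomial.coeff_add _ _ _

theorem coeff_sub (P Q : DiffOp R) (k : ℕ) : (P - Q).coeff k = P.coeff k - Q.coeff k :=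
  Polynomial.coeff_sub _ _ _

@[simp] theorem coeff_zero (k : ℕ) : (0 : DiffOp R).coeff k = 0 := Polynomial.coeff_zero _

theorem coeff_const (a : R) (k : ℕ) : (const a).coeff k = if k = 0 then a else 0 :=
  Polynomial.coeff_C

theorem coeff_one (k : ℕ) : (1 : DiffOp R).coeff k = if k = 0 then 1 else 0 :=
  coeff_const 1 k

/-- The coefficient of `∂ᵏ` as an additive map. -/
def coeffHom (k : ℕ) : DiffOp R →+ R where
  toFun P := P.coeff k
  map_zero' := coeff_zero k
  map_add' P Q := coeff_add P Q k

theorem coeff_sum {ι : Type*} (s : Finset ι) (P : ι → DiffOp R) (k : ℕ) :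
    (∑ i ∈ s, P i).coeff k = ∑ i ∈ s, (P i).coeff k :=
  map_sum (coeffHom k) P s

theorem coeff_const_mul (a : R) (P : DiffOp R) (k : ℕ) :
    (const a * P).coeff k = a * P.coeff k := by
  rw [coeff, toPoly_const_mul, Polynomial.coeff_C_mul]; rfl

theorem coeff_mapCoeffs (p : Polynomial R) (k : ℕ) :
    (Differential.mapCoeffs p).coeff k = (p.coeff k)′ := rfl

theorem coeff_partial_mul_succ (P : DiffOp R) (k : ℕ) :
    (partial' * P).coeff (k + 1) = P.coeff k + (P.coeff (k + 1))′ := by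
  rw [coeff, toPoly_partial_mul, Polynomial.coeff_add, Polynomial.coeff_X_mul, coeff_mapCoeffs]
  rfl

theorem coeff_partial_mul_zero (P : DiffOp R) :
    (partial' * P).coeff 0 = (P.coeff 0)′ := by
  rw [coeff, toPoly_partial_mul, Polynomial.coeff_add, coeff_mapCoeffs]
  simp [coeff]

/-- The embedding of the coefficients as operators of order zero. -/
def constHom : R →+* DiffOp R where
  toFun := const
  map_one' := rfl
  map_zero' := Polynomial.C_0
  map_add' _ _ := Polynomial.C_add
  map_mul' a b := toPoly_injective (by
    rw [toPoly_const_mul, toPoly_const, toPoly_const, Polynomial.C_mul])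

theorem const_zero : const (0 : R) = 0 := map_zero constHom
theorem const_one : const (1 : R) = 1 := rfl
theorem const_add (a b : R) : const (a + b) = const a + const b := map_add constHom a b
theorem const_sub (a b : R) : const (a - b) = const a - const b := map_sub constHom a b
theorem const_mul (a b : R) : const (a * b) = const a * const b := map_mul constHom a b

theorem const_injective : Function.Injective (const : R → DiffOp R) := Polynomial.C_injective

theorem coeff_partial_pow (n k : ℕ) :
    (partial' ^ n : DiffOp R).coeff k = if k = n then 1 else 0 := by
  induction n generalizing k with
  | zero => rw [pow_zero, coeff_one]
  | succ n ih =>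
    rw [pow_succ']
    cases k with
    | zero =>
      rw [coeff_partial_mul_zero, ih, if_neg n.succ_ne_zero.symm]
      split_ifs <;> simp
    | succ k =>
      rw [coeff_partial_mul_succ, ih, ih]
      split_ifs <;> simp_all

/-- The order of `P` is less than `n`. -/
def OrderLT (P : DiffOp R) (n : ℕ) : Prop := ∀ k, n ≤ k → P.coeff k = 0

theorem OrderLT.mono {P : DiffOp R} {n m : ℕ} (h : OrderLT P n) (hnm : n ≤ m) : OrderLT P m :=
  fun k hk => h k (hnm.trans hk)

theorem OrderLT.add {P Q : DiffOp R} {n : ℕ} (hP : OrderLT P n) (hQ : OrderLT Q n) :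
    OrderLT (P + Q) n := fun k hk => by rw [coeff_add, hP k hk, hQ k hk, add_zero]

theorem OrderLT.sub {P Q : DiffOp R} {n : ℕ} (hP : OrderLT P n) (hQ : OrderLT Q n) :
    OrderLT (P - Q) n := fun k hk => by rw [coeff_sub, hP k hk, hQ k hk, sub_zero]

theorem orderLT_zero (n : ℕ) : OrderLT (0 : DiffOp R) n := fun k _ => coeff_zero k

theorem orderLT_sum {ι : Type*} (s : Finset ι) (P : ι → DiffOp R) {n : ℕ}
    (h : ∀ i ∈ s, OrderLT (P i) n) : OrderLT (∑ i ∈ s, P i) n := fun k hk => by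
  rw [coeff_sum]; exact Finset.sum_eq_zero fun i hi => h i hi k hk

theorem OrderLT.const_mul {P : DiffOp R} {n : ℕ} (hP : OrderLT P n) (a : R) :
    OrderLT (const a * P) n := fun k hk => by rw [coeff_const_mul, hP k hk, mul_zero]

theorem OrderLT.partial_mul {P : DiffOp R} {n : ℕ} (hP : OrderLT P n) :
    OrderLT (partial' * P) (n + 1) := fun k hk => by
  obtain ⟨k, rfl⟩ : ∃ j, k = j + 1 := ⟨k - 1, by omega⟩
  rw [coeff_partial_mul_succ, hP k (by omega), hP (k + 1) (by omega), map_zero, add_zero]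

theorem OrderLT.partial_pow_mul {P : DiffOp R} {n : ℕ} (hP : OrderLT P n) (k : ℕ) :
    OrderLT (partial' ^ k * P) (n + k) := by
  induction k with
  | zero => simpa using hP
  | succ k ih => rw [pow_succ', mul_assoc, ← add_assoc]; exact ih.partial_mul

theorem coeff_partial_pow_mul_top {P : DiffOp R} {n : ℕ} (hP : OrderLT P (n + 1)) (k : ℕ) :
    (partial' ^ k * P).coeff (n + k) = P.coeff n := by
  induction k with
  | zero => simp
  | succ k ih =>
    rw [pow_succ', mul_assoc, ← add_assoc, coeff_partial_mul_succ, ih,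
      hP.partial_pow_mul k _ (by omega), map_zero, add_zero]

theorem orderLT_const (a : R) : OrderLT (const a) 1 := fun k hk => by
  rw [coeff_const, if_neg (by omega)]

theorem orderLT_partial_pow (n : ℕ) : OrderLT (partial' ^ n : DiffOp R) (n + 1) := fun k hk => by
  rw [coeff_partial_pow, if_neg (by omega)]

theorem eq_const_of_orderLT_one {P : DiffOp R} (h : OrderLT P 1) : P = const (P.coeff 0) :=
  ext_coeff fun k => by
    rw [coeff_const]
    split_ifs with hk
    · rw [hk]
    · exact h k (by omega)

theorem orderLT_order_succ (P : DiffOp R) : OrderLT P (P.order + 1) := fun _ hk =>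
  Polynomial.coeff_eq_zero_of_natDegree_lt (by exact hk)

theorem order_eq_of_coeff {P : DiffOp R} {n : ℕ} (h : OrderLT P (n + 1)) (hn : P.coeff n ≠ 0) :
    P.order = n :=
  le_antisymm (Polynomial.natDegree_le_iff_coeff_eq_zero.2 fun k hk => h k hk)
    (Polynomial.le_natDegree_of_ne_zero hn)

theorem coeff_order_ne_zero {P : DiffOp R} (h : P ≠ 0) : P.coeff P.order ≠ 0 :=
  Polynomial.leadingCoeff_ne_zero.2 h

theorem order_lt_of_orderLT {P : DiffOp R} {n : ℕ} (h : OrderLT P n) (hP : P ≠ 0) :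
    P.order < n := by
  by_contra hn
  exact coeff_order_ne_zero hP (h _ (by omega))

/-- An operator is the sum of its terms `aᵢ ∂ⁱ`. -/
theorem eq_sum_of_orderLT {P : DiffOp R} {n : ℕ} (h : OrderLT P n) :
    P = ∑ i ∈ Finset.range n, const (P.coeff i) * partial' ^ i :=
  ext_coeff fun k => by
    simp only [coeff_sum, coeff_const_mul, coeff_partial_pow]
    rcases lt_or_ge k n with hk | hk
    · simp [Finset.sum_ite_eq, hk]
    · rw [h k hk]
      symm
      refine Finset.sum_eq_zero fun i hi => ?_
      rw [if_neg (by have := Finset.mem_range.1 hi; omega), mul_zero]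

theorem induction_terms {p : DiffOp R → Prop} (P : DiffOp R)
    (add : ∀ A B, p A → p B → p (A + B)) (term : ∀ a n, p (const a * partial' ^ n)) : p P := by
  rw [eq_sum_of_orderLT (orderLT_order_succ P)]
  generalize P.order + 1 = n
  induction n with
  | zero => simpa [const_zero] using term 0 0
  | succ n ih => rw [Finset.sum_range_succ]; exact add _ _ ih (term _ _)

theorem OrderLT.mul {P Q : DiffOp R} {n m : ℕ} (hP : OrderLT P (n + 1)) (hQ : OrderLT Q m) :
    OrderLT (P * Q) (n + m) := by
  rw [eq_sum_of_orderLT hP, Finset.sum_mul]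
  refine orderLT_sum _ _ fun i hi => ?_
  rw [mul_assoc]
  have := Finset.mem_range.1 hi
  exact ((hQ.partial_pow_mul i).const_mul _).mono (by omega)

theorem coeff_mul_top {P Q : DiffOp R} {n m : ℕ} (hP : OrderLT P (n + 1))
    (hQ : OrderLT Q (m + 1)) : (P * Q).coeff (n + m) = P.coeff n * Q.coeff m := by
  conv_lhs => rw [eq_sum_of_orderLT hP, Finset.sum_mul, coeff_sum, Finset.sum_range_succ]
  rw [Finset.sum_eq_zero, zero_add, mul_assoc, coeff_const_mul, add_comm n m,
    coeff_partial_pow_mul_top hQ]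
  intro i hi
  have := Finset.mem_range.1 hi
  rw [mul_assoc, coeff_const_mul, hQ.partial_pow_mul i _ (by omega), mul_zero]

/-- Multiplication by ∂ on the right differentiates nothing. Together with the formula for left
multiplication, this turns commutators with powers of ∂ into identities of commutative polynomials.
-/
theorem toPoly_mul_partial (P : DiffOp R) : (P * partial').toPoly = P.toPoly * Polynomial.X := by
  induction P using induction_terms with
  | add A B hA hB => rw [add_mul, toPoly_add, toPoly_add, hA, hB, add_mul]
  | term a n =>
    rw [mul_assoc, ← pow_succ]
    ext k
    have h1 := coeff_const_mul a (partial' ^ (n + 1)) k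
    rw [coeff, coeff_partial_pow] at h1
    rw [h1]
    cases k with
    | zero => simp
    | succ k =>
      rw [Polynomial.coeff_mul_X]
      have h2 := coeff_const_mul a (partial' ^ n) k
      rw [coeff, coeff_partial_pow] at h2
      rw [h2]; simp

/-- By ∂a = a∂ + a′ a constant is central. This serves for complex scalars and also for the
variables λ, μ, γ, which are constants by construction. -/
theorem const_mul_comm_of_deriv {a : R} (ha : a′ = 0) (P : DiffOp R) :
    P * const a = const a * P := by
  induction P using induction_terms with
  | add A B hA hB => rw [add_mul, mul_add, hA, hB]
  | term b n =>
    have h : partial' ^ n * const a = const a * partial' ^ n := by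
      induction n with
      | zero => simp
      | succ n ih =>
        rw [pow_succ, mul_assoc, partial_mul_const, ha, const_zero, add_zero, ← mul_assoc, ih,
          mul_assoc]
    rw [mul_assoc, h, ← mul_assoc, ← mul_assoc, ← const_mul, ← const_mul, mul_comm]

end Coefficients

/-! ### Right division by an operator with invertible leading coefficient. -/

section Division

variable {R : Type*} [CommRing R] [Differential R]

/-- Right division by an operator whose leading coefficient is a unit. -/
theorem exists_right_division {P : DiffOp R} {n : ℕ} (hP : OrderLT P (n + 1))
    (hu : IsUnit (P.coeff n)) (m : ℕ) (D : DiffOp R) (hD : OrderLT D (n + m)) :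
    ∃ U, OrderLT U m ∧ OrderLT (D - U * P) n := by
  induction m generalizing D with
  | zero => exact ⟨0, orderLT_zero 0, by simpa using hD⟩
  | succ m ih =>
    obtain ⟨b, hb⟩ := hu.exists_left_inv
    obtain ⟨U, hU, hUP⟩ := ih (D - const (D.coeff (n + m) * b) * partial' ^ m * P) (by
      intro k hk
      rw [coeff_sub, mul_assoc, coeff_const_mul]
      rcases hk.eq_or_lt with rfl | hk
      · rw [coeff_partial_pow_mul_top hP, mul_assoc, hb, mul_one, sub_self]
      · rw [hD k (by omega), hP.partial_pow_mul m k (by omega), mul_zero, sub_zero])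
    refine ⟨U + const (D.coeff (n + m) * b) * partial' ^ m,
      (hU.mono (by omega)).add ((orderLT_partial_pow m).const_mul _), ?_⟩
    convert hUP using 1
    rw [add_mul]; abel

theorem exists_right_division' {P : DiffOp R} {n : ℕ} (hP : OrderLT P (n + 1))
    (hu : IsUnit (P.coeff n)) (D : DiffOp R) : ∃ U, OrderLT (D - U * P) n := by
  obtain ⟨U, -, h⟩ := exists_right_division hP hu (D.order + 1) D
    ((orderLT_order_succ D).mono (by omega))
  exact ⟨U, h⟩

/-- A left multiple of `P` of order less than the one of `P` vanishes. -/
theorem eq_zero_of_orderLT_mul {P U : DiffOp R} {n : ℕ} (hP : OrderLT P (n + 1))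
    (hu : IsUnit (P.coeff n)) (h : OrderLT (U * P) n) : U = 0 := by
  by_contra hU
  have h1 := coeff_mul_top (orderLT_order_succ U) hP
  rw [h _ (by omega)] at h1
  exact coeff_order_ne_zero hU (hu.mul_left_eq_zero.1 h1.symm)

end Division

/-! ### Absence of zero divisors and additivity of the order. -/

section Domain

variable {R : Type*} [CommRing R] [Differential R] [IsDomain R]

instance : IsDomain (DiffOp R) :=
  have : Nontrivial (DiffOp R) := inferInstanceAs (Nontrivial (Polynomial R))
  have : NoZeroDivisors (DiffOp R) := ⟨fun {P Q} h => by
    by_contra! hPQ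
    have h1 := coeff_mul_top (orderLT_order_succ P) (orderLT_order_succ Q)
    rw [h, coeff_zero] at h1
    exact mul_ne_zero (coeff_order_ne_zero hPQ.1) (coeff_order_ne_zero hPQ.2) h1.symm⟩
  NoZeroDivisors.to_isDomain _

theorem order_mul {P Q : DiffOp R} (hP : P ≠ 0) (hQ : Q ≠ 0) :
    (P * Q).order = P.order + Q.order := by
  refine order_eq_of_coeff ((orderLT_order_succ P).mul (orderLT_order_succ Q)) ?_
  rw [coeff_mul_top (orderLT_order_succ P) (orderLT_order_succ Q)]
  exact mul_ne_zero (coeff_order_ne_zero hP) (coeff_order_ne_zero hQ)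

theorem order_pow {P : DiffOp R} (hP : P ≠ 0) (n : ℕ) : (P ^ n).order = n * P.order := by
  induction n with
  | zero => rw [pow_zero, zero_mul]; exact Polynomial.natDegree_one
  | succ n ih => rw [pow_succ, order_mul (pow_ne_zero n hP) hP, ih]; ring

end Domain

/-! ### Change of the differential coefficient ring. -/

section MapCoeff

variable {R S : Type*} [CommRing R] [CommRing S]

theorem coeff_mapCoeff (φ : R →+* S) (P : DiffOp R) (k : ℕ) :
    (P.mapCoeff φ).coeff k = φ (P.coeff k) := Polynomial.coeff_map _ _

variable [Differential R] [Differential S]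

theorem mapCoeff_add (φ : R →+* S) (P Q : DiffOp R) :
    (P + Q).mapCoeff φ = P.mapCoeff φ + Q.mapCoeff φ := Polynomial.map_add _

theorem mapCoeff_sub (φ : R →+* S) (P Q : DiffOp R) :
    (P - Q).mapCoeff φ = P.mapCoeff φ - Q.mapCoeff φ := Polynomial.map_sub _

theorem mapCoeff_const (φ : R →+* S) (a : R) : (const a).mapCoeff φ = const (φ a) :=
  Polynomial.map_C _

theorem mapCoeff_const_mul (φ : R →+* S) (a : R) (P : DiffOp R) :
    (const a * P).mapCoeff φ = const (φ a) * P.mapCoeff φ :=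
  ext_coeff fun k => by
    rw [coeff_mapCoeff, coeff_const_mul, coeff_const_mul, coeff_mapCoeff, map_mul]

variable {φ : R →+* S} (hφ : ∀ a, φ a′ = (φ a)′)
include hφ

theorem mapCoeff_partial_mul (P : DiffOp R) :
    (partial' * P).mapCoeff φ = partial' * P.mapCoeff φ :=
  ext_coeff fun k => by
    cases k with
    | zero => rw [coeff_mapCoeff, coeff_partial_mul_zero, coeff_partial_mul_zero, coeff_mapCoeff, hφ]
    | succ k =>
      rw [coeff_mapCoeff, coeff_partial_mul_succ, coeff_partial_mul_succ, map_add, hφ,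
        coeff_mapCoeff, coeff_mapCoeff]

theorem mapCoeff_partial_pow_mul (n : ℕ) (P : DiffOp R) :
    (partial' ^ n * P).mapCoeff φ = partial' ^ n * P.mapCoeff φ := by
  induction n with
  | zero => simp
  | succ n ih => rw [pow_succ', mul_assoc, mapCoeff_partial_mul hφ, ih, ← mul_assoc, ← pow_succ']

theorem mapCoeff_mul (P Q : DiffOp R) :
    (P * Q).mapCoeff φ = P.mapCoeff φ * Q.mapCoeff φ := by
  induction P using induction_terms with
  | add A B hA hB => rw [add_mul, mapCoeff_add, mapCoeff_add, hA, hB, add_mul]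
  | term a n =>
    rw [mul_assoc, mapCoeff_const_mul, mapCoeff_partial_pow_mul hφ, mapCoeff_const_mul]
    have h := mapCoeff_partial_pow_mul hφ n (1 : DiffOp R)
    rw [mul_one] at h
    rw [h, show (1 : DiffOp R).mapCoeff φ = 1 from Polynomial.map_one _, mul_one, mul_assoc]

end MapCoeff

end DiffOp

/-! ### Boussinesq operators and the centralizer of `L` -/

namespace Bsq

open DiffOp

/-! ### Commutators with `L` and the Boussinesq recursion. -/

section Commutator

variable {K : Type*} [Field K] [Differential K]

/-- The commutator of an operator of order two with `L`, divided by `L`. -/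
theorem commutator_opL (u v f h k : K) :
    (const f * partial' ^ 2 + const h * partial' + const k) * opL u v -
      opL u v * (const f * partial' ^ 2 + const h * partial' + const k) =
    const (2 * f * u′ + 2 * u * f′ - f′′′ - 3 * h′′ - 3 * k′) * partial' ^ 2 +
      const (f * u′′ + 2 * f * v′ + h * u′ - h′′′ - 3 * k′′ - u * h′ + 3 * f′ * (u′ + v) +
        (3 * f′′ + 3 * h′) * u) * partial' +
      const (f * v′′ + h * v′ - k′′′ - u * k′ + 3 * f′ * v′ + (3 * f′′ + 3 * h′) * v) -
    (const (3 * f′) * partial' + const (3 * f′′ + 3 * h′)) * opL u v := by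
  apply toPoly_injective
  have h1 : ∀ P : DiffOp K, partial' ^ 2 * P = partial' * (partial' * P) := fun P => by
    rw [pow_two, mul_assoc]
  have h2 : ∀ P : DiffOp K, partial' ^ 3 * P = partial' * (partial' * (partial' * P)) :=
    fun P => by rw [pow_succ, mul_assoc, h1]
  have e2 : (partial' ^ 2 : DiffOp K).toPoly = Polynomial.X ^ 2 := by
    rw [pow_two, toPoly_mul_partial, toPoly_partial, pow_two]
  have e3 : (partial' ^ 3 : DiffOp K).toPoly = Polynomial.X ^ 3 := by
    rw [pow_succ, toPoly_mul_partial, e2, pow_succ _ 2]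
  have l2 : Polynomial.C (2 : K) = 2 := map_ofNat _ _
  have l3 : Polynomial.C (3 : K) = 3 := map_ofNat _ _
  -- Once every ∂ has been moved past the coefficients, both sides are polynomials in a commuting
  -- variable killed by `mapCoeffs`, and `ring` can compare them.
  simp only [opL, add_mul, mul_assoc, h1, h2, toPoly_add, toPoly_sub, toPoly_const_mul,
    toPoly_partial_mul, toPoly_const, toPoly_partial, e2, e3, map_add, Derivation.leibniz,
    Derivation.leibniz_pow, Differential.mapCoeffs_C, Differential.mapCoeffs_X, smul_eq_mul,
    map_zero, Polynomial.C_mul, Polynomial.C_sub, smul_zero, mul_zero, l2, l3]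
  ring

variable [CharZero K]

theorem deriv_natCast (n : ℕ) : (n : K)′ = 0 := Derivation.map_natCast _ n

theorem deriv_ratConst (a b : ℕ) : ((a : K) / b)′ = 0 := by
  rw [Derivation.leibniz_div_const _ _ _ (deriv_natCast b), deriv_natCast, smul_zero]

/-- The coefficient g - f′/2 and the constant term of `bsqStep` are tuned so that the ∂² coefficient
of the general formula vanishes. What remains is a first-order remainder built from F and G, and a
first-order left factor of L built from f′ and g′. -/
theorem bsqStep_commutator (u v f g : K) :
    bsqStep u f g * opL u v - opL u v * bsqStep u f g =
    const (rhsF u (v - 1 / 2 * u′) f g) * partial' +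
      const (rhsG u (v - 1 / 2 * u′) f g + 1 / 2 * (rhsF u (v - 1 / 2 * u′) f g)′) -
    (const (3 * f′) * partial' + const (3 * g′ + 3 / 2 * f′′)) * opL u v := by
  have d2 : (1 / 2 : K)′ = 0 := by simpa using deriv_ratConst (K := K) 1 2
  have d6 : (1 / 6 : K)′ = 0 := by simpa using deriv_ratConst (K := K) 1 6
  have d3 : (2 / 3 : K)′ = 0 := by simpa using deriv_ratConst (K := K) 2 3
  have n2 : (2 : K)′ = 0 := by simpa using deriv_natCast (K := K) 2
  have n3 : (3 : K)′ = 0 := by simpa using deriv_natCast (K := K) 3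
  rw [bsqStep, commutator_opL]
  have c2 : 2 * f * u′ + 2 * u * f′ - f′′′ - 3 * (g - 1 / 2 * f′)′′ -
      3 * (1 / 6 * f′′ - g′ + 2 / 3 * u * f)′ = 0 := by
    simp only [map_sub, map_add, Derivation.leibniz, d2, d6, d3, smul_eq_mul, mul_zero, add_zero]
    ring
  have c1 : f * u′′ + 2 * f * v′ + (g - 1 / 2 * f′) * u′ - (g - 1 / 2 * f′)′′′ -
      3 * (1 / 6 * f′′ - g′ + 2 / 3 * u * f)′′ - u * (g - 1 / 2 * f′)′ + 3 * f′ * (u′ + v) +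
        (3 * f′′ + 3 * (g - 1 / 2 * f′)′) * u = rhsF u (v - 1 / 2 * u′) f g := by
    simp only [rhsF, map_sub, map_add, Derivation.leibniz, d2, d6, d3, smul_eq_mul, mul_zero,
      add_zero]
    ring
  have c0 : f * v′′ + (g - 1 / 2 * f′) * v′ - (1 / 6 * f′′ - g′ + 2 / 3 * u * f)′′′ -
      u * (1 / 6 * f′′ - g′ + 2 / 3 * u * f)′ + 3 * f′ * v′ +
      (3 * f′′ + 3 * (g - 1 / 2 * f′)′) * v = rhsG u (v - 1 / 2 * u′) f g +
        1 / 2 * (rhsF u (v - 1 / 2 * u′) f g)′ := by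
    simp only [rhsF, rhsG, map_sub, map_add, Derivation.leibniz, d2, d6, d3, n2, n3, smul_eq_mul,
      mul_zero, add_zero]
    ring
  have cq : 3 * f′′ + 3 * (g - 1 / 2 * f′)′ = 3 * g′ + 3 / 2 * f′′ := by
    simp only [map_sub, Derivation.leibniz, d2, smul_eq_mul, mul_zero, add_zero]
    ring
  rw [c2, c1, c0, cq, const_zero, zero_mul, zero_add]

/-- The remainder of the commutator of `bsqStep u f g` with `L` modulo `L`. -/
def commRem (u v f g : K) : DiffOp K :=
  const (rhsF u (v - 1 / 2 * u′) f g) * partial' +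
    const (rhsG u (v - 1 / 2 * u′) f g + 1 / 2 * (rhsF u (v - 1 / 2 * u′) f g)′)

/-- The quotient, up to sign, of the commutator of `bsqStep u f g` with `L` by `L`. -/
def commQuot (f g : K) : DiffOp K :=
  const (3 * f′) * partial' + const (3 * g′ + 3 / 2 * f′′)

theorem linear_inj {a b c d : K}
    (h : const a * partial' + const b = const c * partial' + const d) : a = c ∧ b = d := by
  have h0 := congrArg (fun P => P.coeff 0) h
  have h1 := congrArg (fun P => P.coeff 1) h
  have e : ∀ k, (partial' : DiffOp K).coeff k = if k = 1 then 1 else 0 := fun k => by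
    simpa using coeff_partial_pow (R := K) 1 k
  simp only [coeff_add, coeff_const_mul, coeff_const, e] at h0 h1
  exact ⟨by simpa using h1, by simpa using h0⟩

theorem half_deriv_three_mul (f : K) : 1 / 2 * (3 * f′)′ = 3 / 2 * f′′ := by
  have n3 : (3 : K)′ = 0 := by simpa using deriv_natCast (K := K) 3
  rw [Derivation.leibniz, n3]
  simp only [smul_eq_mul, mul_zero, add_zero]
  ring

/-- The coefficients of ∂ compare 3f₁′ with F. Given this equality, the terms 3f₁′′/2 and F′/2
cancel in order zero and leave the comparison of 3g₁′ with G. -/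
theorem commRem_eq_commQuot_iff (u v f g f₁ g₁ : K) :
    commRem u v f g = commQuot f₁ g₁ ↔
      3 * f₁′ = rhsF u (v - 1 / 2 * u′) f g ∧ 3 * g₁′ = rhsG u (v - 1 / 2 * u′) f g := by
  constructor
  · intro h
    obtain ⟨h1, h2⟩ := linear_inj h
    refine ⟨h1.symm, ?_⟩
    rw [h1, half_deriv_three_mul] at h2
    exact (add_right_cancel h2).symm
  · rintro ⟨h1, h2⟩
    rw [commRem, commQuot, ← h1, ← h2, half_deriv_three_mul]

theorem orderLT_partial : OrderLT (partial' : DiffOp K) 2 := by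
  simpa using orderLT_partial_pow (R := K) 1

theorem orderLT_opL (u v : K) : OrderLT (opL u v) 4 :=
  ((orderLT_partial_pow 3).add ((orderLT_partial.const_mul u).mono (by norm_num))).add
    ((orderLT_const v).mono (by norm_num))

theorem coeff_opL (u v : K) : (opL u v).coeff 3 = 1 := by
  simp only [opL, coeff_add, coeff_partial_pow, coeff_const]
  rw [(orderLT_partial.const_mul u) 3 (by norm_num)]
  simp

theorem isUnit_coeff_opL (u v : K) : IsUnit ((opL u v).coeff 3) := by
  rw [coeff_opL]; exact isUnit_one

theorem order_opL (u v : K) : (opL u v).order = 3 :=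
  order_eq_of_coeff (orderLT_opL u v) (by rw [coeff_opL]; exact one_ne_zero)

theorem orderLT_quadratic (a b c : K) :
    OrderLT (const a * partial' ^ 2 + const b * partial' + const c) 3 :=
  (((orderLT_partial_pow 2).const_mul a).add
    ((orderLT_partial.const_mul b).mono (by norm_num))).add
      ((orderLT_const c).mono (by norm_num))

theorem coeff_two_quadratic (a b c : K) :
    (const a * partial' ^ 2 + const b * partial' + const c).coeff 2 = a := by
  rw [coeff_add, coeff_add, coeff_const_mul, coeff_partial_pow,
    (orderLT_partial.const_mul b) 2 le_rfl, coeff_const]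
  simp

theorem eq_quadratic {P : DiffOp K} (h : OrderLT P 3) :
    P = const (P.coeff 2) * partial' ^ 2 + const (P.coeff 1) * partial' + const (P.coeff 0) := by
  conv_lhs => rw [eq_sum_of_orderLT h]
  rw [Finset.sum_range_succ, Finset.sum_range_succ, Finset.sum_range_one]
  simp only [pow_zero, pow_one, mul_one]
  abel

theorem orderLT_bsqStep (u f g : K) : OrderLT (bsqStep u f g) 3 := orderLT_quadratic _ _ _

theorem bsqOp_congr (u v : K) {f g f' g' : ℕ → K} {n : ℕ} (hf : ∀ k ≤ n, f k = f' k)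
    (hg : ∀ k ≤ n, g k = g' k) : bsqOp u v f g n = bsqOp u v f' g' n := by
  induction n with
  | zero => rw [bsqOp, bsqOp, hf 0 le_rfl, hg 0 le_rfl]
  | succ n ih =>
    rw [bsqOp, bsqOp, ih (fun k hk => hf k (by omega)) (fun k hk => hg k (by omega)),
      hf _ le_rfl, hg _ le_rfl]

variable [Algebra ℂ K]

theorem IsBsqSequence.eq_one_or_two {u v : K} {i n : ℕ} {f g : ℕ → K}
    (h : IsBsqSequence u v i n f g) : i = 1 ∨ i = 2 :=
  h.init.imp And.left And.left

theorem IsBsqSequence.of_succ {u v : K} {i n : ℕ} {f g : ℕ → K}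
    (h : IsBsqSequence u v i (n + 1) f g) : IsBsqSequence u v i n f g :=
  ⟨h.init, fun k hk => h.stepF k (by omega), fun k hk => h.stepG k (by omega)⟩

variable (hK : ∀ a : K, a′ = 0 ↔ a ∈ Set.range (algebraMap ℂ K))
include hK

/-- The last digit `R` in base `L` of an operator whose commutator with `L` has order at most one
is, up to a constant, a Boussinesq operator of order at most two. -/
theorem digit_eq_bsqStep (u v : K) {E E' R : DiffOp K} (hR : OrderLT R 3) (hE : OrderLT E 2)
    (h : E' * opL u v + (R * opL u v - opL u v * R) = E) :
    ∃ (f g : K) (c : ℂ), R = bsqStep u f g + const (algebraMap ℂ K c) ∧ E' = commQuot f g ∧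
      E = commRem u v f g ∧ R.coeff 2 = f ∧ R.coeff 1 = g - 1 / 2 * f′ := by
  have d2 : (1 / 2 : K)′ = 0 := by simpa using deriv_ratConst (K := K) 1 2
  have d6 : (1 / 6 : K)′ = 0 := by simpa using deriv_ratConst (K := K) 1 6
  have d3 : (2 / 3 : K)′ = 0 := by simpa using deriv_ratConst (K := K) 2 3
  obtain ⟨f, hf⟩ : ∃ f, f = R.coeff 2 := ⟨_, rfl⟩
  obtain ⟨g, hg⟩ : ∃ g, g = R.coeff 1 + 1 / 2 * f′ := ⟨_, rfl⟩
  obtain ⟨k, hk⟩ : ∃ k, k = R.coeff 0 := ⟨_, rfl⟩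
  have hh : R.coeff 1 = g - 1 / 2 * f′ := by rw [hg]; ring
  have hRq := eq_quadratic hR
  rw [← hf, hh, ← hk] at hRq
  have hc := commutator_opL u v f (g - 1 / 2 * f′) k
  rw [← hRq] at hc
  have cq : 3 * f′′ + 3 * (g - 1 / 2 * f′)′ = 3 * g′ + 3 / 2 * f′′ := by
    simp only [map_sub, Derivation.leibniz, d2, smul_eq_mul, mul_zero, add_zero]
    ring
  rw [cq, show const (3 * f′) * partial' + const (3 * g′ + 3 / 2 * f′′) = commQuot f g from rfl]
    at hc
  rw [hc] at h
  set S := const (2 * f * u′ + 2 * u * f′ - f′′′ - 3 * (g - 1 / 2 * f′)′′ - 3 * k′) * partial' ^ 2 +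
    const (f * u′′ + 2 * f * v′ + (g - 1 / 2 * f′) * u′ - (g - 1 / 2 * f′)′′′ - 3 * k′′ -
      u * (g - 1 / 2 * f′)′ + 3 * f′ * (u′ + v) + (3 * g′ + 3 / 2 * f′′) * u) * partial' +
    const (f * v′′ + (g - 1 / 2 * f′) * v′ - k′′′ - u * k′ + 3 * f′ * v′ +
      (3 * g′ + 3 / 2 * f′′) * v) with hS
  -- E and S have order at most two, whereas a nonzero left multiple of L has order at least three;
  -- so the quotients and the remainders agree separately.
  have hq : E' - commQuot f g = 0 := by
    refine eq_zero_of_orderLT_mul (orderLT_opL u v) (isUnit_coeff_opL u v) ?_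
    have : (E' - commQuot f g) * opL u v = E - S := by rw [← h, sub_mul]; abel
    rw [this]
    exact (hE.mono (by norm_num)).sub (orderLT_quadratic _ _ _)
  have hE' : E' = commQuot f g := sub_eq_zero.1 hq
  have hES : E = S := by rw [← h, hE']; abel
  have h2 : 2 * f * u′ + 2 * u * f′ - f′′′ - 3 * (g - 1 / 2 * f′)′′ - 3 * k′ = 0 := by
    rw [← coeff_two_quadratic (2 * f * u′ + 2 * u * f′ - f′′′ - 3 * (g - 1 / 2 * f′)′′ - 3 * k′),
      ← hS, ← hES]
    exact hE 2 le_rfl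
  -- The missing ∂² coefficient fixes k′, hence fixes k up to a complex constant.
  obtain ⟨c, hc'⟩ := (hK (k - (1 / 6 * f′′ - g′ + 2 / 3 * u * f))).1 (by
    simp only [map_sub, map_add, Derivation.leibniz, d2, d6, d3, smul_eq_mul, mul_zero,
      add_zero] at h2 ⊢
    linear_combination (-1 / 3) * h2)
  have hRb : R = bsqStep u f g + const (algebraMap ℂ K c) := by
    have hk' : k = (1 / 6 * f′′ - g′ + 2 / 3 * u * f) + algebraMap ℂ K c := by rw [hc']; ring
    rw [hRq, bsqStep, hk', const_add]
    exact (add_assoc _ _ _).symm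
  refine ⟨f, g, c, hRb, hE', ?_, hf.symm, hh⟩
  have hcomm : R * opL u v - opL u v * R = commRem u v f g - commQuot f g * opL u v := by
    rw [hRb, add_mul, mul_add, const_mul_comm_of_deriv ((hK _).2 ⟨c, rfl⟩), add_sub_add_right_eq_sub,
      bsqStep_commutator]
    rfl
  rw [hES]
  exact sub_left_injective (hc.symm.trans hcomm)

theorem deriv_algebraMap_complex (c : ℂ) : (algebraMap ℂ K c)′ = 0 := (hK _).2 ⟨c, rfl⟩

/-- The value at `P` of a polynomial with complex coefficients. -/
def polyAt (P : DiffOp K) : Polynomial ℂ →+* DiffOp K :=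
  Polynomial.eval₂RingHom' (constHom.comp (algebraMap ℂ K)) P fun c =>
    (const_mul_comm_of_deriv (deriv_algebraMap_complex hK c) P).symm

theorem polyAt_C (P : DiffOp K) (c : ℂ) :
    polyAt hK P (Polynomial.C c) = const (algebraMap ℂ K c) := Polynomial.eval₂_C _ _

theorem polyAt_X (P : DiffOp K) : polyAt hK P Polynomial.X = P := Polynomial.eval₂_X _ _

theorem const_algebraMap_mul_comm (c : ℂ) (P : DiffOp K) :
    P * const (algebraMap ℂ K c) = const (algebraMap ℂ K c) * P :=
  const_mul_comm_of_deriv (deriv_algebraMap_complex hK c) P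

theorem commute_polyAt {P Q : DiffOp K} (h : Q * P = P * Q) (p : Polynomial ℂ) :
    Q * polyAt hK P p = polyAt hK P p * Q := by
  induction p using Polynomial.induction_on' with
  | add p q hp hq => rw [map_add, mul_add, add_mul, hp, hq]
  | monomial n c =>
    rw [← Polynomial.C_mul_X_pow_eq_monomial, map_mul, map_pow, polyAt_C, polyAt_X, ← mul_assoc,
      const_algebraMap_mul_comm hK, mul_assoc, mul_assoc]
    congr 1
    exact (Commute.pow_right h n).eq

/-- The sum telescopes: [P L + R, L] = [P, L] L + [R, L], and the left multiple of L produced by the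
new digit cancels the remainder left by the previous ones. -/
theorem bsqOp_commutator {u v : K} {i n : ℕ} {f g : ℕ → K} (h : IsBsqSequence u v i n f g) :
    bsqOp u v f g n * opL u v - opL u v * bsqOp u v f g n = commRem u v (f n) (g n) := by
  induction n with
  | zero =>
    have h0 : (f 0)′ = 0 ∧ (g 0)′ = 0 := by
      rcases h.init with ⟨-, hf, hg⟩ | ⟨-, hf, c, hg⟩
      · rw [hf, hg]; simp
      · rw [hf, hg]; exact ⟨by simp, deriv_algebraMap_complex hK c⟩
    rw [bsqOp, bsqStep_commutator, h0.1, h0.2, commRem]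
    simp [const_zero]
  | succ n ih =>
    have h1 := ih h.of_succ
    have h2 := (commRem_eq_commQuot_iff u v (f n) (g n) (f (n + 1)) (g (n + 1))).2
      ⟨h.stepF n (by omega), h.stepG n (by omega)⟩
    have h3 := bsqStep_commutator u v (f (n + 1)) (g (n + 1))
    have h4 : bsqOp u v f g (n + 1) * opL u v - opL u v * bsqOp u v f g (n + 1) =
        (bsqOp u v f g n * opL u v - opL u v * bsqOp u v f g n) * opL u v +
        (bsqStep u (f (n + 1)) (g (n + 1)) * opL u v -
          opL u v * bsqStep u (f (n + 1)) (g (n + 1))) := by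
      rw [bsqOp]; noncomm_ring
    rw [h4, h1, h2, h3, commRem, commQuot]
    abel

theorem orderLT_bsqOp {u v : K} {i n : ℕ} {f g : ℕ → K} (h : IsBsqSequence u v i n f g) :
    OrderLT (bsqOp u v f g n) (3 * n + i + 1) ∧ (bsqOp u v f g n).coeff (3 * n + i) = 1 := by
  have hi := h.eq_one_or_two
  induction n with
  | zero =>
    rcases h.init with ⟨rfl, hf, hg⟩ | ⟨rfl, hf, c, hg⟩
    · rw [bsqOp, hf, hg, bsqStep]
      simp only [const_zero, zero_mul, zero_add, mul_zero, add_zero, map_zero, sub_zero,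
        Derivation.map_one_eq_zero, const_one, one_mul]
      refine ⟨orderLT_partial, ?_⟩
      simpa using coeff_partial_pow (R := K) 1 1
    · refine ⟨orderLT_bsqStep _ _ _, ?_⟩
      rw [bsqOp, bsqStep]
      rw [coeff_two_quadratic, hf]
  | succ n ih =>
    obtain ⟨h1, h2⟩ := ih h.of_succ
    have h3 := h1.mul (orderLT_opL u v)
    have h4 := coeff_mul_top h1 (orderLT_opL u v)
    have h5 := orderLT_bsqStep u (f (n + 1)) (g (n + 1))
    rw [bsqOp]
    refine ⟨(h3.mono (by omega)).add (h5.mono (by omega)), ?_⟩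
    rw [coeff_add, h5 _ (by omega), add_zero, show 3 * (n + 1) + i = 3 * n + i + 3 by ring, h4, h2,
      coeff_opL, one_mul]

/-- A monic operator of order `3 n + i`, `i ∈ {1, 2}`, whose commutator with `L` has order at most
one is the sum of a Boussinesq operator and a polynomial in `L`. -/
theorem exists_eq_bsqOp_add {u v : K} {i : ℕ} (hi : i = 1 ∨ i = 2) (n : ℕ) (B : DiffOp K)
    (hB : OrderLT B (3 * n + i + 1)) (hB1 : B.coeff (3 * n + i) = 1)
    (hc : OrderLT (B * opL u v - opL u v * B) 2) :
    ∃ (f g : ℕ → K) (p : Polynomial ℂ), IsBsqSequence u v i n f g ∧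
      B = bsqOp u v f g n + polyAt hK (opL u v) p ∧
      B * opL u v - opL u v * B = commRem u v (f n) (g n) := by
  induction n generalizing B with
  | zero =>
    -- There is no higher digit, so the quotient is zero; this forces f and g to be constants, as
    -- the initial condition requires.
    obtain ⟨f, g, c, h1, h2, h3, h4, h5⟩ := digit_eq_bsqStep hK u v
      (hB.mono (by omega)) hc (E' := 0) (by rw [zero_mul, zero_add])
    have h2' : const (3 * f′) * partial' + const (3 * g′ + 3 / 2 * f′′) =
        const (0 : K) * partial' + const 0 := by
      rw [const_zero, zero_mul, add_zero]; exact h2.symm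
    obtain ⟨h6, h7⟩ := linear_inj h2'
    have hf : f′ = 0 := by simpa using h6
    have hg : g′ = 0 := by simpa [hf] using h7
    refine ⟨fun _ => f, fun _ => g, Polynomial.C c, ⟨?_, by simp, by simp⟩, ?_, h3⟩
    · rcases hi with rfl | rfl
      · left
        have hf0 : f = 0 := by rw [← h4]; exact hB 2 le_rfl
        exact ⟨rfl, hf0, by simpa [hf0, ← hB1] using h5.symm⟩
      · right
        obtain ⟨c', hc'⟩ := (hK g).1 hg
        exact ⟨rfl, h4.symm.trans hB1, c', hc'.symm⟩
    · rw [polyAt_C]; exact h1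
  | succ n ih =>
    obtain ⟨B', hB', hR⟩ := exists_right_division (orderLT_opL u v) (isUnit_coeff_opL u v)
      (3 * n + i + 1) B (hB.mono (by omega))
    have hB'1 : B'.coeff (3 * n + i) = 1 := by
      have e1 := coeff_mul_top hB' (orderLT_opL u v)
      have e2 := hR (3 * n + i + 3) (by omega)
      rw [coeff_sub, show 3 * n + i + 3 = 3 * (n + 1) + i by ring, hB1] at e2
      rw [show 3 * n + i + 3 = 3 * (n + 1) + i by ring, coeff_opL, mul_one] at e1
      rw [← e1]
      exact (sub_eq_zero.1 e2).symm
    -- Here [B, L] = [B′, L] L + [R, L]. The digit lemma shows that [B′, L] is a first-order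
    -- quotient, which permits the induction on B′; equating it with the last remainder of B′ gives
    -- the next step of the recursion.
    obtain ⟨f', g', c, h1, h2, h3, -⟩ := digit_eq_bsqStep hK u v hR hc
      (E' := B' * opL u v - opL u v * B') (by noncomm_ring)
    obtain ⟨f, g, p, h4, h5, h6⟩ := ih B' hB' hB'1 (by
      rw [h2, commQuot]
      exact (orderLT_partial.const_mul _).add ((orderLT_const _).mono (by norm_num)))
    obtain ⟨h7, h8⟩ := (commRem_eq_commQuot_iff u v (f n) (g n) f' g').1 (h6.symm.trans h2)
    have hne : ∀ k, k ≤ n → k ≠ n + 1 := fun k hk => by omega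
    refine ⟨Function.update f (n + 1) f', Function.update g (n + 1) g',
      p * Polynomial.X + Polynomial.C c, ⟨?_, ?_, ?_⟩, ?_, ?_⟩
    · simpa using h4.init
    · intro k hk
      rcases (Nat.lt_succ_iff.1 hk).eq_or_lt with rfl | hk'
      · simpa using h7
      · have := h4.stepF k hk'
        rwa [Function.update_of_ne (by omega), Function.update_of_ne (by omega),
          Function.update_of_ne (by omega)]
    · intro k hk
      rcases (Nat.lt_succ_iff.1 hk).eq_or_lt with rfl | hk'
      · simpa using h8
      · have := h4.stepG k hk'
        rwa [Function.update_of_ne (by omega), Function.update_of_ne (by omega),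
          Function.update_of_ne (by omega)]
    · rw [bsqOp, Function.update_self, Function.update_self, map_add, map_mul, polyAt_X, polyAt_C,
        bsqOp_congr u v (f' := f) (g' := g)
          (fun k hk => Function.update_of_ne (hne k hk) _ _)
          (fun k hk => Function.update_of_ne (hne k hk) _ _)]
      have h9 : B = B' * opL u v + (B - B' * opL u v) := by abel
      rw [h9, h1, h5, add_mul]
      abel
    · rw [Function.update_self, Function.update_self]; exact h3

end Commutator

end Bsq

/-! ### Sums of operators of pairwise different orders. -/

namespace DiffOp

theorem ne_zero_of_order_mod {R : Type*} [CommRing R] [Differential R] {A : DiffOp R} {n i : ℕ}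
    (h : A.order % n = i) (hi : i ≠ 0) : A ≠ 0 := fun h0 => hi <| by
  rw [← h, h0, show (0 : DiffOp R).order = 0 from Polynomial.natDegree_zero, Nat.zero_mod]

/-- If the nonzero members of a finite family have pairwise different orders, then the degree of
the sum is the maximum of the degrees. -/
theorem degree_sum_of_order_ne {R : Type*} [CommRing R] [Differential R] {n : ℕ}
    (P : Fin n → DiffOp R)
    (h : ∀ i j, i ≠ j → P i ≠ 0 → P j ≠ 0 → (P i).order ≠ (P j).order) :
    (∑ i, P i).toPoly.degree = Finset.univ.sup fun i => (P i).toPoly.degree := by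
  refine Polynomial.degree_sum_eq_of_disjoint (fun i => (P i).toPoly) Finset.univ ?_
  intro i hi j hj hij hd
  exact h i j hij hi.2 hj.2 (Polynomial.natDegree_eq_of_degree_eq hd)

/-- Leading terms of different orders cannot cancel. This is the independence argument behind every
count modulo 3. -/
theorem eq_zero_of_sum_eq_zero {R : Type*} [CommRing R] [Differential R] {n : ℕ}
    {P : Fin n → DiffOp R}
    (h : ∀ i j, i ≠ j → P i ≠ 0 → P j ≠ 0 → (P i).order ≠ (P j).order)
    (h0 : ∑ i, P i = 0) (i : Fin n) : P i = 0 := by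
  have h1 := degree_sum_of_order_ne P h
  have h2 : (P i).toPoly.degree ≤ (∑ i, P i).toPoly.degree := by
    rw [h1]; exact Finset.le_sup (f := fun i => (P i).toPoly.degree) (Finset.mem_univ i)
  rw [h0] at h2
  exact Polynomial.degree_eq_bot.1 (le_bot_iff.1 (h2.trans_eq Polynomial.degree_zero))

end DiffOp

namespace Bsq

open DiffOp

/-! ### The centralizer of `L` as a free module over ℂ[L]. -/

section Centralizer

variable {K : Type*} [Field K] [Differential K] [CharZero K]

/-- Only ∂³ contributes in order n + 2: with B′ the coefficientwise derivative, [∂³, B] = 3B′∂² +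
3B″∂ + B‴, while u∂ + v produces order at most n + 1. Operators commuting with L thus have constant
leading coefficients. -/
theorem coeff_commutator_opL (u v : K) {B : DiffOp K} {n : ℕ} (hB : OrderLT B (n + 1)) :
    (opL u v * B - B * opL u v).coeff (n + 2) = 3 * (B.coeff n)′ := by
  have h2 : ∀ P : DiffOp K, partial' ^ 3 * P = partial' * (partial' * (partial' * P)) :=
    fun P => by rw [pow_succ, pow_two, mul_assoc, mul_assoc]
  have h3 : ∀ P : DiffOp K, P * partial' ^ 3 = ((P * partial') * partial') * partial' :=
    fun P => by rw [pow_succ, pow_two, mul_assoc, mul_assoc, mul_assoc]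
  have e1 : opL u v * B - B * opL u v = (partial' ^ 3 * B - B * partial' ^ 3) +
      (const u * (partial' * B) + const v * B - B * (const u * partial' + const v)) := by
    rw [opL]; noncomm_ring
  have e2 : OrderLT (const u * (partial' * B) + const v * B - B * (const u * partial' + const v))
      (n + 2) := by
    refine ((hB.partial_mul.const_mul u).add ((hB.const_mul v).mono (by omega))).sub ?_
    exact hB.mul ((orderLT_partial.const_mul u).add ((orderLT_const v).mono (by norm_num)))
  rw [e1, coeff_add, e2 _ le_rfl, add_zero]
  have e3 : (partial' ^ 3 * B - B * partial' ^ 3).toPoly =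
      3 * (Differential.mapCoeffs B.toPoly * Polynomial.X * Polynomial.X) +
      3 * (Differential.mapCoeffs (Differential.mapCoeffs B.toPoly) * Polynomial.X) +
      Differential.mapCoeffs (Differential.mapCoeffs (Differential.mapCoeffs B.toPoly)) := by
    simp only [h2, h3, toPoly_sub, toPoly_partial_mul, toPoly_mul_partial, map_add,
      Derivation.leibniz, Differential.mapCoeffs_X, smul_eq_mul, mul_zero, add_zero]
    ring
  have hB1 : B.toPoly.coeff (n + 1) = 0 := hB (n + 1) le_rfl
  have hB2 : B.toPoly.coeff (n + 2) = 0 := hB (n + 2) (by omega)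
  rw [coeff, e3, ← map_ofNat Polynomial.C 3]
  simp only [Polynomial.coeff_add, Polynomial.coeff_C_mul, Polynomial.coeff_mul_X, coeff_mapCoeffs,
    hB1, hB2, map_zero, mul_zero, add_zero]
  rfl

theorem deriv_leadingCoeff {u v : K} {B : DiffOp K} {n : ℕ} (hB : OrderLT B (n + 1))
    (h : B * opL u v = opL u v * B) : (B.coeff n)′ = 0 := by
  have h1 := coeff_commutator_opL u v hB
  rw [h, sub_self, coeff_zero] at h1
  simpa using h1.symm

variable [Algebra ℂ K] (hK : ∀ a : K, a′ = 0 ↔ a ∈ Set.range (algebraMap ℂ K))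
include hK

/-- The operators that commute with `L` have complex leading coefficients. -/
theorem exists_leadingCoeff {u v : K} {B : DiffOp K} (h : B * opL u v = opL u v * B) :
    ∃ c : ℂ, B.coeff B.order = algebraMap ℂ K c := by
  obtain ⟨c, hc⟩ := (hK _).1 (deriv_leadingCoeff (orderLT_order_succ B) h)
  exact ⟨c, hc.symm⟩

/-- The degree bound need not be sharp, so that the induction can strip constant terms with `divX`.
-/
theorem polyAt_opL_top (u v : K) (n : ℕ) (p : Polynomial ℂ) (hp : p.natDegree ≤ n) :
    OrderLT (polyAt hK (opL u v) p) (3 * n + 1) ∧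
      (polyAt hK (opL u v) p).coeff (3 * n) = algebraMap ℂ K (p.coeff n) := by
  induction n generalizing p with
  | zero =>
    rw [Polynomial.eq_C_of_natDegree_le_zero hp, polyAt_C]
    exact ⟨orderLT_const _, by simp [coeff_const]⟩
  | succ n ih =>
    obtain ⟨h1, h2⟩ := ih p.divX (by rw [Polynomial.natDegree_divX_eq_natDegree_tsub_one]; omega)
    have h3 := h1.mul (orderLT_opL u v)
    have h4 := coeff_mul_top h1 (orderLT_opL u v)
    have h5 := orderLT_const (algebraMap ℂ K (p.coeff 0))
    conv in polyAt hK (opL u v) p => rw [← p.divX_mul_X_add]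
    conv in (polyAt hK (opL u v) p).coeff _ => rw [← p.divX_mul_X_add]
    rw [map_add, map_mul, polyAt_X, polyAt_C]
    refine ⟨(h3.mono (by omega)).add (h5.mono (by omega)), ?_⟩
    rw [coeff_add, h5 _ (by omega), add_zero, show 3 * (n + 1) = 3 * n + 3 by ring, h4, h2,
      coeff_opL, mul_one, Polynomial.coeff_divX]

theorem polyAt_opL_ne_zero (u v : K) {p : Polynomial ℂ} (hp : p ≠ 0) :
    polyAt hK (opL u v) p ≠ 0 ∧ (polyAt hK (opL u v) p).order = 3 * p.natDegree := by
  obtain ⟨h1, h2⟩ := polyAt_opL_top hK u v _ p le_rfl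
  have h3 : (polyAt hK (opL u v) p).coeff (3 * p.natDegree) ≠ 0 := by
    rw [h2]
    exact (map_ne_zero _).2 (Polynomial.leadingCoeff_ne_zero.2 hp)
  exact ⟨fun h => h3 (by rw [h, coeff_zero]), order_eq_of_coeff h1 h3⟩

theorem order_polyAt_mul {u v : K} {p : Polynomial ℂ} {B : DiffOp K}
    (h : polyAt hK (opL u v) p * B ≠ 0) :
    (polyAt hK (opL u v) p * B).order = 3 * p.natDegree + B.order := by
  have hp : p ≠ 0 := fun hp => h (by rw [hp, map_zero, zero_mul])
  rw [order_mul (polyAt_opL_ne_zero hK u v hp).1 (fun hB => h (by rw [hB, mul_zero])),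
    (polyAt_opL_ne_zero hK u v hp).2]

/-- Polynomials in `L` times three operators whose orders are pairwise incongruent modulo `3`. -/
theorem order_ne_of_mod_ne (u v : K) (p : Fin 3 → Polynomial ℂ) (B : Fin 3 → DiffOp K)
    (hB : ∀ i j, i ≠ j → (B i).order % 3 ≠ (B j).order % 3) (i j : Fin 3) (hij : i ≠ j)
    (hi : polyAt hK (opL u v) (p i) * B i ≠ 0) (hj : polyAt hK (opL u v) (p j) * B j ≠ 0) :
    (polyAt hK (opL u v) (p i) * B i).order ≠ (polyAt hK (opL u v) (p j) * B j).order := by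
  rw [order_polyAt_mul hK hi, order_polyAt_mul hK hj]
  have := hB i j hij
  omega

theorem commute_const_mul {P : DiffOp K} (c : ℂ) {B : DiffOp K} (h : B * P = P * B) :
    const (algebraMap ℂ K c) * B * P = P * (const (algebraMap ℂ K c) * B) := by
  rw [mul_assoc, h, ← mul_assoc, ← const_algebraMap_mul_comm hK, mul_assoc]

/-- Leading coefficients are complex and the orders differ by a multiple of three, so a scalar
multiple of some Lᵏ E has the same leading term as B. -/
theorem exists_reduction {u v : K} {B E : DiffOp K} (hE0 : E ≠ 0)
    (hB : B * opL u v = opL u v * B) (hE : E * opL u v = opL u v * E)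
    (hle : E.order ≤ B.order) (hmod : E.order % 3 = B.order % 3) :
    ∃ p : Polynomial ℂ, OrderLT (B - polyAt hK (opL u v) p * E) B.order := by
  obtain ⟨b, hb⟩ := exists_leadingCoeff hK hB
  obtain ⟨e, he⟩ := exists_leadingCoeff hK hE
  have he0 : e ≠ 0 := fun h => coeff_order_ne_zero hE0 (by rw [he, h, map_zero])
  obtain ⟨k, hk⟩ : ∃ k, B.order = 3 * k + E.order := ⟨(B.order - E.order) / 3, by omega⟩
  refine ⟨Polynomial.monomial k (b / e), ?_⟩
  obtain ⟨h1, h2⟩ := polyAt_opL_top hK u v k (Polynomial.monomial k (b / e))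
    (Polynomial.natDegree_monomial_le _)
  have h3 := h1.mul (orderLT_order_succ E)
  have h4 := coeff_mul_top h1 (orderLT_order_succ E)
  rw [← add_assoc, ← hk] at h3
  rw [← hk, h2, he, Polynomial.coeff_monomial, if_pos rfl, ← map_mul, div_mul_cancel₀ _ he0] at h4
  intro m hm
  rcases hm.eq_or_lt with rfl | hm
  · rw [coeff_sub, h4, hb, sub_self]
  · rw [coeff_sub, h3 m (by omega), orderLT_order_succ B m (by omega), sub_zero]

section Generators

variable {u v : K} {A₁ A₂ : DiffOp K} (h₁ : IsMinimalCommuting (opL u v) 1 A₁)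
  (h₂ : IsMinimalCommuting (opL u v) 2 A₂)
include h₁ h₂

/-- The centralizer of `L` is generated by `1, A₁, A₂` over the polynomials in `L`. -/
theorem exists_eq_polyAt_add {B : DiffOp K} (hB : B * opL u v = opL u v * B) :
    ∃ p q r : Polynomial ℂ, B = polyAt hK (opL u v) p + polyAt hK (opL u v) q * A₁ +
      polyAt hK (opL u v) r * A₂ := by
  have key : ∀ n, ∀ B : DiffOp K, OrderLT B n → B * opL u v = opL u v * B →
      ∃ p q r : Polynomial ℂ, B = polyAt hK (opL u v) p + polyAt hK (opL u v) q * A₁ +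
        polyAt hK (opL u v) r * A₂ := by
    intro n
    induction n using Nat.strong_induction_on with
    | _ n ih =>
      intro B hn hB
      by_cases hB0 : B = 0
      · exact ⟨0, 0, 0, by simp [hB0]⟩
      have hlt := order_lt_of_orderLT hn hB0
      have hcomm : ∀ (E : DiffOp K) (p : Polynomial ℂ), E * opL u v = opL u v * E →
          (B - polyAt hK (opL u v) p * E) * opL u v =
            opL u v * (B - polyAt hK (opL u v) p * E) := fun E p hE => by
        rw [sub_mul, mul_sub, hB, mul_assoc, hE, ← mul_assoc, ← mul_assoc,
          commute_polyAt hK rfl]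
      have h3 : B.order % 3 = 0 ∨ B.order % 3 = 1 ∨ B.order % 3 = 2 := by omega
      have o1 : (1 : DiffOp K).order = 0 := Polynomial.natDegree_one
      rcases h3 with h3 | h3 | h3
      -- The identity serves as the minimal operator of residue zero.
      · obtain ⟨p', hp'⟩ := exists_reduction hK (E := 1) one_ne_zero hB (by simp)
          (by omega) (by omega)
        obtain ⟨p, q, r, h⟩ := ih _ hlt _ hp' (hcomm 1 p' (by simp))
        exact ⟨p + p', q, r, by rw [sub_eq_iff_eq_add.1 h, map_add]; noncomm_ring⟩
      · obtain ⟨p', hp'⟩ := exists_reduction hK (ne_zero_of_order_mod h₁.2.1 one_ne_zero) hB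
          h₁.1
          (h₁.2.2 B hB h3) (by rw [h₁.2.1, h3])
        obtain ⟨p, q, r, h⟩ := ih _ hlt _ hp' (hcomm A₁ p' h₁.1)
        exact ⟨p, q + p', r, by rw [sub_eq_iff_eq_add.1 h, map_add]; noncomm_ring⟩
      · obtain ⟨p', hp'⟩ := exists_reduction hK (ne_zero_of_order_mod h₂.2.1 two_ne_zero) hB
          h₂.1
          (h₂.2.2 B hB h3) (by rw [h₂.2.1, h3])
        obtain ⟨p, q, r, h⟩ := ih _ hlt _ hp' (hcomm A₂ p' h₂.1)
        exact ⟨p, q, r + p', by rw [sub_eq_iff_eq_add.1 h, map_add]; noncomm_ring⟩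
  exact key _ B (orderLT_order_succ B) hB

/-- With r = 0 the operators p(L), q(L)A₁ and A₁² would be dependent, although the orders of 1, A₁,
A₁² have residues 0, 1, 2 modulo 3. That r is nonzero is what ties A₂ to A₁. -/
theorem exists_sq_eq : ∃ p q r : Polynomial ℂ, r ≠ 0 ∧
    A₁ * A₁ = polyAt hK (opL u v) p + polyAt hK (opL u v) q * A₁ +
      polyAt hK (opL u v) r * A₂ := by
  obtain ⟨p, q, r, h⟩ := exists_eq_polyAt_add hK h₁ h₂ (B := A₁ * A₁)
    (by rw [mul_assoc, h₁.1, ← mul_assoc, h₁.1, mul_assoc])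
  refine ⟨p, q, r, fun hr => ?_, h⟩
  have hA : A₁ ≠ 0 := ne_zero_of_order_mod h₁.2.1 one_ne_zero
  have ho : (A₁ * A₁).order = A₁.order + A₁.order := order_mul hA hA
  have h1 := h₁.2.1
  have o1 : (1 : DiffOp K).order = 0 := Polynomial.natDegree_one
  have := eq_zero_of_sum_eq_zero (order_ne_of_mod_ne hK u v ![p, q, -1] ![1, A₁, A₁ * A₁] (by
    intro i j hij
    fin_cases i <;> fin_cases j <;> simp_all <;> omega)) (by
      rw [Fin.sum_univ_three]
      simp [h, hr]) 2
  simp [hA] at this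

/-- A₁ commutes with A₁², p(L) and q(L)A₁, hence with r(L)A₂; the factor r(L) cancels in a domain.
-/
theorem minimal_commute : A₁ * A₂ = A₂ * A₁ := by
  obtain ⟨p, q, r, hr, h⟩ := exists_sq_eq hK h₁ h₂
  have hr0 := (polyAt_opL_ne_zero hK u v hr).1
  have hA : polyAt hK (opL u v) r * A₂ =
      A₁ * A₁ - polyAt hK (opL u v) p - polyAt hK (opL u v) q * A₁ := by rw [h]; abel
  have hp := commute_polyAt hK h₁.1 p
  have hq := commute_polyAt hK h₁.1 q
  have hrc := commute_polyAt hK h₁.1 r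
  have h3 : A₁ * (polyAt hK (opL u v) r * A₂) = (polyAt hK (opL u v) r * A₂) * A₁ := by
    rw [hA, mul_sub, mul_sub, sub_mul, sub_mul, hp, ← mul_assoc, ← mul_assoc, hq]
  rw [← mul_assoc, hrc, mul_assoc, mul_assoc] at h3
  exact mul_left_cancel₀ hr0 h3

/-- The centralizer of `L` is commutative. -/
theorem centralizer_commute {B C : DiffOp K} (hB : B * opL u v = opL u v * B)
    (hC : C * opL u v = opL u v * C) : B * C = C * B := by
  have h12 := minimal_commute hK h₁ h₂
  -- Commuting with A₁ and A₂ is enough to commute with the whole centralizer. This is applied first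
  -- to A₁ and A₂ themselves, then to an arbitrary B.
  have aux : ∀ D E : DiffOp K, D * opL u v = opL u v * D → E * opL u v = opL u v * E →
      D * A₁ = A₁ * D → D * A₂ = A₂ * D → D * E = E * D := by
    intro D E hD hE hD1 hD2
    obtain ⟨p, q, r, rfl⟩ := exists_eq_polyAt_add hK h₁ h₂ hE
    have hp := commute_polyAt hK hD p
    have hq := commute_polyAt hK hD q
    have hr := commute_polyAt hK hD r
    rw [mul_add, mul_add, add_mul, add_mul, hp, ← mul_assoc, ← mul_assoc, hq, hr, mul_assoc,
      mul_assoc, hD1, hD2, mul_assoc, mul_assoc]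
  exact aux B C hB hC (aux A₁ B h₁.1 hB rfl h12).symm (aux A₂ B h₂.1 hB h12.symm rfl).symm

end Generators

/-- For each nonzero residue, some Boussinesq operator has minimal order in the centralizer. -/
theorem exists_minimal_bsqOperator {u v : K} {i : ℕ} (hi : i = 1 ∨ i = 2)
    (hne : ∃ B : DiffOp K, B * opL u v = opL u v * B ∧ B.order % 3 = i) :
    ∃ A : DiffOp K, IsMinimalCommuting (opL u v) i A ∧ IsBsqOperator u v i A := by
  classical
  have hex : ∃ n, ∃ B : DiffOp K, B * opL u v = opL u v * B ∧ B.order % 3 = i ∧ B.order = n := by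
    obtain ⟨B, h1, h2⟩ := hne
    exact ⟨_, B, h1, h2, rfl⟩
  obtain ⟨B, hB, hBi, hBn⟩ := Nat.find_spec hex
  have hmin : ∀ C : DiffOp K, C * opL u v = opL u v * C → C.order % 3 = i → B.order ≤ C.order :=
    fun C hC hCi => by
      rw [hBn]
      exact Nat.find_min' hex ⟨C, hC, hCi, rfl⟩
  have hB0 : B ≠ 0 := fun h => by
    rw [h, show (0 : DiffOp K).order = 0 from Polynomial.natDegree_zero] at hBi
    omega
  obtain ⟨c, hc⟩ := exists_leadingCoeff hK hB
  have hc0 : c ≠ 0 := fun h => coeff_order_ne_zero hB0 (by rw [hc, h, map_zero])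
  obtain ⟨n, hn⟩ : ∃ n, B.order = 3 * n + i := ⟨B.order / 3, by omega⟩
  have hcomm := commute_const_mul hK c⁻¹ hB
  -- After scaling to leading coefficient one, B differs from a Boussinesq operator by a polynomial
  -- in L. The latter operator still commutes with L and has the same order.
  obtain ⟨f, g, p, h1, h2, -⟩ := exists_eq_bsqOp_add hK hi n (u := u) (v := v)
    (const (algebraMap ℂ K c⁻¹) * B)
    (by rw [← hn]; exact (orderLT_order_succ B).const_mul _)
    (by rw [← hn, coeff_const_mul, hc, ← map_mul, inv_mul_cancel₀ hc0, map_one])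
    (by rw [hcomm, sub_self]; exact orderLT_zero 2)
  obtain ⟨h3, h4⟩ := orderLT_bsqOp hK h1
  have h5 : (bsqOp u v f g n).order = B.order := by
    rw [hn]; exact order_eq_of_coeff h3 (by rw [h4]; exact one_ne_zero)
  refine ⟨bsqOp u v f g n, ⟨?_, by rw [h5, hBi], by rw [h5]; exact hmin⟩, n, f, g, h1, rfl⟩
  rw [eq_sub_iff_add_eq.2 h2.symm, sub_mul, mul_sub, hcomm, commute_polyAt hK rfl]

/-- The stationary equations kill the last remainder, so the Boussinesq operator of branch i
commutes with L. Its square has order congruent to 2i, which is the other nonzero residue modulo 3.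
-/
theorem exists_minimal_bsqOperators {u v : K} (h : IsBoussinesq u v) :
    ∃ A₁ A₂ : DiffOp K, IsMinimalCommuting (opL u v) 1 A₁ ∧ IsMinimalCommuting (opL u v) 2 A₂ ∧
      IsBsqOperator u v 1 A₁ ∧ IsBsqOperator u v 2 A₂ := by
  obtain ⟨i, n, f, g, h1, h2, h3⟩ := h
  obtain ⟨B, hB⟩ : ∃ B, B = bsqOp u v f g n := ⟨_, rfl⟩
  have hcomm : B * opL u v = opL u v * B := by
    have h4 := bsqOp_commutator hK h1
    rw [commRem, h2, h3] at h4
    rw [hB]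
    exact sub_eq_zero.1 (h4.trans (by simp [const_zero]))
  obtain ⟨h5, h6⟩ := orderLT_bsqOp hK h1
  have ho : B.order = 3 * n + i := by
    rw [hB]; exact order_eq_of_coeff h5 (by rw [h6]; exact one_ne_zero)
  have hB0 : B ≠ 0 := fun h => by
    rw [hB] at h
    rw [h, coeff_zero] at h6
    exact zero_ne_one h6
  have hcomm2 : B * B * opL u v = opL u v * (B * B) := by
    rw [mul_assoc, hcomm, ← mul_assoc, hcomm, mul_assoc]
  have ho2 : (B * B).order = B.order + B.order := order_mul hB0 hB0
  have hboth : ∀ j, j = 1 ∨ j = 2 →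
      ∃ B : DiffOp K, B * opL u v = opL u v * B ∧ B.order % 3 = j := by
    intro j hj
    rcases h1.eq_one_or_two with rfl | rfl <;> rcases hj with rfl | rfl
    · exact ⟨B, hcomm, by omega⟩
    · exact ⟨B * B, hcomm2, by omega⟩
    · exact ⟨B * B, hcomm2, by omega⟩
    · exact ⟨B, hcomm, by omega⟩
  obtain ⟨A₁, hA₁, hA₁'⟩ := exists_minimal_bsqOperator hK (Or.inl rfl) (hboth 1 (Or.inl rfl))
  obtain ⟨A₂, hA₂, hA₂'⟩ := exists_minimal_bsqOperator hK (Or.inr rfl) (hboth 2 (Or.inr rfl))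
  exact ⟨A₁, A₂, hA₁, hA₂, hA₁', hA₂'⟩

end Centralizer

end Bsq

/-! ### Right multiplication modulo an operator, resultants and subresultants -/

namespace DiffOp

/-! ### Right multiplication on remainders and its Lax equation. -/

section MulMatrix

variable {R : Type*} [CommRing R] [Differential R] {n : ℕ}

/-- The operator `∑ vⱼ ∂ʲ` of order less than `n`. -/
def vecOp (v : Fin n → R) : DiffOp R := ∑ j, const (v j) * partial' ^ (j : ℕ)

/-- The rows of `T` are the remainders of `Q, ∂ Q, …, ∂ⁿ⁻¹ Q` modulo `P`. -/
def IsMulMatrix (P Q : DiffOp R) (T : Matrix (Fin n) (Fin n) R) : Prop :=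
  ∀ i : Fin n, ∃ U, partial' ^ (i : ℕ) * Q = U * P + vecOp (T i)

theorem vecOp_add (v w : Fin n → R) : vecOp (v + w) = vecOp v + vecOp w := by
  simp only [vecOp, Pi.add_apply, const_add, add_mul, Finset.sum_add_distrib]

theorem vecOp_sub (v w : Fin n → R) : vecOp (v - w) = vecOp v - vecOp w := by
  simp only [vecOp, Pi.sub_apply, const_sub, sub_mul, Finset.sum_sub_distrib]

theorem vecOp_smul (a : R) (v : Fin n → R) : vecOp (a • v) = const a * vecOp v := by
  simp only [vecOp, Pi.smul_apply, smul_eq_mul, const_mul, Finset.mul_sum, mul_assoc]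

theorem vecOp_zero : vecOp (0 : Fin n → R) = 0 := by simp [vecOp, const_zero]

theorem vecOp_sum {ι : Type*} (s : Finset ι) (v : ι → Fin n → R) :
    vecOp (∑ i ∈ s, v i) = ∑ i ∈ s, vecOp (v i) := by
  classical
  induction s using Finset.induction_on with
  | empty => simp [vecOp_zero]
  | insert i s hi ih => rw [Finset.sum_insert hi, Finset.sum_insert hi, vecOp_add, ih]

theorem coeff_vecOp (v : Fin n → R) (j : Fin n) : (vecOp v).coeff j = v j := by
  rw [vecOp, coeff_sum, Finset.sum_eq_single j]
  · rw [coeff_const_mul, coeff_partial_pow, if_pos rfl, mul_one]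
  · intro i _ hij
    rw [coeff_const_mul, coeff_partial_pow, if_neg (fun h => hij (Fin.ext h.symm)), mul_zero]
  · simp

theorem orderLT_vecOp (v : Fin n → R) : OrderLT (vecOp v) n :=
  orderLT_sum _ _ fun i _ => ((orderLT_partial_pow (i : ℕ)).const_mul _).mono i.2

theorem vecOp_injective : Function.Injective (vecOp : (Fin n → R) → DiffOp R) := fun v w h =>
  funext fun j => by rw [← coeff_vecOp v, h, coeff_vecOp]

theorem eq_vecOp {V : DiffOp R} (h : OrderLT V n) : V = vecOp fun j : Fin n => V.coeff j := by
  conv_lhs => rw [eq_sum_of_orderLT h]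
  rw [vecOp, Finset.sum_range]

theorem partial_mul_vecOp (v : Fin n → R) : partial' * vecOp v =
    (∑ j, const (v j) * partial' ^ ((j : ℕ) + 1)) + vecOp fun j => (v j)′ := by
  rw [vecOp, vecOp, Finset.mul_sum, ← Finset.sum_add_distrib]
  refine Finset.sum_congr rfl fun j _ => ?_
  rw [← mul_assoc, partial_mul_const, add_mul, pow_succ', mul_assoc]

theorem IsMulMatrix.vecOp_mul {P Q : DiffOp R} {T : Matrix (Fin n) (Fin n) R}
    (hT : IsMulMatrix P Q T) (v : Fin n → R) :
    ∃ U, vecOp v * Q = U * P + vecOp (Matrix.vecMul v T) := by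
  choose U hU using hT
  refine ⟨∑ i, const (v i) * U i, ?_⟩
  rw [Matrix.vecMul_eq_sum, vecOp_sum, Finset.sum_mul, ← Finset.sum_add_distrib, vecOp,
    Finset.sum_mul]
  refine Finset.sum_congr rfl fun i _ => ?_
  rw [mul_assoc, hU, vecOp_smul, mul_add, mul_assoc]

theorem IsMulMatrix.sub_const {P Q : DiffOp R} {T : Matrix (Fin n) (Fin n) R}
    (hT : IsMulMatrix P Q T) {y : R} (hy : y′ = 0) :
    IsMulMatrix P (Q - const y) (T - Matrix.scalar (Fin n) y) := by
  intro i
  obtain ⟨U, hU⟩ := hT i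
  refine ⟨U, ?_⟩
  have h : (T - Matrix.scalar (Fin n) y) i = T i - y • Pi.single i 1 := by
    ext j
    simp [Matrix.diagonal_apply, Pi.single_apply, eq_comm]
  have h1 : vecOp (Pi.single i 1 : Fin n → R) = partial' ^ (i : ℕ) := by
    rw [vecOp, Finset.sum_eq_single i]
    · simp [const_one]
    · intro j _ hj; simp [hj, const_zero]
    · simp
  rw [mul_sub, hU, h, vecOp_sub, vecOp_smul, h1, const_mul_comm_of_deriv hy, add_sub_assoc]

theorem IsMulMatrix.mapCoeff {S : Type*} [CommRing S] [Differential S] {P Q : DiffOp R}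
    {T : Matrix (Fin n) (Fin n) R} (hT : IsMulMatrix P Q T) {φ : R →+* S}
    (hφ : ∀ a, φ a′ = (φ a)′) : IsMulMatrix (P.mapCoeff φ) (Q.mapCoeff φ) (T.map φ) := by
  intro i
  obtain ⟨U, hU⟩ := hT i
  refine ⟨U.mapCoeff φ, ?_⟩
  have h := congrArg (DiffOp.mapCoeff φ) hU
  rw [mapCoeff_partial_pow_mul hφ, mapCoeff_add, mapCoeff_mul hφ] at h
  rw [h]
  congr 1
  have h2 : OrderLT ((vecOp (T i)).mapCoeff φ) n := fun k hk => by
    rw [coeff_mapCoeff, orderLT_vecOp _ k hk, map_zero]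
  rw [eq_vecOp h2]
  congr 1
  ext j
  rw [coeff_mapCoeff, coeff_vecOp]; rfl

variable {P : DiffOp R} (hP : OrderLT P (n + 1)) (hu : IsUnit (P.coeff n))
include hP hu

theorem orderLT_of_mul {U : DiffOp R} {m : ℕ} (h : OrderLT (U * P) (n + m)) : OrderLT U m := by
  by_cases hU : U = 0
  · rw [hU]; exact orderLT_zero m
  refine (orderLT_order_succ U).mono ?_
  by_contra hm
  have h1 := coeff_mul_top (orderLT_order_succ U) hP
  rw [h _ (by omega)] at h1
  exact coeff_order_ne_zero hU (hu.mul_left_eq_zero.1 h1.symm)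

theorem remainder_unique {U U' : DiffOp R} {v w : Fin n → R}
    (h : U * P + vecOp v = U' * P + vecOp w) : v = w := by
  have h1 : (U - U') * P = vecOp w - vecOp v := by
    rw [sub_mul, sub_eq_sub_iff_add_eq_add, h, add_comm]
  have h2 : U - U' = 0 := eq_zero_of_orderLT_mul hP hu (by
    rw [h1]; exact (orderLT_vecOp w).sub (orderLT_vecOp v))
  rw [h2, zero_mul] at h1
  exact (vecOp_injective (sub_eq_zero.1 h1.symm)).symm

theorem exists_remainder (D : DiffOp R) : ∃ (U : DiffOp R) (v : Fin n → R),
    D = U * P + vecOp v := by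
  obtain ⟨U, hU⟩ := exists_right_division' hP hu D
  exact ⟨U, _, by rw [← eq_vecOp hU]; abel⟩

theorem exists_isMulMatrix (Q : DiffOp R) : ∃ T : Matrix (Fin n) (Fin n) R, IsMulMatrix P Q T := by
  choose U v h using fun i : Fin n => exists_remainder hP hu (partial' ^ (i : ℕ) * Q)
  exact ⟨v, fun i => ⟨U i, h i⟩⟩

/-- If `Q` commutes with `P`, the matrix of the right multiplication by `Q` satisfies a Lax
equation. -/
theorem IsMulMatrix.exists_lax {Q : DiffOp R} {T : Matrix (Fin n) (Fin n) R}
    (hT : IsMulMatrix P Q T) (hPQ : P * Q = Q * P) :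
    ∃ Ω : Matrix (Fin n) (Fin n) R, T.map (fun a => a′) = Ω * T - T * Ω := by
  -- Ω is the matrix of left multiplication by ∂ on remainders. The Lax equation compares two
  -- computations of the remainder of ∂ⁱ⁺¹Q: as ∂(∂ⁱQ), which differentiates the coefficients of T,
  -- and as (∂ⁱ⁺¹)Q, where commutation moves P back to the right.
  obtain ⟨W, Ω, hΩ⟩ : ∃ (W : Fin n → DiffOp R) (Ω : Matrix (Fin n) (Fin n) R),
      ∀ i : Fin n, partial' ^ ((i : ℕ) + 1) = W i * P + vecOp (Ω i) := by
    choose W Ω hΩ using fun i : Fin n => exists_remainder hP hu (partial' ^ ((i : ℕ) + 1))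
    exact ⟨W, Ω, hΩ⟩
  refine ⟨Ω, ?_⟩
  ext i j
  obtain ⟨U, hU⟩ := hT i
  obtain ⟨U', hU'⟩ := hT.vecOp_mul (Ω i)
  have hΩT : ∀ v : Fin n → R, ∃ U, (∑ j, const (v j) * partial' ^ ((j : ℕ) + 1)) =
      U * P + vecOp (Matrix.vecMul v Ω) := fun v => by
    refine ⟨∑ j, const (v j) * W j, ?_⟩
    rw [Matrix.vecMul_eq_sum, vecOp_sum, Finset.sum_mul, ← Finset.sum_add_distrib]
    refine Finset.sum_congr rfl fun j _ => ?_
    rw [hΩ, vecOp_smul, mul_add, mul_assoc]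
  obtain ⟨U'', hU''⟩ := hΩT (T i)
  have h1 : partial' ^ ((i : ℕ) + 1) * Q =
      (partial' * U + U'') * P + vecOp (Matrix.vecMul (T i) Ω + fun j => (T i j)′) := by
    rw [pow_succ', mul_assoc, hU, mul_add, partial_mul_vecOp, hU'', vecOp_add, add_mul, mul_assoc]
    abel
  have h2 : partial' ^ ((i : ℕ) + 1) * Q = (W i * Q + U') * P + vecOp (Matrix.vecMul (Ω i) T) := by
    rw [hΩ, add_mul, hU', mul_assoc, hPQ, ← mul_assoc, add_mul, add_assoc]
  have h3 := congrFun (remainder_unique hP hu (h1.symm.trans h2)) j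
  simp only [Pi.add_apply] at h3
  change (T i j)′ = Matrix.vecMul (Ω i) T j - Matrix.vecMul (T i) Ω j
  rw [← h3]; ring

end MulMatrix

/-! ### Invariance of the characteristic polynomial under a Lax equation. -/

section Lax

variable {R : Type*} [CommRing R] [Differential R]

/-- The ring homomorphism `a ↦ a + a′ ε` to the dual numbers. -/
def toDual : R →+* TrivSqZeroExt R R where
  toFun a := TrivSqZeroExt.inl a + TrivSqZeroExt.inr a′
  map_one' := by ext <;> simp
  map_zero' := by ext <;> simp
  map_mul' a b := by ext <;> simp [mul_comm]
  map_add' a b := by ext <;> simp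

/-- A matrix that satisfies a Lax equation has a constant characteristic polynomial. -/
theorem deriv_coeff_charpoly_of_lax {n : ℕ} {T Ω : Matrix (Fin n) (Fin n) R}
    (h : T.map (fun a => a′) = Ω * T - T * Ω) (k : ℕ) : (T.charpoly.coeff k)′ = 0 := by
  let i : R →+* TrivSqZeroExt R R := TrivSqZeroExt.inlHom R R
  let E : Matrix (Fin n) (Fin n) (TrivSqZeroExt R R) := Ω.map TrivSqZeroExt.inr
  have hE : ∀ M : Matrix (Fin n) (Fin n) (TrivSqZeroExt R R), E * M * E = 0 := by
    intro M
    ext a b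
    · simp [Matrix.mul_apply, E, TrivSqZeroExt.fst_sum]
    · simp [Matrix.mul_apply, E, TrivSqZeroExt.snd_sum, TrivSqZeroExt.fst_sum]
  have hEE : E * E = 0 := by simpa using hE 1
  -- Over the dual numbers T + εT′ = (1 + εΩ) T (1 - εΩ), a conjugate of T. Equality of the
  -- characteristic polynomials kills the ε-part of each coefficient.
  let M : (Matrix (Fin n) (Fin n) (TrivSqZeroExt R R))ˣ :=
    ⟨1 + E, 1 - E, by rw [add_mul, mul_sub, mul_sub, hEE]; simp,
      by rw [sub_mul, mul_add, mul_add, hEE]; simp⟩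
  have hconj : T.map toDual = M.val * T.map i * M⁻¹.val := by
    change _ = (1 + E) * T.map i * (1 - E)
    have h1 : (1 + E) * T.map i * (1 - E) = T.map i + (E * T.map i - T.map i * E) -
        E * T.map i * E := by noncomm_ring
    rw [h1, hE, sub_zero]
    ext a b
    · simp [toDual, i, E, Matrix.mul_apply, TrivSqZeroExt.fst_sum]
    · have h2 := congrFun (congrFun h a) b
      rw [Matrix.map_apply, Matrix.sub_apply, Matrix.mul_apply, Matrix.mul_apply] at h2
      simp [toDual, i, E, Matrix.mul_apply, TrivSqZeroExt.snd_sum, h2, mul_comm]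
  have hchar : (T.map toDual).charpoly = (T.map i).charpoly := by
    rw [hconj, Matrix.charpoly_mul_comm, Units.inv_mul_cancel_left]
  rw [Matrix.charpoly_map, Matrix.charpoly_map] at hchar
  have h3 := congrArg (fun p => (p.coeff k).snd) hchar
  simpa [Polynomial.coeff_map, toDual, i] using h3

end Lax

/-! ### Differential resultants as determinants of right multiplications. -/

section Resultant

variable {R : Type*} [CommRing R] [Differential R]

/-- The differential resultant as the determinant of a right multiplication. -/
theorem dRes_eq_det {P Q : DiffOp R} (hu : IsUnit (P.coeff P.order))
    {T : Matrix (Fin P.order) (Fin P.order) R} (hT : IsMulMatrix P Q T) :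
    dRes P Q = P.coeff P.order ^ Q.order * T.det := by
  have hP := orderLT_order_succ P
  have hQ := orderLT_order_succ Q
  choose U hU using hT
  simp only [dRes, extendedSystem]
  generalize P.order = n at *
  generalize hm : Q.order = m at *
  have hUm : ∀ i, OrderLT (U i) m := fun i => by
    refine orderLT_of_mul hP hu ?_
    rw [← sub_eq_iff_eq_add.2 (hU i)]
    exact ((hQ.partial_pow_mul i).mono (by omega)).sub ((orderLT_vecOp _).mono (by omega))
  -- Division by P writes the extended system as E applied to ∂ᵐ⁻¹P, …, P, ∂ⁿ⁻¹, …, 1. The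
  -- coefficient matrix B of this list is triangular, with m diagonal entries equal to the leading
  -- coefficient of P and n equal to one; E is block triangular with blocks 1 and T. The reversals
  -- come from listing powers of ∂ in decreasing order.
  let e : Fin m ⊕ Fin n ≃ Fin (n + m) := finSumFinEquiv.trans (finCongr (add_comm m n))
  let E : Matrix (Fin m ⊕ Fin n) (Fin m ⊕ Fin n) R :=
    Matrix.fromBlocks 1 0 (Matrix.of fun j i => (U j.rev).coeff i.rev) (T.submatrix Fin.rev Fin.rev)
  let X : Fin m ⊕ Fin n → DiffOp R :=
    Sum.elim (fun i => partial' ^ (i.rev : ℕ) * P) (fun j => partial' ^ (j.rev : ℕ))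
  let B : Matrix (Fin m ⊕ Fin n) (Fin m ⊕ Fin n) R :=
    Matrix.of fun x y => (X x).coeff (n + m - 1 - e y)
  have hel : ∀ i : Fin m, ((e (Sum.inl i) : Fin (n + m)) : ℕ) = i := fun i => by simp [e]
  have her : ∀ j : Fin n, ((e (Sum.inr j) : Fin (n + m)) : ℕ) = m + j := fun j => by simp [e, add_comm]
  have hW : (Matrix.of fun r c : Fin (n + m) =>
      (if (r : ℕ) < m - 0 then partial' ^ (m - 1 - 0 - r) * P
        else partial' ^ (n - 1 - 0 - (r - (m - 0))) * Q).coeff (n + m - 1 - c)).submatrix e e =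
      E * B := by
    ext x y
    have hx : (E * B) x y = (∑ z, const (E x z) * X z).coeff (n + m - 1 - e y) := by
      rw [coeff_sum, Matrix.mul_apply]
      exact Finset.sum_congr rfl fun z _ => (coeff_const_mul _ _ _).symm
    rw [hx, Matrix.submatrix_apply, Matrix.of_apply]
    congr 1
    rw [Fintype.sum_sum_type]
    rcases x with i | j
    · rw [hel, if_pos (by omega)]
      rw [Finset.sum_eq_single i]
      · simp only [E, X, Matrix.fromBlocks_apply₁₁, Matrix.fromBlocks_apply₁₂, Matrix.one_apply_eq,
          Sum.elim_inl, Matrix.zero_apply, const_zero, zero_mul, Finset.sum_const_zero, add_zero,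
          const_one, one_mul]
        congr 2
        rw [Fin.val_rev]; omega
      · intro i' _ hi'
        simp only [E, Matrix.fromBlocks_apply₁₁, Matrix.one_apply_ne hi'.symm, const_zero, zero_mul]
      · simp
    · rw [her, if_neg (by omega)]
      have h1 : n - 1 - 0 - (m + j - (m - 0)) = (j.rev : ℕ) := by rw [Fin.val_rev]; omega
      rw [h1, hU j.rev]
      congr 1
      · conv_lhs => rw [eq_vecOp (hUm j.rev), vecOp, ← Equiv.sum_comp Fin.revPerm, Finset.sum_mul]
        refine Finset.sum_congr rfl fun i _ => ?_
        simp [E, X, mul_assoc]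
      · rw [vecOp, ← Equiv.sum_comp Fin.revPerm]
        refine Finset.sum_congr rfl fun i _ => ?_
        simp [E, X]
  have hB : B = Matrix.fromBlocks (Matrix.of fun i i' : Fin m => (X (Sum.inl i)).coeff (n + m - 1 - i'))
      (Matrix.of fun (i : Fin m) (j : Fin n) => (X (Sum.inl i)).coeff (n + m - 1 - (m + j))) 0 1 := by
    ext x y
    rcases x with i | j <;> rcases y with i' | j'
    · simp [B, hel]
    · simp [B, her]
    · simp only [B, X, Matrix.of_apply, Sum.elim_inr, Matrix.fromBlocks_apply₂₁, hel,
        coeff_partial_pow, Matrix.zero_apply, Fin.val_rev]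
      rw [if_neg (by omega)]
    · simp only [B, X, Matrix.of_apply, Sum.elim_inr, Matrix.fromBlocks_apply₂₂, her,
        coeff_partial_pow, Matrix.one_apply, Fin.val_rev, Fin.ext_iff]
      congr 1
      simp only [eq_iff_iff]
      omega
  have hdetB : B.det = P.coeff n ^ m := by
    rw [hB, Matrix.det_fromBlocks_zero₂₁, Matrix.det_one, mul_one, Matrix.det_of_isUpperTriangular]
    · rw [Finset.prod_eq_pow_card (b := P.coeff n), Finset.card_univ, Fintype.card_fin]
      intro i _
      have h1 : n + m - 1 - (i : ℕ) = n + (i.rev : ℕ) := by rw [Fin.val_rev]; omega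
      simp only [X, Matrix.of_apply, Sum.elim_inl]
      rw [h1, coeff_partial_pow_mul_top hP]
    · intro i i' hi
      have hi' : (i' : ℕ) < i := hi
      simp only [X, Matrix.of_apply, Sum.elim_inl]
      exact hP.partial_pow_mul _ _ (by rw [Fin.val_rev]; omega)
  have hdetE : E.det = T.det := by
    rw [Matrix.det_fromBlocks_zero₁₂, Matrix.det_one, one_mul]
    exact Matrix.det_submatrix_equiv_self Fin.revPerm T
  rw [← Matrix.det_submatrix_equiv_self e]
  rw [hW, Matrix.det_mul, hdetE, hdetB, mul_comm]

theorem dRes_eq_det_of_order_eq {P Q : DiffOp R} {n : ℕ} (hn : P.order = n)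
    (hu : IsUnit (P.coeff n)) {T : Matrix (Fin n) (Fin n) R} (hT : IsMulMatrix P Q T) :
    dRes P Q = P.coeff n ^ Q.order * T.det := by
  subst hn
  exact dRes_eq_det hu hT

end Resultant

/-! ### The first subresultant as a left combination. -/

section Subresultant

variable {R : Type*} [CommRing R] [Differential R]

theorem orderLT_extendedSystem_one {P Q : DiffOp R} (hQ : 1 ≤ Q.order)
    (r : Fin (P.order + Q.order - 2)) :
    OrderLT (extendedSystem 1 P Q r) (P.order + Q.order - 2 + 1) := by
  have hr := r.2
  rw [extendedSystem]
  split_ifs with h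
  · exact ((orderLT_order_succ P).partial_pow_mul _).mono (by omega)
  · exact ((orderLT_order_succ Q).partial_pow_mul _).mono (by omega)

/-- The first subresultant belongs to the left ideal generated by `P` and `Q`. -/
theorem exists_subres_eq {P Q : DiffOp R} (hQ : 1 ≤ Q.order)
    (hPQ : 3 ≤ P.order + Q.order) :
    ∃ U V : DiffOp R, const (subres P Q 1) * partial' + const (subres P Q 0) = U * P + V * Q := by
  have hX := orderLT_extendedSystem_one (P := P) hQ
  obtain ⟨N, hN⟩ : ∃ N, N = P.order + Q.order - 2 := ⟨_, rfl⟩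
  let X : Fin N → DiffOp R := fun r => extendedSystem 1 P Q r
  have hXN : ∀ r, OrderLT (X r) (N + 1) := by subst hN; exact hX
  have hmem : ∀ r, ∃ U V : DiffOp R, X r = U * P + V * Q := fun r => by
    simp only [X, extendedSystem]
    split_ifs
    · exact ⟨partial' ^ (Q.order - 1 - 1 - r), 0, by rw [zero_mul, add_zero]⟩
    · exact ⟨0, partial' ^ (P.order - 1 - 1 - (r - (Q.order - 1))), by rw [zero_mul, zero_add]⟩
  let M : Matrix (Fin N) (Fin N) R := Matrix.of fun r c => (X r).coeff (N - c)
  let last : Fin N := ⟨N - 1, by omega⟩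
  have h1 : subres P Q 1 = M.det := by
    subst hN
    simp only [subres, M, X]
    simp
  have h0 : subres P Q 0 = (M.updateCol last fun r => (X r).coeff 0).det := by
    subst hN
    simp only [subres]
    congr 1
    ext r c
    simp only [Matrix.of_apply, true_and, Matrix.updateCol_apply, M, X, last, Fin.ext_iff]
    have hc := c.2
    split_ifs with h h' h'
    · rfl
    · omega
    · omega
    · rfl
  -- Cramer's rule: with these weights the coefficient of ∂ᵏ in the combination is the determinant
  -- of M with its last column, that of ∂, replaced by the column of ∂ᵏ. For k ≥ 2 this repeats a
  -- column or inserts a zero one.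
  let w : Fin N → R := M.adjugate last
  have hw : ∀ k, (∑ r, const (w r) * X r).coeff k =
      (M.updateCol last fun r => (X r).coeff k).det := fun k => by
    rw [coeff_sum, ← Matrix.cramer_apply, Matrix.cramer_eq_adjugate_mulVec]
    exact Finset.sum_congr rfl fun r _ => coeff_const_mul _ _ _
  have hsum : const (subres P Q 1) * partial' + const (subres P Q 0) =
      ∑ r, const (w r) * X r := by
    refine ext_coeff fun k => ?_
    rw [hw, coeff_add, coeff_const_mul, coeff_const]
    have hp := coeff_partial_pow (R := R) 1 k
    rw [pow_one] at hp
    rw [hp]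
    rcases k with _ | _ | k
    · simp [h0]
    · have : M.updateCol last (fun r => (X r).coeff 1) = M := by
        ext r c
        rw [Matrix.updateCol_apply]
        split_ifs with h
        · rw [h]
          simp only [M, last, Matrix.of_apply]
          congr 1; omega
        · rfl
      simp [this, h1]
    · rw [if_neg (by omega), if_neg (by omega), mul_zero, add_zero]
      symm
      rcases lt_or_ge N (k + 2) with hk | hk
      · refine Matrix.det_eq_zero_of_column_eq_zero last fun r => ?_
        rw [Matrix.updateCol_self]
        exact hXN r _ hk
      · refine Matrix.det_zero_of_column_eq (i := last) (j := ⟨N - (k + 2), by omega⟩)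
          (by simp only [last, ne_eq, Fin.mk.injEq]; omega) fun r => ?_
        rw [Matrix.updateCol_self, Matrix.updateCol_ne
          (by simp only [last, ne_eq, Fin.mk.injEq]; omega)]
        simp only [M, Matrix.of_apply]
        congr 1; omega
  choose U V hUV using hmem
  refine ⟨∑ r, const (w r) * U r, ∑ r, const (w r) * V r, ?_⟩
  rw [hsum, Finset.sum_mul, Finset.sum_mul, ← Finset.sum_add_distrib]
  exact Finset.sum_congr rfl fun r _ => by rw [hUV, mul_add, mul_assoc, mul_assoc]

end Subresultant

/-! ### Consequences of a vanishing leading subresultant coefficient. -/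

section SubresultantKernel

variable {F : Type*} [Field F] [Differential F]

/-- If the leading coefficient of the first subresultant vanishes, then a nontrivial combination
of small order of `P` and `Q` has order zero. -/
theorem exists_combination_of_subres_eq_zero {P Q : DiffOp F} (hP : 1 ≤ P.order)
    (hQ : 1 ≤ Q.order) (h : subres P Q 1 = 0) :
    ∃ (U V : DiffOp F) (c : F), (U ≠ 0 ∨ V ≠ 0) ∧ OrderLT V (P.order - 1) ∧
      U * P + V * Q = const c := by
  have hX := orderLT_extendedSystem_one (P := P) hQ
  have hdet : (Matrix.of fun r c : Fin (P.order + Q.order - 2) =>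
      (extendedSystem 1 P Q r).coeff (P.order + Q.order - 2 - c)).det = 0 := by
    rw [← h, subres]; simp
  -- A row vector in the kernel combines the extended system so that every column except that of 1
  -- vanishes. Splitting it into the parts belonging to P and to Q gives U and V.
  obtain ⟨w, hw0, hw⟩ := Matrix.exists_vecMul_eq_zero_iff.2 hdet
  let U : DiffOp F := ∑ r : Fin (P.order + Q.order - 2), if (r : ℕ) < Q.order - 1 then
    const (w r) * partial' ^ (Q.order - 1 - 1 - r) else 0
  let V : DiffOp F := ∑ r : Fin (P.order + Q.order - 2), if (r : ℕ) < Q.order - 1 then 0 else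
    const (w r) * partial' ^ (P.order - 1 - 1 - (r - (Q.order - 1)))
  have hUV : U * P + V * Q = ∑ r, const (w r) * extendedSystem 1 P Q r := by
    simp only [U, V, Finset.sum_mul, ← Finset.sum_add_distrib]
    refine Finset.sum_congr rfl fun r _ => ?_
    rw [extendedSystem]
    split_ifs
    · rw [zero_mul, add_zero, mul_assoc]
    · rw [zero_mul, zero_add, mul_assoc]
  have hlt : OrderLT (U * P + V * Q) 1 := by
    intro k hk
    rw [hUV]
    rcases lt_or_ge (P.order + Q.order - 2) k with hk' | hk'
    · exact orderLT_sum _ _ (fun r _ => (hX r).const_mul _) k hk'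
    · have := congrFun hw ⟨P.order + Q.order - 2 - k, by omega⟩
      rw [coeff_sum]
      rw [Matrix.vecMul, dotProduct] at this
      rw [Pi.zero_apply] at this
      rw [← this]
      refine Finset.sum_congr rfl fun r _ => ?_
      rw [coeff_const_mul, Matrix.of_apply]
      congr 2
      change k = P.order + Q.order - 2 - (P.order + Q.order - 2 - k)
      omega
  refine ⟨U, V, _, ?_, ?_, eq_const_of_orderLT_one hlt⟩
  · by_contra! h0
    refine hw0 (funext fun r => ?_)
    have hr := r.2
    by_cases hrm : (r : ℕ) < Q.order - 1
    · have h1 := congrArg (fun D => D.coeff (Q.order - 1 - 1 - r)) h0.1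
      simp only [U, coeff_sum] at h1
      rw [Finset.sum_eq_single r] at h1
      · simpa [hrm, coeff_const_mul, coeff_partial_pow] using h1
      · intro r' _ hr'
        split_ifs with h2
        · rw [coeff_const_mul, coeff_partial_pow,
            if_neg (fun h3 => hr' (Fin.ext (by omega))), mul_zero]
        · exact coeff_zero _
      · simp
    · have h1 := congrArg (fun D => D.coeff (P.order - 1 - 1 - (r - (Q.order - 1)))) h0.2
      simp only [V, coeff_sum] at h1
      rw [Finset.sum_eq_single r] at h1
      · simpa [hrm, coeff_const_mul, coeff_partial_pow] using h1
      · intro r' _ hr'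
        have hr2 := r'.2
        split_ifs with h2
        · exact coeff_zero _
        · rw [coeff_const_mul, coeff_partial_pow,
            if_neg (fun h3 => hr' (Fin.ext (by omega))), mul_zero]
      · simp
  · refine orderLT_sum _ _ fun r _ => ?_
    have hr := r.2
    split_ifs with h2
    · exact orderLT_zero _
    · exact ((orderLT_partial_pow _).const_mul _).mono (by omega)

end SubresultantKernel

end DiffOp

/-! ### Commutative rings of differential operators and their points -/

namespace Bsq

open DiffOp MvPolynomial

theorem map_aeval_eq_polyAt {K S : Type*} [Field K] [Differential K] [CharZero K] [Algebra ℂ K]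
    [CommRing S] [Algebra ℂ S] (hK : ∀ a : K, a′ = 0 ↔ a ∈ Set.range (algebraMap ℂ K))
    {f : S →+* DiffOp K} (hf : ∀ c : ℂ, f (algebraMap ℂ S c) = const (algebraMap ℂ K c)) (s : S)
    (p : Polynomial ℂ) : f (Polynomial.aeval s p) = polyAt hK (f s) p := by
  induction p using Polynomial.induction_on' with
  | add p q hp hq => rw [map_add, map_add, map_add, hp, hq]
  | monomial n c =>
    rw [← Polynomial.C_mul_X_pow_eq_monomial, map_mul, map_mul, map_mul, map_pow, map_pow, map_pow,
      polyAt_C, polyAt_X, Polynomial.aeval_C, Polynomial.aeval_X, hf]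

/-- A commutative `ℂ`-algebra `S` realized as the centralizer of `L = ∂³ + u ∂ + v`, and its
generators `a 0 = L`, `a 1`, `a 2` over `ℂ`. -/
structure SpectralData (K S : Type*) [Field K] [Differential K] [Algebra ℂ K] [CommRing S]
    [Algebra ℂ S] where
  constants : ∀ a : K, a′ = 0 ↔ a ∈ Set.range (algebraMap ℂ K)
  toOp : S →+* DiffOp K
  toOp_injective : Function.Injective toOp
  toOp_algebraMap : ∀ c : ℂ, toOp (algebraMap ℂ S c) = const (algebraMap ℂ K c)
  a : Fin 3 → S
  u : K
  v : K
  toOp_zero : toOp (a 0) = opL u v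
  exists_toOp_eq : ∀ D : DiffOp K, D * opL u v = opL u v * D → ∃ s, toOp s = D
  generates : ∀ s, ∃ p q r : Polynomial ℂ,
    s = Polynomial.aeval (a 0) p + Polynomial.aeval (a 0) q * a 1 + Polynomial.aeval (a 0) r * a 2
  order_one : (toOp (a 1)).order % 3 = 1
  order_two : (toOp (a 2)).order % 3 = 2
  sq_eq : ∃ p q r : Polynomial ℂ, r ≠ 0 ∧
    a 1 * a 1 = Polynomial.aeval (a 0) p + Polynomial.aeval (a 0) q * a 1 +
      Polynomial.aeval (a 0) r * a 2

namespace SpectralData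

variable {K S : Type*} [Field K] [Differential K] [CharZero K] [Algebra ℂ K] [CommRing S]
  [Algebra ℂ S] (D : SpectralData K S)

section Basic

include D in
theorem isDomain : IsDomain S := Function.Injective.isDomain D.toOp D.toOp_injective

include D in
theorem deriv_algebraMap (c : ℂ) : (algebraMap ℂ K c)′ = 0 := (D.constants _).2 ⟨c, rfl⟩

theorem order_pos (i : Fin 3) : 1 ≤ (D.toOp (D.a i)).order := by
  have h1 := D.order_one
  have h2 := D.order_two
  have h0 : (D.toOp (D.a 0)).order = 3 := by rw [D.toOp_zero]; exact order_opL _ _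
  fin_cases i
  · exact h0.symm ▸ (by norm_num)
  · exact (by omega : 1 ≤ (D.toOp (D.a 1)).order)
  · exact (by omega : 1 ≤ (D.toOp (D.a 2)).order)

theorem order_unit {s t : S} (h : s * t = 1) : (D.toOp s).order = 0 := by
  have h1 : D.toOp s * D.toOp t = 1 := by rw [← map_mul, h, map_one]
  have hs : D.toOp s ≠ 0 := fun h0 => by simp [h0] at h1
  have ht : D.toOp t ≠ 0 := fun h0 => by simp [h0] at h1
  have h2 := order_mul hs ht
  rw [h1, show (1 : DiffOp K).order = 0 from Polynomial.natDegree_one] at h2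
  omega

theorem toOp_aeval (s : S) (p : Polynomial ℂ) :
    D.toOp (Polynomial.aeval s p) = polyAt D.constants (D.toOp s) p :=
  map_aeval_eq_polyAt D.constants D.toOp_algebraMap s p

theorem commute (s t : S) : D.toOp s * D.toOp t = D.toOp t * D.toOp s := by
  rw [← map_mul, mul_comm, map_mul]

theorem commute_opL (s : S) : D.toOp s * opL D.u D.v = opL D.u D.v * D.toOp s := by
  rw [← D.toOp_zero, D.commute]

/-- The values at the generators of `S`. -/
def evalGen : MvPolynomial (Fin 3) ℂ →ₐ[ℂ] S := MvPolynomial.aeval D.a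

/-- The ideal of the relations between the generators of `S`. -/
def relations : Ideal (MvPolynomial (Fin 3) ℂ) := RingHom.ker D.evalGen

theorem mem_relations {p : MvPolynomial (Fin 3) ℂ} : p ∈ D.relations ↔ D.evalGen p = 0 := Iff.rfl

theorem evalGen_X (i : Fin 3) : D.evalGen (X i) = D.a i := aeval_X _ _

theorem evalGen_aeval_X (p : Polynomial ℂ) (i : Fin 3) :
    D.evalGen (Polynomial.aeval (X i) p) = Polynomial.aeval (D.a i) p := by
  rw [← Polynomial.aeval_algHom_apply, evalGen_X]

theorem evalGen_surjective : Function.Surjective D.evalGen := fun s => by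
  obtain ⟨p, q, r, h⟩ := D.generates s
  refine ⟨Polynomial.aeval (X 0) p + Polynomial.aeval (X 0) q * X 1 +
    Polynomial.aeval (X 0) r * X 2, ?_⟩
  simp only [map_add, map_mul, evalGen_aeval_X, evalGen_X, h]

theorem isPrime_relations : D.relations.IsPrime :=
  have := D.isDomain
  RingHom.ker_isPrime _

/-- The points of the spectral curve: the common zeros of the relations. -/
def points : Set (Fin 3 → ℂ) := zeroLocus ℂ D.relations

/-- The Nullstellensatz, for a prime and hence radical ideal: relations can be checked at points. -/
theorem vanishingIdeal_points : vanishingIdeal ℂ D.points = D.relations :=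
  have := D.isPrime_relations
  IsPrime.vanishingIdeal_zeroLocus _

theorem aeval_eq_eval_apply (P : Fin 3 → ℂ) (p : MvPolynomial (Fin 3) ℂ) :
    MvPolynomial.aeval P p = MvPolynomial.eval P p := by
  rw [← MvPolynomial.coe_aeval_eq_eval]; rfl

theorem mem_relations_of_forall {p : MvPolynomial (Fin 3) ℂ}
    (h : ∀ P ∈ D.points, MvPolynomial.eval P p = 0) : p ∈ D.relations := by
  rw [← D.vanishingIdeal_points, mem_vanishingIdeal_iff]
  intro P hP
  rw [aeval_eq_eval_apply, h P hP]

theorem eval_eq_zero {p : MvPolynomial (Fin 3) ℂ} (hp : p ∈ D.relations) {P : Fin 3 → ℂ}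
    (hP : P ∈ D.points) : MvPolynomial.eval P p = 0 := by
  have := (mem_zeroLocus_iff.1 hP) p hp
  rwa [aeval_eq_eval_apply] at this

/-- The character of `S` that corresponds to a point. -/
def character {P : Fin 3 → ℂ} (hP : P ∈ D.points) : S →ₐ[ℂ] ℂ :=
  AlgHom.liftOfSurjective D.evalGen D.evalGen_surjective (MvPolynomial.aeval P)
    fun p hp => (mem_zeroLocus_iff.1 hP) p hp

theorem character_evalGen {P : Fin 3 → ℂ} (hP : P ∈ D.points) (p : MvPolynomial (Fin 3) ℂ) :
    D.character hP (D.evalGen p) = MvPolynomial.eval P p :=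
  (AlgHom.liftOfSurjective_apply _ _ _ _ _).trans (aeval_eq_eval_apply P p)

theorem character_a {P : Fin 3 → ℂ} (hP : P ∈ D.points) (i : Fin 3) :
    D.character hP (D.a i) = P i := by
  rw [← D.evalGen_X, character_evalGen, eval_X]

end Basic

/-! ### Properness of the left ideal attached to a point. -/

section Properness

/-- The operator `Aᵢ - Pᵢ`. -/
def opAt (P : Fin 3 → ℂ) (i : Fin 3) : DiffOp K :=
  D.toOp (D.a i) - const (algebraMap ℂ K (P i))

/-- The left ideal generated by the operators `Aᵢ - Pᵢ`. -/
def leftIdeal (P : Fin 3 → ℂ) : Ideal (DiffOp K) := Ideal.span (Set.range (D.opAt P))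

theorem opAt_eq (P : Fin 3 → ℂ) (i : Fin 3) :
    D.opAt P i = D.toOp (D.a i - algebraMap ℂ S (P i)) := by
  rw [opAt, map_sub, D.toOp_algebraMap]

theorem opAt_mem (P : Fin 3 → ℂ) (i : Fin 3) : D.opAt P i ∈ D.leftIdeal P :=
  Ideal.subset_span ⟨i, rfl⟩

/-- The powers of the maximal ideal of a point annihilate some nonzero element of the fibre. -/
theorem exists_socle {P : Fin 3 → ℂ} (hP : P ∈ D.points) :
    ∃ r : S, r ∉ Ideal.span {D.a 0 - algebraMap ℂ S (P 0)} ∧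
      ∀ i, (D.a i - algebraMap ℂ S (P i)) * r ∈ Ideal.span {D.a 0 - algebraMap ℂ S (P 0)} := by
  set I : Ideal S := Ideal.span {D.a 0 - algebraMap ℂ S (P 0)} with hI
  have hker : ∀ x ∈ I, D.character hP x = 0 := by
    intro x hx
    obtain ⟨y, rfl⟩ := Ideal.mem_span_singleton'.1 hx
    rw [map_mul, map_sub, character_a, AlgHom.commutes]
    simp
  let χ : S ⧸ I →ₐ[ℂ] ℂ := Ideal.Quotient.liftₐ I (D.character hP) hker
  have hχ : ∀ s : S, χ (Ideal.Quotient.mk I s) = D.character hP s := fun s => rfl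
  have h0 : ∀ p : Polynomial ℂ, Ideal.Quotient.mk I (Polynomial.aeval (D.a 0) p) =
      algebraMap ℂ (S ⧸ I) (p.eval (P 0)) := by
    intro p
    have h1 : Ideal.Quotient.mk I (D.a 0) = algebraMap ℂ (S ⧸ I) (P 0) :=
      Ideal.Quotient.eq.2 (Ideal.subset_span rfl)
    have h2 := Polynomial.aeval_algHom_apply (Ideal.Quotient.mkₐ ℂ I) (D.a 0) p
    rw [Ideal.Quotient.mkₐ_eq_mk, h1, Polynomial.aeval_algebraMap_apply] at h2
    rw [← h2]; simp
  -- Modulo L - P₀ every polynomial in L is a scalar, so 1, A₁, A₂ span the fibre.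
  have hfin : Module.Finite ℂ (S ⧸ I) := by
    suffices hspan : (⊤ : Submodule ℂ (S ⧸ I)) =
        Submodule.span ℂ {1, Ideal.Quotient.mk I (D.a 1), Ideal.Quotient.mk I (D.a 2)} from
      ⟨hspan ▸ Submodule.fg_span (Set.toFinite _)⟩
    symm
    rw [eq_top_iff]
    rintro x -
    obtain ⟨s, rfl⟩ := Ideal.Quotient.mk_surjective x
    obtain ⟨p, q, r, h⟩ := D.generates s
    rw [h, map_add, map_add, map_mul, map_mul, h0, h0, h0, ← Algebra.smul_def, ← Algebra.smul_def,
      Algebra.algebraMap_eq_smul_one]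
    refine add_mem (add_mem ?_ ?_) ?_ <;> refine Submodule.smul_mem _ _ (Submodule.subset_span ?_) <;>
      simp
  have hart : IsArtinianRing (S ⧸ I) := IsArtinianRing.of_finite ℂ _
  have hprime : (RingHom.ker χ).IsPrime := RingHom.ker_isPrime χ
  -- The fibre is Artinian, so the prime ideal of the point is minimal, hence associated: it is the
  -- annihilator of some element.
  have hass := Module.associatedPrimes.minimalPrimes_annihilator_subset_associatedPrimes (S ⧸ I) (S ⧸ I)
    (IsArtinianRing.mem_minimalPrimes (I := Module.annihilator (S ⧸ I) (S ⧸ I))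
      (p := RingHom.ker χ) (by
        intro x hx
        have h1 : x * 1 = 0 := (Module.mem_annihilator.1 hx) 1
        rw [mul_one] at h1
        rw [h1]
        exact Ideal.zero_mem _))
  obtain ⟨-, x, hx⟩ := isAssociatedPrime_iff.1 hass
  obtain ⟨r, rfl⟩ := Ideal.Quotient.mk_surjective x
  refine ⟨r, fun hr => ?_, fun i => ?_⟩
  · rw [Ideal.Quotient.eq_zero_iff_mem.2 hr] at hx
    refine hprime.ne_top ?_
    rw [hx]
    simp
  · have h1 : Ideal.Quotient.mk I (D.a i - algebraMap ℂ S (P i)) ∈ RingHom.ker χ := by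
      rw [RingHom.mem_ker, hχ, map_sub, character_a, AlgHom.commutes]
      simp
    rw [hx, Submodule.mem_colon_singleton] at h1
    rw [← Ideal.Quotient.eq_zero_iff_mem, map_mul]
    simpa using h1

/-- The operators `L - P₀`, `A₁ - P₁`, `A₂ - P₂` have no left combination equal to `1`. -/
theorem one_notMem_leftIdeal {P : Fin 3 → ℂ} (hP : P ∈ D.points) : (1 : DiffOp K) ∉ D.leftIdeal P := by
  intro h
  obtain ⟨c, hc⟩ := (Submodule.mem_span_range_iff_exists_fun _).1 h
  obtain ⟨r, hr, hri⟩ := D.exists_socle hP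
  choose y hy using fun i => Ideal.mem_span_singleton'.1 (hri i)
  -- Multiplying 1 = ∑ cᵢ(Aᵢ - Pᵢ) on the right by r makes each summand a left multiple of L - P₀,
  -- because (Aᵢ - Pᵢ)r = yᵢ(L - P₀).
  have h1 : D.toOp r = (∑ i, c i * D.toOp (y i)) * D.toOp (D.a 0 - algebraMap ℂ S (P 0)) := by
    conv_lhs => rw [← one_mul (D.toOp r), ← hc]
    rw [Finset.sum_mul, Finset.sum_mul]
    refine Finset.sum_congr rfl fun i _ => ?_
    rw [smul_eq_mul, opAt_eq, mul_assoc, mul_assoc, ← map_mul, ← map_mul, hy]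
  have hne : D.toOp (D.a 0 - algebraMap ℂ S (P 0)) ≠ 0 := by
    rw [← D.opAt_eq, opAt, D.toOp_zero]
    intro h0
    have := (orderLT_const (algebraMap ℂ K (P 0))) 3 (by norm_num)
    rw [← sub_eq_zero.1 h0, coeff_opL] at this
    exact one_ne_zero this
  -- The left factor commutes with L, since r and L - P₀ do and L - P₀ cancels. It thus belongs to
  -- S, which puts r in the ideal it avoids.
  obtain ⟨s, hs⟩ := D.exists_toOp_eq (∑ i, c i * D.toOp (y i)) (by
    refine mul_right_cancel₀ hne ?_
    rw [mul_assoc, mul_assoc, ← h1, ← D.commute_opL, ← D.commute_opL, h1, mul_assoc])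
  rw [← hs, ← map_mul] at h1
  exact hr (Ideal.mem_span_singleton'.2 ⟨s, (D.toOp_injective h1).symm⟩)

theorem eq_zero_of_const_mem {P : Fin 3 → ℂ} (hP : P ∈ D.points) {c : K}
    (h : const c ∈ D.leftIdeal P) : c = 0 := by
  by_contra hc
  refine D.one_notMem_leftIdeal hP ?_
  have := (D.leftIdeal P).mul_mem_left (const c⁻¹) h
  rwa [← const_mul, inv_mul_cancel₀ hc, const_one] at this

/-- If the left ideal of a point contains `∂ + φ`, then `∂ + φ` generates it. -/
theorem exists_eq_mul_of_mem {P : Fin 3 → ℂ} (hP : P ∈ D.points) {φ : K}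
    (hφ : partial' + const φ ∈ D.leftIdeal P) {B : DiffOp K} (hB : B ∈ D.leftIdeal P) :
    IsRightDivisor (partial' + const φ) B := by
  have e : (partial' : DiffOp K).coeff 1 = 1 := by simpa using coeff_partial_pow (R := K) 1 1
  have h1 : OrderLT (partial' + const φ) 2 :=
    orderLT_partial.add ((orderLT_const φ).mono one_le_two)
  have h2 : (partial' + const φ).coeff 1 = 1 := by
    rw [DiffOp.coeff_add, e, coeff_const, if_neg one_ne_zero, add_zero]
  obtain ⟨U, hU⟩ := exists_right_division' h1 (h2 ▸ isUnit_one) B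
  have h3 := eq_const_of_orderLT_one hU
  have h4 : B - U * (partial' + const φ) ∈ D.leftIdeal P :=
    (D.leftIdeal P).sub_mem hB ((D.leftIdeal P).mul_mem_left U hφ)
  rw [h3] at h4
  rw [D.eq_zero_of_const_mem hP h4, const_zero] at h3
  exact ⟨U, sub_eq_zero.1 h3⟩

theorem eq_of_partial_add_const_mem {P : Fin 3 → ℂ} (hP : P ∈ D.points) {φ ψ : K}
    (hφ : partial' + const φ ∈ D.leftIdeal P) (hψ : partial' + const ψ ∈ D.leftIdeal P) :
    φ = ψ := by
  have h := (D.leftIdeal P).sub_mem hφ hψ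
  rw [add_sub_add_left_eq_sub, ← const_sub] at h
  exact sub_eq_zero.1 (D.eq_zero_of_const_mem hP h)

end Properness

end SpectralData

end Bsq

/-! ### The Burchnall-Chaundy polynomials as characteristic polynomials -/

namespace DiffOp

section Shifted

variable {R S : Type*} [CommRing R] [Differential R] [CommRing S] [Differential S]

theorem orderLT_sub_const {B : DiffOp R} {n : ℕ} (hn : 1 ≤ n) (hB : OrderLT B (n + 1)) (y : R) :
    OrderLT (B - const y) (n + 1) := hB.sub ((orderLT_const y).mono (by omega))

theorem coeff_sub_const {B : DiffOp R} {n : ℕ} (hn : 1 ≤ n) (y : R) :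
    (B - const y).coeff n = B.coeff n := by
  rw [coeff_sub, coeff_const, if_neg (by omega), sub_zero]

theorem orderLT_mapCoeff {B : DiffOp R} {n : ℕ} (hB : OrderLT B n) (f : R →+* S) :
    OrderLT (B.mapCoeff f) n := fun k hk => by rw [coeff_mapCoeff, hB k hk, map_zero]

theorem mapCoeff_mapCoeff {T : Type*} [CommRing T] (f : R →+* S) (g : S →+* T) (B : DiffOp R) :
    (B.mapCoeff f).mapCoeff g = B.mapCoeff (g.comp f) :=
  Polynomial.map_map _ _ _

theorem mapCoeff_id (B : DiffOp R) : B.mapCoeff (RingHom.id R) = B := Polynomial.map_id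

end Shifted

/-- Polynomials over a differential ring, the variable being a constant. -/
instance polynomialDifferential {R : Type*} [CommRing R] [Differential R] :
    Differential (Polynomial R) := ⟨Differential.mapCoeffs⟩

theorem deriv_C {R : Type*} [CommRing R] [Differential R] (a : R) :
    (Polynomial.C a)′ = Polynomial.C a′ := Differential.mapCoeffs_C a

theorem deriv_X {R : Type*} [CommRing R] [Differential R] : (Polynomial.X : Polynomial R)′ = 0 :=
  Differential.mapCoeffs_X

theorem coeff_deriv {R : Type*} [CommRing R] [Differential R] (p : Polynomial R) (k : ℕ) :
    (p′).coeff k = (p.coeff k)′ := rfl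

/-- Evaluation at a constant commutes with the derivation. -/
theorem deriv_eval₂ {R S : Type*} [CommRing R] [Differential R] [CommRing S] [Differential S]
    {f : R →+* S} (hf : ∀ a, f a′ = (f a)′) {y : S} (hy : y′ = 0) (p : Polynomial R) :
    Polynomial.eval₂RingHom f y p′ = (Polynomial.eval₂RingHom f y p)′ := by
  induction p using Polynomial.induction_on' with
  | add p q hp hq => rw [map_add, map_add, map_add, map_add, hp, hq]
  | monomial n a =>
    have hX : (Polynomial.X ^ n : Polynomial R)′ = 0 := by
      rw [Derivation.leibniz_pow, deriv_X, smul_zero, smul_zero]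
    have hyn : (y ^ n)′ = 0 := by rw [Derivation.leibniz_pow, hy, smul_zero, smul_zero]
    rw [← Polynomial.C_mul_X_pow_eq_monomial, Derivation.leibniz, hX, deriv_C]
    simp only [smul_eq_mul, mul_zero, zero_add, map_mul, map_pow, Polynomial.coe_eval₂RingHom,
      Polynomial.eval₂_C, Polynomial.eval₂_X, Derivation.leibniz, hyn, hf]

end DiffOp

namespace Bsq

open DiffOp MvPolynomial

/-- Substitution of two of the three variables in a polynomial in two variables. -/
def substPair (k : Type*) [CommRing k] (i j : Fin 3) :
    Polynomial (Polynomial k) →+* MvPolynomial (Fin 3) k :=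
  Polynomial.eval₂RingHom (Polynomial.eval₂RingHom MvPolynomial.C (X i)) (X j)

theorem map_substPair {k l : Type*} [CommRing k] [CommRing l] (f : k →+* l) (i j : Fin 3)
    (F : Polynomial (Polynomial k)) : MvPolynomial.map f (substPair k i j F) =
      substPair l i j (F.map (Polynomial.mapRingHom f)) := by
  have h : (MvPolynomial.map f).comp (substPair k i j) =
      (substPair l i j).comp (Polynomial.mapRingHom (Polynomial.mapRingHom f)) := by
    refine Polynomial.ringHom_ext' (Polynomial.ringHom_ext' ?_ ?_) ?_
    · ext x; simp [substPair]
    · simp [substPair]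
    · simp [substPair]
  exact congrArg (fun g => g F) h

theorem eval_substPair {k : Type*} [CommRing k] (P : Fin 3 → k) (i j : Fin 3)
    (F : Polynomial (Polynomial k)) : MvPolynomial.eval P (substPair k i j F) =
      (F.map (Polynomial.evalRingHom (P i))).eval (P j) := by
  have h : (MvPolynomial.eval P).comp (substPair k i j) =
      (Polynomial.evalRingHom (P j)).comp
        (Polynomial.mapRingHom (Polynomial.evalRingHom (P i))) := by
    refine Polynomial.ringHom_ext' (Polynomial.ringHom_ext' ?_ ?_) ?_
    · ext x; simp [substPair]
    · simp [substPair]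
    · simp [substPair]
  exact congrArg (fun g => g F) h

theorem deriv_mvPolynomial_X {R : Type*} [CommRing R] [Differential R] (i : Fin 3) :
    (X i : MvPolynomial (Fin 3) R)′ = 0 := by
  classical
  ext s
  refine (MvPolyDeriv.coeff_derivCoeff _ s).trans ?_
  rw [MvPolynomial.coeff_X, MvPolynomial.coeff_zero]
  split_ifs <;> simp

theorem deriv_mvPolynomial_C {R : Type*} [CommRing R] [Differential R] (a : R) :
    (MvPolynomial.C a : MvPolynomial (Fin 3) R)′ = MvPolynomial.C a′ := by
  classical
  ext s
  refine (MvPolyDeriv.coeff_derivCoeff _ s).trans ?_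
  rw [MvPolynomial.coeff_C, MvPolynomial.coeff_C]
  split_ifs <;> simp

theorem aeval_substPair {A : Type*} [CommRing A] [Algebra ℂ A] (a : Fin 3 → A) (i j : Fin 3)
    (F : Polynomial (Polynomial ℂ)) : MvPolynomial.aeval a (substPair ℂ i j F) =
      F.eval₂ (Polynomial.aeval (a i)).toRingHom (a j) := by
  have h : (MvPolynomial.aeval a).toRingHom.comp (substPair ℂ i j) =
      Polynomial.eval₂RingHom (Polynomial.aeval (a i)).toRingHom (a j) := by
    refine Polynomial.ringHom_ext' (Polynomial.ringHom_ext' ?_ ?_) ?_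
    · ext x; simp [substPair]
    · simp [substPair]
    · simp [substPair]
  exact congrArg (fun g => g F) h

namespace SpectralData

variable {K S : Type*} [Field K] [Differential K] [CharZero K] [Algebra ℂ K] [CommRing S]
  [Algebra ℂ S] (D : SpectralData K S)

theorem exists_leadingCoeff (i : Fin 3) : ∃ c : ℂ, c ≠ 0 ∧
    (D.toOp (D.a i)).coeff (D.toOp (D.a i)).order = algebraMap ℂ K c := by
  obtain ⟨c, hc⟩ := Bsq.exists_leadingCoeff D.constants (D.commute_opL (D.a i))
  refine ⟨c, fun h0 => ?_, hc⟩
  have h1 : D.toOp (D.a i) ≠ 0 := fun h => by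
    have := D.order_pos i
    rw [h, show (0 : DiffOp K).order = 0 from Polynomial.natDegree_zero] at this
    omega
  exact coeff_order_ne_zero h1 (by rw [hc, h0, map_zero])

theorem isUnit_leadingCoeff (i : Fin 3) :
    IsUnit ((D.toOp (D.a i)).coeff (D.toOp (D.a i)).order) := by
  obtain ⟨c, hc, h⟩ := D.exists_leadingCoeff i
  rw [h]
  exact (isUnit_iff_ne_zero.2 hc).map _

/-- A_j commutes with Aᵢ - X over K[X], so the Lax equation makes the coefficients of the
characteristic polynomial constants of K[X], that is, elements of ℂ[X]. -/
theorem exists_charpoly (i j : Fin 3) :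
    ∃ (T : Matrix (Fin (D.toOp (D.a i)).order) (Fin (D.toOp (D.a i)).order) (Polynomial K))
      (F : Polynomial (Polynomial ℂ)),
      IsMulMatrix ((D.toOp (D.a i)).mapCoeff Polynomial.C - const Polynomial.X)
        ((D.toOp (D.a j)).mapCoeff Polynomial.C) T ∧
      F.map (Polynomial.mapRingHom (algebraMap ℂ K)) = T.charpoly := by
  have hn := D.order_pos i
  have hP := orderLT_sub_const hn (orderLT_mapCoeff (orderLT_order_succ (D.toOp (D.a i)))
    (Polynomial.C : K →+* Polynomial K)) Polynomial.X
  have hu : IsUnit (((D.toOp (D.a i)).mapCoeff Polynomial.C - const Polynomial.X).coeff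
      (D.toOp (D.a i)).order) := by
    rw [coeff_sub_const hn, coeff_mapCoeff]
    exact (D.isUnit_leadingCoeff i).map _
  obtain ⟨T, hT⟩ := exists_isMulMatrix hP hu ((D.toOp (D.a j)).mapCoeff Polynomial.C)
  have hcomm : ((D.toOp (D.a i)).mapCoeff Polynomial.C - const Polynomial.X) *
      (D.toOp (D.a j)).mapCoeff Polynomial.C = (D.toOp (D.a j)).mapCoeff Polynomial.C *
        ((D.toOp (D.a i)).mapCoeff Polynomial.C - const Polynomial.X) := by
    have hC : ∀ a : K, Polynomial.C a′ = (Polynomial.C a)′ := fun a => (deriv_C a).symm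
    rw [sub_mul, mul_sub, ← mapCoeff_mul hC, ← mapCoeff_mul hC, D.commute,
      const_mul_comm_of_deriv deriv_X]
  obtain ⟨Ω, hΩ⟩ := hT.exists_lax hP hu hcomm
  have hlift : T.charpoly ∈ Polynomial.lifts (Polynomial.mapRingHom (algebraMap ℂ K)) := by
    rw [Polynomial.lifts_iff_coeff_lifts]
    intro k
    have h1 : T.charpoly.coeff k ∈ Polynomial.lifts (algebraMap ℂ K) := by
      rw [Polynomial.lifts_iff_coeff_lifts]
      intro l
      rw [← D.constants, ← coeff_deriv, deriv_coeff_charpoly_of_lax hΩ, Polynomial.coeff_zero]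
    obtain ⟨q, hq⟩ := (Polynomial.mem_lifts _).1 h1
    exact ⟨q, hq⟩
  obtain ⟨F, hF⟩ := (Polynomial.mem_lifts _).1 hlift
  exact ⟨T, F, hT, hF⟩

/-- The matrix of the right multiplication by `Aⱼ` modulo `Aᵢ - X`. -/
def mulMatrix (i j : Fin 3) :
    Matrix (Fin (D.toOp (D.a i)).order) (Fin (D.toOp (D.a i)).order) (Polynomial K) :=
  (D.exists_charpoly i j).choose

/-- The characteristic polynomial of the right multiplication by `Aⱼ` modulo `Aᵢ - X`. -/
def curvePoly (i j : Fin 3) : Polynomial (Polynomial ℂ) :=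
  (D.exists_charpoly i j).choose_spec.choose

theorem isMulMatrix_mulMatrix (i j : Fin 3) :
    IsMulMatrix ((D.toOp (D.a i)).mapCoeff Polynomial.C - const Polynomial.X)
      ((D.toOp (D.a j)).mapCoeff Polynomial.C) (D.mulMatrix i j) :=
  (D.exists_charpoly i j).choose_spec.choose_spec.1

theorem map_curvePoly (i j : Fin 3) :
    (D.curvePoly i j).map (Polynomial.mapRingHom (algebraMap ℂ K)) = (D.mulMatrix i j).charpoly :=
  (D.exists_charpoly i j).choose_spec.choose_spec.2

theorem injective_mapRingHom_algebraMap :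
    Function.Injective (Polynomial.mapRingHom (algebraMap ℂ K)) :=
  Polynomial.map_injective _ (algebraMap ℂ K).injective

theorem monic_curvePoly (i j : Fin 3) : (D.curvePoly i j).Monic := by
  rw [injective_mapRingHom_algebraMap (K := K).monic_map_iff, D.map_curvePoly]
  exact Matrix.charpoly_monic _

theorem natDegree_curvePoly (i j : Fin 3) :
    (D.curvePoly i j).natDegree = (D.toOp (D.a i)).order := by
  rw [← Polynomial.natDegree_map_eq_of_injective (injective_mapRingHom_algebraMap (K := K)),
    D.map_curvePoly, Matrix.charpoly_natDegree_eq_dim, Fintype.card_fin]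

theorem coeff_pencil (k l : Fin 3) :
    (pencil (D.toOp (D.a k)) l).coeff (D.toOp (D.a k)).order =
      MvPolynomial.C ((D.toOp (D.a k)).coeff (D.toOp (D.a k)).order) := by
  rw [pencil, coeff_sub_const (D.order_pos k), coeff_mapCoeff]

theorem order_pencil (k l : Fin 3) :
    (pencil (D.toOp (D.a k)) l).order = (D.toOp (D.a k)).order :=
  order_eq_of_coeff
    (orderLT_sub_const (D.order_pos k) (orderLT_mapCoeff (orderLT_order_succ _) _) _) (by
      change (pencil (D.toOp (D.a k)) l).coeff _ ≠ 0
      rw [D.coeff_pencil]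
      exact ((D.isUnit_leadingCoeff k).map MvPolynomial.C).ne_zero)

/-- The differential resultants have complex coefficients. -/
theorem dRes_pencil (i j : Fin 3) : ∃ c : ℂ, c ≠ 0 ∧
    dRes (pencil (D.toOp (D.a i)) i) (pencil (D.toOp (D.a j)) j) =
      MvPolynomial.map (algebraMap ℂ K)
        (MvPolynomial.C c * substPair ℂ i j (D.curvePoly i j)) := by
  obtain ⟨c, hc0, hc⟩ := D.exists_leadingCoeff i
  let φ : Polynomial K →+* MvPolynomial (Fin 3) K := Polynomial.eval₂RingHom MvPolynomial.C (X i)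
  have hφ : ∀ p, φ p′ = (φ p)′ :=
    deriv_eval₂ (fun a => (deriv_mvPolynomial_C a).symm) (deriv_mvPolynomial_X i)
  have hφC : φ.comp Polynomial.C = MvPolynomial.C := by ext x; simp [φ]
  have hT := ((D.isMulMatrix_mulMatrix i j).mapCoeff hφ).sub_const (deriv_mvPolynomial_X j)
  rw [mapCoeff_sub, mapCoeff_const, mapCoeff_mapCoeff, mapCoeff_mapCoeff, hφC,
    show φ Polynomial.X = X i from Polynomial.eval₂_X _ _] at hT
  have hu : IsUnit ((pencil (D.toOp (D.a i)) i).coeff (D.toOp (D.a i)).order) := by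
    rw [D.coeff_pencil i i]
    exact (D.isUnit_leadingCoeff i).map _
  have hres : dRes (pencil (D.toOp (D.a i)) i) (pencil (D.toOp (D.a j)) j) = _ :=
    dRes_eq_det_of_order_eq (D.order_pencil i i) hu hT
  -- The sign (-1)ⁿ appears because the characteristic polynomial is the determinant of X - T rather
  -- than of T - X.
  have hdet : ((D.mulMatrix i j).map φ - Matrix.scalar _ (X j)).det =
      (-1) ^ (D.toOp (D.a i)).order *
        substPair K i j ((D.curvePoly i j).map (Polynomial.mapRingHom (algebraMap ℂ K))) := by
    rw [D.map_curvePoly, ← neg_sub, Matrix.det_neg, Fintype.card_fin, ← Matrix.eval_charpoly,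
      Matrix.charpoly_map, Polynomial.eval_map]
    rfl
  refine ⟨c ^ (D.toOp (D.a j)).order * (-1) ^ (D.toOp (D.a i)).order, by simp [hc0], ?_⟩
  rw [hres, hdet, D.coeff_pencil i i, hc, D.order_pencil j j, map_mul, MvPolynomial.map_C, map_substPair]
  simp only [map_mul, map_pow, map_neg, map_one, mul_assoc]

/-! #### Specialization at a point -/

section Specialize

variable (P : Fin 3 → ℂ) (i j : Fin 3)

theorem orderLT_opAt : OrderLT (D.opAt P i) ((D.toOp (D.a i)).order + 1) :=
  orderLT_sub_const (D.order_pos i) (orderLT_order_succ _) _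

theorem isUnit_coeff_opAt : IsUnit ((D.opAt P i).coeff (D.toOp (D.a i)).order) := by
  rw [opAt, coeff_sub_const (D.order_pos i)]
  exact D.isUnit_leadingCoeff i

theorem order_opAt : (D.opAt P i).order = (D.toOp (D.a i)).order :=
  order_eq_of_coeff (D.orderLT_opAt P i) (D.isUnit_coeff_opAt P i).ne_zero

/-- The curve polynomial with the first variable specialized. -/
def curvePolyAt : Polynomial ℂ := (D.curvePoly i j).map (Polynomial.evalRingHom (P i))

theorem exists_mulMatrix_opAt :
    ∃ T : Matrix (Fin (D.toOp (D.a i)).order) (Fin (D.toOp (D.a i)).order) K,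
      IsMulMatrix (D.opAt P i) (D.opAt P j) (T - Matrix.scalar _ (algebraMap ℂ K (P j))) ∧
      T.charpoly = (D.curvePolyAt P i j).map (algebraMap ℂ K) := by
  let φ : Polynomial K →+* K := Polynomial.eval₂RingHom (RingHom.id K) (algebraMap ℂ K (P i))
  have hφ : ∀ p, φ p′ = (φ p)′ := deriv_eval₂ (fun a => rfl) (D.deriv_algebraMap (P i))
  have hφC : φ.comp Polynomial.C = RingHom.id K := by ext x; simp [φ]
  have hT := ((D.isMulMatrix_mulMatrix i j).mapCoeff hφ).sub_const (D.deriv_algebraMap (P j))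
  rw [mapCoeff_sub, mapCoeff_const, mapCoeff_mapCoeff, mapCoeff_mapCoeff, hφC, mapCoeff_id,
    mapCoeff_id, show φ Polynomial.X = algebraMap ℂ K (P i) from Polynomial.eval₂_X _ _] at hT
  refine ⟨_, hT, ?_⟩
  rw [Matrix.charpoly_map, ← D.map_curvePoly, curvePolyAt, Polynomial.map_map, Polynomial.map_map]
  congr 1
  refine Polynomial.ringHom_ext (fun c => ?_) ?_ <;> simp [φ]

/-- The points of the spectral curve satisfy the curve polynomials. -/
theorem eval_curvePolyAt {P : Fin 3 → ℂ} (hP : P ∈ D.points) :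
    (D.curvePolyAt P i j).eval (P j) = 0 := by
  obtain ⟨T, hT, hchar⟩ := D.exists_mulMatrix_opAt P i j
  have hn := D.order_pos i
  by_contra h0
  have hdet : (T - Matrix.scalar _ (algebraMap ℂ K (P j))).det ≠ 0 := by
    rw [← neg_sub, Matrix.det_neg, ← Matrix.eval_charpoly, hchar, Polynomial.eval_map_algebraMap,
      Polynomial.aeval_algebraMap_apply]
    refine mul_ne_zero (pow_ne_zero _ (neg_ne_zero.2 one_ne_zero)) ?_
    rw [Polynomial.coe_aeval_eq_eval]
    exact (map_ne_zero _).2 h0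
  -- If the matrix were invertible, the row vector of the operator 1 could be lifted through it, and
  -- 1 would be a left combination of the two operators.
  obtain ⟨U, hU⟩ := hT.vecOp_mul (Matrix.vecMul (Pi.single ⟨0, hn⟩ 1)
    (T - Matrix.scalar _ (algebraMap ℂ K (P j)))⁻¹)
  rw [Matrix.vecMul_vecMul, Matrix.nonsing_inv_mul _ (isUnit_iff_ne_zero.2 hdet),
    Matrix.vecMul_one] at hU
  have h1 : vecOp (Pi.single (⟨0, hn⟩ : Fin (D.toOp (D.a i)).order) (1 : K)) = 1 := by
    rw [vecOp, Finset.sum_eq_single ⟨0, hn⟩]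
    · simp [const_one]
    · intro k _ hk; simp [hk, const_zero]
    · simp
  rw [h1] at hU
  refine D.one_notMem_leftIdeal hP ?_
  rw [← sub_eq_iff_eq_add'.2 hU]
  exact (D.leftIdeal P).sub_mem ((D.leftIdeal P).mul_mem_left _ (D.opAt_mem P j))
    ((D.leftIdeal P).mul_mem_left _ (D.opAt_mem P i))

/-- Two independent vectors in the kernel force a multiple root of the curve polynomial. -/
theorem eval_derivative_curvePolyAt {P : Fin 3 → ℂ} (hP : P ∈ D.points)
    (hs : subres (D.opAt P i) (D.opAt P j) 1 = 0) :
    (D.curvePolyAt P i j).derivative.eval (P j) = 0 := by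
  obtain ⟨T, hT, hchar⟩ := D.exists_mulMatrix_opAt P i j
  have hPn := D.orderLT_opAt P i
  have hPu := D.isUnit_coeff_opAt P i
  have hP0 : D.opAt P i ≠ 0 := fun h => hPu.ne_zero (by rw [h, DiffOp.coeff_zero])
  obtain ⟨U, V, c, hUV, hV, hc⟩ := exists_combination_of_subres_eq_zero
    (by rw [D.order_opAt]; exact D.order_pos i) (by rw [D.order_opAt]; exact D.order_pos j) hs
  rw [D.order_opAt] at hV
  -- The combination of order zero lies in a proper left ideal, so it vanishes and gives an honest
  -- kernel vector V.
  have hc0 : c = 0 := D.eq_zero_of_const_mem hP (by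
    rw [← hc]
    exact (D.leftIdeal P).add_mem ((D.leftIdeal P).mul_mem_left _ (D.opAt_mem P i))
      ((D.leftIdeal P).mul_mem_left _ (D.opAt_mem P j)))
  rw [hc0, const_zero] at hc
  have hne_V : V ≠ 0 := fun h0 => by
    rw [h0, zero_mul, add_zero] at hc
    exact hUV.elim (fun hU => (mul_ne_zero hU hP0) hc) (fun hV => hV h0)
  have hVd := order_lt_of_orderLT hV hne_V
  have hVQ : V * D.opAt P j = -U * D.opAt P i := by
    rw [neg_mul]; exact eq_neg_of_add_eq_zero_right hc
  have hker : ∀ W U' : DiffOp K, OrderLT W (D.toOp (D.a i)).order → W * D.opAt P j = U' * D.opAt P i →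
      Matrix.vecMul (fun k : Fin (D.toOp (D.a i)).order => W.coeff k) T = algebraMap ℂ K (P j) • fun k : Fin (D.toOp (D.a i)).order => W.coeff k := by
    intro W U' hW hWQ
    obtain ⟨U'', hU''⟩ := hT.vecOp_mul fun k : Fin (D.toOp (D.a i)).order => W.coeff k
    rw [← eq_vecOp hW, hWQ] at hU''
    have h1 : Matrix.vecMul (fun k : Fin (D.toOp (D.a i)).order => W.coeff k) (T - Matrix.scalar (Fin (D.toOp (D.a i)).order) (algebraMap ℂ K (P j))) = 0 :=
      remainder_unique hPn hPu (U := U'') (U' := U') (by rw [vecOp_zero, add_zero, hU''])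
    rw [Matrix.vecMul_sub, sub_eq_zero] at h1
    rw [h1]
    ext k
    simp [Matrix.vecMul_diagonal, mul_comm]
  have hV' := hker V (-U) (hV.mono (by omega)) hVQ
  -- The bound on V leaves room for one more ∂: the operator ∂V is still a remainder and also lies
  -- in the kernel. Having one order more than V, it is independent of it, so the eigenspace has
  -- dimension at least two and the root is multiple.
  have hdV := hker (partial' * V) (partial' * -U) (hV.partial_mul.mono (by omega))
    (by rw [mul_assoc, hVQ, mul_assoc])
  have hli : LinearIndependent K ![fun k : Fin (D.toOp (D.a i)).order => V.coeff k, fun k : Fin (D.toOp (D.a i)).order => (partial' * V).coeff k] := by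
    rw [LinearIndependent.pair_iff]
    intro s t hst
    have hst' : const s * V + const t * (partial' * V) = 0 := by
      have h1 := congrArg vecOp hst
      rwa [vecOp_add, vecOp_smul, vecOp_smul, ← eq_vecOp (hV.mono (by omega)),
        ← eq_vecOp (hV.partial_mul.mono (by omega)), vecOp_zero] at h1
    have h2 := congrArg (fun B => B.coeff (V.order + 1)) hst'
    have h3 := orderLT_order_succ V (V.order + 1) le_rfl
    simp only [DiffOp.coeff_add, coeff_const_mul, coeff_partial_mul_succ, h3, mul_zero, map_zero,
      add_zero, zero_add, DiffOp.coeff_zero] at h2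
    have ht : t = 0 := (mul_eq_zero.1 h2).resolve_right (coeff_order_ne_zero hne_V)
    rw [ht, const_zero, zero_mul, add_zero] at hst'
    have h4 := (mul_eq_zero.1 hst').resolve_right hne_V
    exact ⟨const_injective (h4.trans const_zero.symm), ht⟩
  have hspan : Submodule.span K (Set.range
      ![fun k : Fin (D.toOp (D.a i)).order => V.coeff k, fun k : Fin (D.toOp (D.a i)).order => (partial' * V).coeff k]) ≤
      Module.End.eigenspace (Matrix.toLin' T.transpose) (algebraMap ℂ K (P j)) := by
    rw [Submodule.span_le]
    rintro _ ⟨k, rfl⟩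
    rw [SetLike.mem_coe, Module.End.mem_eigenspace_iff, Matrix.toLin'_apply,
      Matrix.mulVec_transpose]
    fin_cases k
    · exact hV'
    · exact hdV
  have hcard := finrank_span_eq_card hli
  have hmult := (Submodule.finrank_mono hspan).trans
    (LinearMap.finrank_eigenspace_le (Matrix.toLin' T.transpose) (algebraMap ℂ K (P j)))
  rw [hcard, Fintype.card_fin, Matrix.charpoly_toLin', Matrix.charpoly_transpose, hchar] at hmult
  have hne : (D.curvePolyAt P i j).map (algebraMap ℂ K) ≠ 0 :=
    (((D.monic_curvePoly i j).map _).map _).ne_zero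
  have hroot := ((Polynomial.one_lt_rootMultiplicity_iff_isRoot hne).1
    (lt_of_lt_of_le one_lt_two hmult)).2
  rw [Polynomial.derivative_map, Polynomial.IsRoot, Polynomial.eval_map_algebraMap,
    Polynomial.aeval_algebraMap_apply, Polynomial.coe_aeval_eq_eval] at hroot
  exact (map_eq_zero _).1 hroot

end Specialize

end SpectralData

end Bsq

/-! ### The geometry of the spectral curve -/

namespace Bsq

open DiffOp MvPolynomial

section SubstPair

theorem substPair_C_X {k : Type*} [CommRing k] (i j : Fin 3) :
    substPair k i j (Polynomial.C Polynomial.X) = X i := by simp [substPair]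

theorem substPair_X {k : Type*} [CommRing k] (i j : Fin 3) :
    substPair k i j Polynomial.X = X j := by simp [substPair]

/-- The partial derivatives of a polynomial in two of the three variables. -/
theorem pderiv_substPair {k : Type*} [CommRing k] {i j l : Fin 3} (hl : l ≠ i)
    (F : Polynomial (Polynomial k)) : pderiv l (substPair k i j F) =
      if l = j then substPair k i j F.derivative else 0 := by
  have hC : ∀ c : Polynomial k, pderiv l (substPair k i j (Polynomial.C c)) = 0 := by
    intro c
    induction c using Polynomial.induction_on' with
    | add p q hp hq => rw [Polynomial.C_add, map_add, map_add, hp, hq, add_zero]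
    | monomial n c =>
      rw [← Polynomial.C_mul_X_pow_eq_monomial, Polynomial.C_mul, Polynomial.C_pow, map_mul,
        map_pow, substPair_C_X, Derivation.leibniz, Derivation.leibniz_pow,
        pderiv_X_of_ne hl.symm]
      simp [substPair]
  induction F using Polynomial.induction_on' with
  | add p q hp hq =>
    rw [map_add, map_add, hp, hq, Polynomial.derivative_add, map_add]
    split_ifs
    · rfl
    · rw [add_zero]
  | monomial n c =>
    rw [← Polynomial.C_mul_X_pow_eq_monomial, map_mul, map_pow, substPair_X, Derivation.leibniz,
      hC, smul_zero, add_zero, Derivation.leibniz_pow]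
    split_ifs with h
    · subst h
      rw [pderiv_X_self, Polynomial.derivative_C_mul_X_pow]
      simp only [map_mul, map_pow, map_natCast, substPair_X, smul_eq_mul, nsmul_eq_mul, mul_one]
      ring
    · rw [pderiv_X_of_ne (Ne.symm h)]
      simp

end SubstPair

namespace SpectralData

variable {K S : Type*} [Field K] [Differential K] [CharZero K] [Algebra ℂ K] [CommRing S]
  [Algebra ℂ S] (D : SpectralData K S)

/-- The value of a polynomial in two variables at `(aᵢ, aⱼ)`. -/
def evalPair (i j : Fin 3) : Polynomial (Polynomial ℂ) →+* S :=
  Polynomial.eval₂RingHom (Polynomial.aeval (D.a i)).toRingHom (D.a j)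

theorem evalGen_substPair (i j : Fin 3) (F : Polynomial (Polynomial ℂ)) :
    D.evalGen (substPair ℂ i j F) = D.evalPair i j F := aeval_substPair _ _ _ _

theorem substPair_curvePoly_mem (i j : Fin 3) :
    substPair ℂ i j (D.curvePoly i j) ∈ D.relations :=
  D.mem_relations_of_forall fun P hP => by
    rw [eval_substPair]
    exact D.eval_curvePolyAt i j hP

theorem evalPair_curvePoly (i j : Fin 3) : D.evalPair i j (D.curvePoly i j) = 0 := by
  rw [← evalGen_substPair]
  exact D.substPair_curvePoly_mem i j

/-- `A₁` and `A₂` satisfy no equation of degree less than three over `ℂ[L]`. -/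
theorem evalPair_zero_ne_zero {k : Fin 3} (hk : k ≠ 0) {G : Polynomial (Polynomial ℂ)}
    (hG : G ≠ 0) (hdeg : G.natDegree < 3) : D.evalPair 0 k G ≠ 0 := by
  intro h0
  have h := congrArg D.toOp h0
  rw [evalPair, Polynomial.coe_eval₂RingHom, Polynomial.eval₂_eq_sum_range' _ hdeg,
    Finset.sum_range, map_sum, map_zero] at h
  have hk' : (D.toOp (D.a k)).order % 3 = 1 ∨ (D.toOp (D.a k)).order % 3 = 2 := by
    fin_cases k
    · exact absurd rfl hk
    · exact Or.inl D.order_one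
    · exact Or.inr D.order_two
  have hne : D.toOp (D.a k) ≠ 0 := fun h0 => by
    rw [h0, show (0 : DiffOp K).order = 0 from Polynomial.natDegree_zero] at hk'
    omega
  have hterm : ∀ n : Fin 3, D.toOp ((Polynomial.aeval (D.a 0)).toRingHom (G.coeff n) *
      D.a k ^ (n : ℕ)) = polyAt D.constants (opL D.u D.v) (G.coeff n) *
        D.toOp (D.a k) ^ (n : ℕ) := fun n => by
    rw [map_mul, map_pow, ← D.toOp_zero, ← D.toOp_aeval]
    rfl
  simp only [hterm] at h
  have hord := order_ne_of_mod_ne D.constants D.u D.v (fun n : Fin 3 => G.coeff n)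
    (fun n => D.toOp (D.a k) ^ (n : ℕ)) (by
      have h0 : (D.toOp (D.a k) ^ 0).order = 0 := by
        rw [pow_zero]; exact Polynomial.natDegree_one
      have h1 : (D.toOp (D.a k) ^ 1).order = (D.toOp (D.a k)).order := by rw [pow_one]
      have h2 : (D.toOp (D.a k) ^ 2).order = 2 * (D.toOp (D.a k)).order := order_pow hne 2
      intro i j hij
      fin_cases i <;> fin_cases j <;> first
        | exact absurd rfl hij
        | (simp only [h0, h1, h2]; omega))
  have hz := eq_zero_of_sum_eq_zero hord h
  refine hG (Polynomial.ext fun n => ?_)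
  rw [Polynomial.coeff_zero]
  rcases lt_or_ge n 3 with hn | hn
  · by_contra hc
    exact (mul_ne_zero (polyAt_opL_ne_zero D.constants D.u D.v hc).1 (pow_ne_zero n hne))
      (hz ⟨n, hn⟩)
  · exact Polynomial.coeff_eq_zero_of_natDegree_lt (by omega)

theorem natDegree_curvePoly_zero (k : Fin 3) : (D.curvePoly 0 k).natDegree = 3 := by
  rw [D.natDegree_curvePoly, D.toOp_zero, order_opL]

theorem coeff_derivative_curvePoly_zero (k : Fin 3) :
    (D.curvePoly 0 k).derivative.coeff 2 = 3 := by
  have h := D.monic_curvePoly 0 k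
  rw [Polynomial.Monic, Polynomial.leadingCoeff, natDegree_curvePoly_zero] at h
  rw [Polynomial.coeff_derivative, h]
  norm_num

theorem natDegree_derivative_curvePoly_zero (k : Fin 3) :
    (D.curvePoly 0 k).derivative.natDegree < 3 :=
  lt_of_le_of_lt (Polynomial.natDegree_derivative_le _) (by
    rw [natDegree_curvePoly_zero]; norm_num)

theorem derivative_curvePoly_zero_sub_C_ne_zero (k : Fin 3) (c : Polynomial ℂ) :
    (D.curvePoly 0 k).derivative - Polynomial.C c ≠ 0 := fun h => by
  have h2 := congrArg (fun p => p.coeff 2) h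
  simp only [Polynomial.coeff_sub, coeff_derivative_curvePoly_zero, Polynomial.coeff_C_succ,
    sub_zero, Polynomial.coeff_zero] at h2
  norm_num at h2

/-- The curve polynomial over ℂ[L] is a monic cubic, so its derivative has degree two; 1, A_k, A_k²
are independent over ℂ[L]. -/
theorem evalPair_derivative_curvePoly_ne_zero {k : Fin 3} (hk : k ≠ 0) :
    D.evalPair 0 k (D.curvePoly 0 k).derivative ≠ 0 := by
  have h := D.derivative_curvePoly_zero_sub_C_ne_zero k 0
  rw [map_zero, sub_zero] at h
  exact D.evalPair_zero_ne_zero hk h (D.natDegree_derivative_curvePoly_zero k)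

include D in
/-- The units of `S` are the nonzero complex numbers. -/
theorem exists_eq_algebraMap_of_mul_eq_one {s t : S} (h : s * t = 1) :
    ∃ c : ℂ, s = algebraMap ℂ S c := by
  have h0 := D.order_unit h
  obtain ⟨c, hc⟩ := Bsq.exists_leadingCoeff D.constants (D.commute_opL s)
  refine ⟨c, D.toOp_injective ?_⟩
  have h1 := eq_const_of_orderLT_one (h0 ▸ orderLT_order_succ (D.toOp s))
  rw [h0] at hc
  rw [D.toOp_algebraMap, ← hc, ← h1]

/-- The derivative of the curve polynomial is not a unit. -/
theorem evalPair_derivative_curvePoly_mul_ne_one {k : Fin 3} (hk : k ≠ 0) (t : S) :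
    D.evalPair 0 k (D.curvePoly 0 k).derivative * t ≠ 1 := by
  intro h
  obtain ⟨c, hc⟩ := D.exists_eq_algebraMap_of_mul_eq_one h
  -- A unit is a scalar c, and the derivative minus c would be a relation of degree two for A_k.
  refine D.evalPair_zero_ne_zero hk (D.derivative_curvePoly_zero_sub_C_ne_zero k (Polynomial.C c))
    (lt_of_le_of_lt (Polynomial.natDegree_sub_C).le (D.natDegree_derivative_curvePoly_zero k)) ?_
  rw [map_sub, hc, sub_eq_zero]
  simp [evalPair]

/-! #### Finiteness over the line -/

theorem aeval_zero_ne_zero {p : Polynomial ℂ} (hp : p ≠ 0) : Polynomial.aeval (D.a 0) p ≠ 0 := by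
  intro h
  have := congrArg D.toOp h
  rw [D.toOp_aeval, D.toOp_zero, map_zero] at this
  exact (polyAt_opL_ne_zero D.constants D.u D.v hp).1 this

/-- The monic curve polynomials of A₁ and A₂ over ℂ[L] make the generators integral. -/
theorem isIntegralElem (s : S) : RingHom.IsIntegralElem (R := Polynomial ℂ) (Polynomial.aeval (D.a 0)).toRingHom s := by
  have hk : ∀ k, RingHom.IsIntegralElem (R := Polynomial ℂ) (Polynomial.aeval (D.a 0)).toRingHom (D.a k) := fun k =>
    ⟨D.curvePoly 0 k, D.monic_curvePoly 0 k, D.evalPair_curvePoly 0 k⟩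
  have hC : ∀ p : Polynomial ℂ, RingHom.IsIntegralElem (R := Polynomial ℂ) (Polynomial.aeval (D.a 0)).toRingHom (Polynomial.aeval (D.a 0) p) :=
    fun p => RingHom.isIntegralElem_map _
  obtain ⟨p, q, r, rfl⟩ := D.generates s
  exact ((hC p).add _ ((hC q).mul _ (hk 1))).add _ ((hC r).mul _ (hk 2))

/-- In an integral extension of domains a nonzero ideal meets the base in a nonzero ideal. The zeros
of s thus lie over finitely many values of λ. -/
theorem exists_aeval_eq_mul {s : S} (hs : s ≠ 0) :
    ∃ c : Polynomial ℂ, c ≠ 0 ∧ ∃ t, Polynomial.aeval (D.a 0) c = t * s := by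
  have := D.isDomain
  let _ : Algebra (Polynomial ℂ) S := (Polynomial.aeval (D.a 0)).toRingHom.toAlgebra
  have h := Ideal.comap_ne_bot_of_integral_mem (R := Polynomial ℂ) hs
    (Ideal.mem_span_singleton_self s) (D.isIntegralElem s)
  obtain ⟨c, hc, hc0⟩ := Submodule.exists_mem_ne_zero_of_ne_bot h
  obtain ⟨t, ht⟩ := Ideal.mem_span_singleton'.1 (Ideal.mem_comap.1 hc)
  exact ⟨c, hc0, t, ht.symm⟩

/-- A polynomial that is not a relation has finitely many zeros on the curve. -/
theorem finite_zeros {p : MvPolynomial (Fin 3) ℂ} (hp : p ∉ D.relations) :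
    {P ∈ D.points | MvPolynomial.eval P p = 0}.Finite := by
  obtain ⟨c, hc, t, ht⟩ := D.exists_aeval_eq_mul (s := D.evalGen p) hp
  have hfin : ∀ k, (⋃ x ∈ c.roots.toFinset,
      ((D.curvePolyAt (fun _ => x) 0 k).roots.toFinset : Set ℂ)).Finite := fun k =>
    Set.Finite.biUnion (Finset.finite_toSet _) fun x _ => Finset.finite_toSet _
  refine (Set.Finite.pi hfin).subset ?_
  rintro P ⟨hP, hPp⟩ k -
  have h0 : c.eval (P 0) = 0 := by
    have h1 := congrArg (D.character hP) ht
    rw [map_mul, D.character_evalGen, hPp, mul_zero, ← Polynomial.aeval_algHom_apply,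
      D.character_a, Polynomial.coe_aeval_eq_eval] at h1
    exact h1
  refine Set.mem_biUnion (x := P 0) (by simpa [hc] using h0) ?_
  rw [Finset.mem_coe, Multiset.mem_toFinset, Polynomial.mem_roots']
  exact ⟨((D.monic_curvePoly 0 k).map _).ne_zero, D.eval_curvePolyAt 0 k hP⟩

/-- Every complex number is the first coordinate of a point of the curve. -/
theorem exists_point (x : ℂ) : ∃ P ∈ D.points, P 0 = x := by
  -- L - x has order three, so it is not a unit; a maximal ideal containing it is a point by the
  -- Nullstellensatz.
  have htop : Ideal.span {D.a 0 - algebraMap ℂ S x} ≠ ⊤ := by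
    intro h
    rw [Ideal.span_singleton_eq_top] at h
    obtain ⟨t, ht⟩ := h.exists_right_inv
    have h1 := D.order_unit ht
    have h2 := D.order_opAt (fun _ => x) 0
    rw [← D.opAt_eq (fun _ => x) 0, h2, D.toOp_zero, order_opL] at h1
    omega
  obtain ⟨M, hM, hle⟩ := Ideal.exists_le_maximal _ htop
  have hmax := Ideal.comap_isMaximal_of_surjective D.evalGen D.evalGen_surjective (K := M)
  obtain ⟨P, hP⟩ := isMaximal_iff_eq_vanishingIdeal_singleton.1 hmax
  have hmem : ∀ p, D.evalGen p ∈ M → MvPolynomial.eval P p = 0 := by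
    intro p hp
    have h1 : p ∈ Ideal.comap D.evalGen M := hp
    rw [hP, mem_vanishingIdeal_iff] at h1
    rw [← aeval_eq_eval_apply]
    exact h1 P rfl
  refine ⟨P, mem_zeroLocus_iff.2 fun p hp => ?_, ?_⟩
  · rw [aeval_eq_eval_apply]
    refine hmem p ?_
    rw [D.mem_relations.1 hp]
    exact M.zero_mem
  · have h1 := hmem (X 0 - MvPolynomial.C x) (by
      rw [map_sub, evalGen_X, ← MvPolynomial.algebraMap_eq, AlgHom.commutes]
      exact hle (Ideal.subset_span rfl))
    rw [map_sub, eval_X, eval_C] at h1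
    exact sub_eq_zero.1 h1

/-- A prime ideal of relations that contains the first two curve polynomials contains all the
relations. -/
theorem relations_le_of_isPrime {Q : Ideal (MvPolynomial (Fin 3) ℂ)} [hQ : Q.IsPrime]
    (hle : Q ≤ D.relations) (hmem : ∀ k, k ≠ 0 → substPair ℂ 0 k (D.curvePoly 0 k) ∈ Q) :
    D.relations ≤ Q := by
  let f : Polynomial ℂ →+* MvPolynomial (Fin 3) ℂ := (Polynomial.aeval (X 0)).toRingHom
  let g := (Ideal.Quotient.mk Q).comp f
  have hsub : ∀ k F, substPair ℂ 0 k F = Polynomial.eval₂ f (X k) F := fun k F => by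
    rw [← aeval_substPair (fun i => (X i : MvPolynomial (Fin 3) ℂ)), MvPolynomial.aeval_X_left]
    rfl
  have hint : ∀ r, g.IsIntegralElem (Ideal.Quotient.mk Q r) := by
    intro r
    induction r using MvPolynomial.induction_on with
    | C c =>
      have : g (Polynomial.C c) = Ideal.Quotient.mk Q (MvPolynomial.C c) := by
        simp [g, f, MvPolynomial.algebraMap_eq]
      rw [← this]
      exact g.isIntegralElem_map
    | add p q hp hq => rw [map_add]; exact hp.add _ hq
    | mul_X p k hp =>
      rw [map_mul]
      refine hp.mul _ ?_
      by_cases hk : k = 0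
      · have : g Polynomial.X = Ideal.Quotient.mk Q (X k) := by simp [g, f, hk]
        rw [← this]
        exact g.isIntegralElem_map
      · refine ⟨D.curvePoly 0 k, D.monic_curvePoly 0 k, ?_⟩
        rw [← Polynomial.hom_eval₂, ← hsub, Ideal.Quotient.eq_zero_iff_mem]
        exact hmem k hk
  intro r hr
  by_contra hrQ
  obtain ⟨p, hp, hpr⟩ := hint r
  rw [← Polynomial.hom_eval₂, Ideal.Quotient.eq_zero_iff_mem] at hpr
  have hcomap : (Q.comap f).IsPrime := Ideal.IsPrime.comap f
  -- Incomparability in an integral extension of ℂ[λ]: a strictly larger ideal of relations would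
  -- contain a polynomial in λ outside Q. But L is transcendental, so that polynomial is zero.
  obtain ⟨i, hi, hi'⟩ := Ideal.exists_coeff_mem_comap_sdiff_comap_of_root_mem_sdiff hle ⟨hr, hrQ⟩
    (hp.map _).ne_zero hpr
  refine hi' ?_
  have h1 : Polynomial.aeval (D.a 0) (p.coeff i) = 0 := by
    rw [← evalGen_aeval_X]
    exact hi
  have h2 : p.coeff i = 0 := by_contra fun h => D.aeval_zero_ne_zero h h1
  rw [h2]
  exact Ideal.zero_mem _

/-! #### Singular points -/

/-- The polynomial of the pair (L, A_k) involves only λ and its own variable, so its linear equation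
expresses v_k through v₀ when the derivative in that variable is nonzero. -/
theorem finrank_tangentSpace_le_one {P : Fin 3 → ℂ}
    (h : ∀ k, k ≠ 0 → MvPolynomial.eval P (substPair ℂ 0 k (D.curvePoly 0 k).derivative) ≠ 0) :
    Module.finrank ℂ (tangentSpace D.relations P) ≤ 1 := by
  let e : Fin 3 → Fin 3 → ℂ := fun k l =>
    MvPolynomial.eval P (pderiv l (substPair ℂ 0 k (D.curvePoly 0 k)))
  have hoff : ∀ k l, l ≠ 0 → l ≠ k → e k l = 0 := fun k l hl hlk => by
    simp only [e]
    rw [pderiv_substPair hl, if_neg hlk, map_zero]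
  have hdiag : ∀ k, k ≠ 0 → e k k ≠ 0 := fun k hk => by
    simp only [e]
    rw [pderiv_substPair hk, if_pos rfl]
    exact h k hk
  have hle : tangentSpace D.relations P ≤ Submodule.span ℂ {fun k => if k = 0 then 1 else
      - e k 0 / e k k} := by
    intro v hv
    refine Submodule.mem_span_singleton.2 ⟨v 0, funext fun k => ?_⟩
    rw [Pi.smul_apply, smul_eq_mul]
    split_ifs with hk
    · rw [hk, mul_one]
    · have h1 : ∑ l, v l * e k l = 0 := hv _ (D.substPair_curvePoly_mem 0 k)
      rw [Finset.sum_eq_add 0 k (Ne.symm hk) (fun l _ hl => by rw [hoff k l hl.1 hl.2, mul_zero])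
        (by simp) (by simp)] at h1
      have h2 := hdiag k hk
      field_simp
      linear_combination -h1
  exact (Submodule.finrank_mono hle).trans (finrank_span_le_card _ |>.trans (by simp))

end SpectralData

end Bsq

/-! ### The first subresultants along the spectral curve -/

namespace DiffOp

/-- The first subresultants commute with specializations that preserve the orders. -/
theorem map_subres {R T : Type*} [CommRing R] [Differential R] [CommRing T] [Differential T]
    {φ : R →+* T} (hφ : ∀ a, φ a′ = (φ a)′) {P Q : DiffOp R}
    (hP : (P.mapCoeff φ).order = P.order) (hQ : (Q.mapCoeff φ).order = Q.order) (j : Fin 2) :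
    φ (subres P Q j) = subres (P.mapCoeff φ) (Q.mapCoeff φ) j := by
  have hp : (partial' : DiffOp R).mapCoeff φ = partial' := Polynomial.map_X φ
  have hpow : ∀ n, ((partial' : DiffOp R) ^ n).mapCoeff φ = partial' ^ n := fun n => by
    induction n with
    | zero => rw [pow_zero, pow_zero]; exact Polynomial.map_one φ
    | succ n ih => rw [pow_succ, pow_succ, mapCoeff_mul hφ, ih, hp]
  simp only [subres, extendedSystem]
  generalize (P.mapCoeff φ).order = n at hP
  generalize (Q.mapCoeff φ).order = m at hQ
  subst hP hQ
  rw [RingHom.map_det]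
  congr 1
  ext r c
  rw [RingHom.mapMatrix_apply, Matrix.map_apply, Matrix.of_apply, Matrix.of_apply,
    ← coeff_mapCoeff]
  split_ifs <;> rw [mapCoeff_mul hφ, hpow]

end DiffOp

namespace Bsq

open DiffOp MvPolynomial

/-- Evaluation at constants commutes with the derivation. -/
theorem deriv_eval {R : Type*} [CommRing R] [Differential R] {y : Fin 3 → R}
    (hy : ∀ k, (y k)′ = 0) (p : MvPolynomial (Fin 3) R) :
    MvPolynomial.eval y p′ = (MvPolynomial.eval y p)′ := by
  induction p using MvPolynomial.induction_on with
  | C a => rw [deriv_mvPolynomial_C, eval_C, eval_C]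
  | add p q hp hq => rw [map_add, map_add, map_add, map_add, hp, hq]
  | mul_X p k hp =>
    rw [Derivation.leibniz, deriv_mvPolynomial_X, smul_zero, zero_add, map_mul, eval_X,
      Derivation.leibniz, hy, smul_zero, zero_add, smul_eq_mul, smul_eq_mul, map_mul, eval_X, hp]

theorem evalAt_map {K : Type*} [Field K] [Algebra ℂ K] (P : Fin 3 → ℂ)
    (p : MvPolynomial (Fin 3) ℂ) :
    evalAt P (MvPolynomial.map (algebraMap ℂ K) p) = algebraMap ℂ K (MvPolynomial.eval P p) := by
  rw [evalAt, MvPolynomial.eval_map]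
  exact (MvPolynomial.eval₂_comp_left (algebraMap ℂ K) (RingHom.id ℂ) P p).symm

namespace SpectralData

variable {K S : Type*} [Field K] [Differential K] [CharZero K] [Algebra ℂ K] [CommRing S]
  [Algebra ℂ S] (D : SpectralData K S)

/-- The values of the first subresultants at a point. -/
theorem evalAt_subres (P : Fin 3 → ℂ) (i j : Fin 3) (l : Fin 2) :
    evalAt P (subres (pencil (D.toOp (D.a i)) i) (pencil (D.toOp (D.a j)) j) l) =
      subres (D.opAt P i) (D.opAt P j) l := by
  have hmap : ∀ k, (pencil (D.toOp (D.a k)) k).mapCoeff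
      (MvPolynomial.eval fun k => algebraMap ℂ K (P k)) = D.opAt P k := fun k => by
    rw [pencil, mapCoeff_sub, mapCoeff_const, mapCoeff_mapCoeff, eval_X, opAt,
      show (MvPolynomial.eval fun k => algebraMap ℂ K (P k)).comp MvPolynomial.C =
        RingHom.id K from RingHom.ext fun x => eval_C x, mapCoeff_id]
  have hord : ∀ k, ((pencil (D.toOp (D.a k)) k).mapCoeff
      (MvPolynomial.eval fun k => algebraMap ℂ K (P k))).order =
        (pencil (D.toOp (D.a k)) k).order := fun k => by
    rw [hmap, D.order_opAt, D.order_pencil]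
  have h := map_subres (deriv_eval fun k => D.deriv_algebraMap (P k)) (hord i) (hord j) l
  rwa [hmap, hmap] at h

/-- A polynomial over `K` that does not vanish on the curve has finitely many zeros on it. -/
theorem finite_zeros_evalAt {Φ : MvPolynomial (Fin 3) K} {P₀ : Fin 3 → ℂ} (hP₀ : P₀ ∈ D.points)
    (h : evalAt P₀ Φ ≠ 0) : {P ∈ D.points | evalAt P Φ = 0}.Finite := by
  -- A ℂ-linear functional on K that detects the value at P₀ turns Φ into a complex polynomial,
  -- whose zeros on the curve contain those of Φ.
  obtain ⟨f, hf⟩ : ∃ f : Module.Dual ℂ K, f (evalAt P₀ Φ) ≠ 0 := by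
    by_contra! h'
    exact h ((Module.forall_dual_apply_eq_zero_iff ℂ _).1 h')
  let p : MvPolynomial (Fin 3) ℂ := ∑ s ∈ Φ.support, monomial s (f (Φ.coeff s))
  have hp : ∀ P : Fin 3 → ℂ, MvPolynomial.eval P p = f (evalAt P Φ) := fun P => by
    rw [evalAt, MvPolynomial.eval_eq' _ Φ, map_sum, map_sum]
    refine Finset.sum_congr rfl fun s _ => ?_
    rw [eval_monomial, Finsupp.prod_fintype _ _ (fun i => pow_zero _)]
    simp only [← map_pow, ← map_prod]
    rw [mul_comm (Φ.coeff s), ← Algebra.smul_def, map_smul, smul_eq_mul, mul_comm]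
  refine (D.finite_zeros (p := p) fun hp' => hf ?_).subset fun P hP => ⟨hP.1, ?_⟩
  · rw [← hp]
    exact D.eval_eq_zero hp' hP₀
  · rw [hp, hP.2, map_zero]

/-- The curve polynomial has a multiple root at every point, and a polynomial vanishing at all
points is a relation. -/
theorem evalPair_derivative_eq_zero {i j : Fin 3}
    (h : ∀ P ∈ D.points, subres (D.opAt P i) (D.opAt P j) 1 = 0) :
    D.evalPair i j (D.curvePoly i j).derivative = 0 := by
  rw [← D.evalGen_substPair]
  refine D.mem_relations_of_forall fun P hP => ?_
  rw [eval_substPair, ← Polynomial.derivative_map]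
  exact D.eval_derivative_curvePolyAt i j hP (h P hP)

theorem exists_subres_ne_zero {k : Fin 3} (hk : k ≠ 0) :
    ∃ P ∈ D.points, subres (D.opAt P 0) (D.opAt P k) 1 ≠ 0 := by
  by_contra! h
  exact D.evalPair_derivative_curvePoly_ne_zero hk (D.evalPair_derivative_eq_zero h)

/-- An algebraic element of a domain over ℂ is a scalar, of order zero, whereas the generators have
positive order. -/
theorem aeval_ne_zero (k : Fin 3) {p : Polynomial ℂ} (hp : p ≠ 0) :
    Polynomial.aeval (D.a k) p ≠ 0 := by
  intro h
  have := D.isDomain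
  have hint : IsIntegral ℂ (D.a k) := IsAlgebraic.isIntegral ⟨p, hp, h⟩
  obtain ⟨c, hc⟩ := minpoly.mem_range_of_degree_eq_one ℂ (D.a k)
    (IsAlgClosed.degree_eq_one_of_irreducible ℂ (minpoly.irreducible hint))
  have h1 := D.order_pos k
  have h2 : (const (algebraMap ℂ K c)).order = 0 := Polynomial.natDegree_C _
  rw [← hc, D.toOp_algebraMap, h2] at h1
  omega

/-- If the first subresultant of `A₁ - μ` and `A₂ - γ` vanishes along the curve, then the curve
polynomial has a multiple factor that vanishes on the curve. -/
theorem exists_sq_mul_eq (h : ∀ P ∈ D.points, subres (D.opAt P 1) (D.opAt P 2) 1 = 0) :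
    ∃ m e : Polynomial (Polynomial ℂ), D.curvePoly 1 2 = m * m * e ∧ D.evalPair 1 2 m = 0 := by
  have := D.isDomain
  let _ : Algebra (Polynomial ℂ) S := (Polynomial.aeval (D.a 1)).toRingHom.toAlgebra
  have hinj : Function.Injective (algebraMap (Polynomial ℂ) S) :=
    (injective_iff_map_eq_zero _).2 fun p hp => by_contra fun h0 => D.aeval_ne_zero 1 h0 hp
  have : FaithfulSMul (Polynomial ℂ) S := (faithfulSMul_iff_algebraMap_injective _ _).2 hinj
  have : Module.IsTorsionFree (Polynomial ℂ) S := inferInstance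
  have haeval : ∀ F, Polynomial.aeval (D.a 2) F = D.evalPair 1 2 F := fun F => rfl
  have hint : IsIntegral (Polynomial ℂ) (D.a 2) :=
    ⟨D.curvePoly 1 2, D.monic_curvePoly 1 2, D.evalPair_curvePoly 1 2⟩
  set m := minpoly (Polynomial ℂ) (D.a 2) with hm
  have hm0 : Polynomial.aeval (D.a 2) m = 0 := minpoly.aeval _ _
  have hpos : 0 < m.natDegree := minpoly.natDegree_pos hint
  have hm' : Polynomial.aeval (D.a 2) m.derivative ≠ 0 := by
    intro h0
    have h1 : m ∣ m.derivative := minpoly.isIntegrallyClosed_dvd hint h0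
    have h2 : m.derivative ≠ 0 := fun h3 => by
      have := Polynomial.derivative_eq_zero.1 h3
      omega
    have h4 := Polynomial.natDegree_le_of_dvd h1 h2
    have h5 := Polynomial.natDegree_derivative_lt (p := m) (by omega)
    omega
  obtain ⟨q, hq⟩ := minpoly.isIntegrallyClosed_dvd hint
    (show Polynomial.aeval (D.a 2) (D.curvePoly 1 2) = 0 from D.evalPair_curvePoly 1 2)
  -- Writing the curve polynomial as m q with m minimal over the integrally closed ring ℂ[A₁], its
  -- derivative at A₂ is m′(A₂)q(A₂). As m′(A₂) is nonzero, m also divides q.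
  have hd := D.evalPair_derivative_eq_zero h
  rw [← haeval, hq, Polynomial.derivative_mul, map_add, map_mul, map_mul, ← hm, hm0, zero_mul,
    add_zero] at hd
  obtain ⟨e, he⟩ := minpoly.isIntegrallyClosed_dvd hint ((mul_eq_zero.1 hd).resolve_left hm')
  exact ⟨m, e, by rw [hq, he, mul_assoc], hm0⟩

/-- The repeated factor m would have to be a unit, yet it vanishes at every point, and points exist.
-/
theorem exists_subres_one_two_ne_zero_of_squarefree
    (hsq : Squarefree (dRes (pencil (D.toOp (D.a 1)) 1) (pencil (D.toOp (D.a 2)) 2))) :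
    ∃ P ∈ D.points, subres (D.opAt P 1) (D.opAt P 2) 1 ≠ 0 := by
  by_contra! h
  obtain ⟨m, e, hme, hm⟩ := D.exists_sq_mul_eq h
  obtain ⟨c, -, hc⟩ := D.dRes_pencil 1 2
  have hu := hsq (MvPolynomial.map (algebraMap ℂ K) (substPair ℂ 1 2 m))
    ⟨MvPolynomial.map (algebraMap ℂ K) (MvPolynomial.C c * substPair ℂ 1 2 e), by
      rw [hc, hme]
      simp only [map_mul]
      ring⟩
  obtain ⟨P, hP, -⟩ := D.exists_point 0
  have h1 := hu.map (MvPolynomial.eval fun k => algebraMap ℂ K (P k))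
  have h2 : evalAt P (MvPolynomial.map (algebraMap ℂ K) (substPair ℂ 1 2 m)) = 0 := by
    rw [evalAt_map, D.eval_eq_zero (D.mem_relations.2 ((D.evalGen_substPair 1 2 m).trans hm)) hP,
      map_zero]
  exact h1.ne_zero h2

/-- A monic factor of `c p`, with `c` a nonzero constant, is a factor of `p`. -/
theorem dvd_of_dvd_C_mul {A : Type*} [CommRing A] [IsDomain A] {q p : Polynomial A} (hq : q.Monic)
    {c : A} (hc : c ≠ 0) (h : q ∣ Polynomial.C c * p) : q ∣ p := by
  rw [← Polynomial.modByMonic_eq_zero_iff_dvd hq] at h ⊢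
  rw [← Polynomial.smul_eq_C_mul, Polynomial.smul_modByMonic] at h
  exact (smul_eq_zero.1 h).resolve_left hc

/-- If the third resultant is h² times a factor e with h a relation, it is redundant near the curve:
f₁ and f₂ alone generate the relations after localizing at an η equal to 1 in S. Then A₂ would be a
simple root of its cubic in the strong sense that the derivative there is invertible, which is
excluded. -/
theorem exists_subres_one_two_ne_zero_of_relations_le
    (hle : D.relations ≤ Ideal.span {substPair ℂ 0 1 (D.curvePoly 0 1),
      substPair ℂ 0 2 (D.curvePoly 0 2), substPair ℂ 1 2 (D.curvePoly 1 2)}) :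
    ∃ P ∈ D.points, subres (D.opAt P 1) (D.opAt P 2) 1 ≠ 0 := by
  have := D.isDomain
  by_contra! hall
  obtain ⟨m, e, hme, hm⟩ := D.exists_sq_mul_eq hall
  set f₁ := substPair ℂ 0 1 (D.curvePoly 0 1) with hf₁
  set f₂ := substPair ℂ 0 2 (D.curvePoly 0 2) with hf₂
  set h := substPair ℂ 1 2 m with hh
  have hmem : ∀ {p}, p ∈ D.relations → ∃ x y z,
      p = x * f₁ + y * f₂ + z * (h * h * substPair ℂ 1 2 e) := fun {p} hp => by
    obtain ⟨x, w, hw, hx⟩ := Ideal.mem_span_insert.1 (hle hp)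
    obtain ⟨y, z, hyz⟩ := Ideal.mem_span_pair.1 hw
    refine ⟨x, y, z, ?_⟩
    rw [hx, ← hyz, hme, map_mul, map_mul, add_assoc]
  have hhJ : D.evalGen h = 0 := (D.evalGen_substPair 1 2 m).trans hm
  obtain ⟨α, β, κ, hαβκ⟩ := hmem (D.mem_relations.2 hhJ)
  -- From h = αf₁ + βf₂ + κh²e one gets ηh ∈ (f₁, f₂), so η times every relation lies in (f₁, f₂).
  set η := 1 - κ * h * substPair ℂ 1 2 e with hη
  have hη1 : D.evalGen η = 1 := by rw [hη, map_sub, map_mul, map_mul, hhJ]; simp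
  obtain ⟨p, q, r, hr, hsq⟩ := D.sq_eq
  -- The relation from A₁² is linear in γ, with coefficient r(λ) ≠ 0.
  let g : MvPolynomial (Fin 3) ℂ := Polynomial.aeval (X 0) r * X 2 -
    (X 1 * X 1 - Polynomial.aeval (X 0) p - Polynomial.aeval (X 0) q * X 1)
  obtain ⟨x, y, z, hxyz⟩ := hmem (p := g) (D.mem_relations.2 (by
    simp only [g, map_sub, map_mul, evalGen_aeval_X, evalGen_X, hsq]
    ring))
  have hηg : η * g = (η * x + z * h * substPair ℂ 1 2 e * α) * f₁ +
      (η * y + z * h * substPair ℂ 1 2 e * β) * f₂ := by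
    rw [hxyz, hη]
    linear_combination (z * h * substPair ℂ 1 2 e) * hαβκ
  -- Only λ and μ are specialized to S, and γ stays free. Then f₁ vanishes, f₂ becomes the cubic (X
  -- - a₂)G, and g becomes r(a₀)(X - a₂); cancelling X - a₂ leaves G dividing r(a₀)ψ(η).
  let y' : Fin 3 → Polynomial S := ![Polynomial.C (D.a 0), Polynomial.C (D.a 1), Polynomial.X]
  let ψ : MvPolynomial (Fin 3) ℂ →ₐ[ℂ] Polynomial S := MvPolynomial.aeval y'
  have hev : ∀ w, (ψ w).eval (D.a 2) = D.evalGen w := by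
    have h1 : ((Polynomial.aeval (R := S) (D.a 2)).restrictScalars ℂ).comp ψ = D.evalGen :=
      MvPolynomial.algHom_ext fun k => by
        fin_cases k <;> simp [ψ, y', evalGen]
    intro w
    rw [← h1]
    simp [Polynomial.coe_aeval_eq_eval]
  have hψp : ∀ p : Polynomial ℂ, ψ (Polynomial.aeval (X 0) p) =
      Polynomial.C (Polynomial.aeval (D.a 0) p) := fun p => by
    rw [← Polynomial.aeval_algHom_apply, MvPolynomial.aeval_X]
    exact Polynomial.aeval_algHom_apply (Polynomial.CAlgHom (R := ℂ) (A := S)) (D.a 0) p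
  have hψ₁ : ψ f₁ = 0 := by
    rw [hf₁, aeval_substPair]
    have h2 := Polynomial.hom_eval₂ (D.curvePoly 0 1) (Polynomial.aeval (D.a 0)).toRingHom
      (Polynomial.C : S →+* Polynomial S) (D.a 1)
    rw [show Polynomial.eval₂ (Polynomial.aeval (D.a 0)).toRingHom (D.a 1) (D.curvePoly 0 1) = 0
      from D.evalPair_curvePoly 0 1, map_zero] at h2
    rw [h2]
    refine congrArg (fun f => Polynomial.eval₂ f _ _) (RingHom.ext fun c => ?_)
    exact Polynomial.aeval_algHom_apply (Polynomial.CAlgHom (R := ℂ) (A := S)) (D.a 0) c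
  have hψ₂ : ψ f₂ = (D.curvePoly 0 2).map (Polynomial.aeval (D.a 0)).toRingHom := by
    rw [hf₂, aeval_substPair, Polynomial.map]
    refine congrArg (fun f => Polynomial.eval₂ f _ _) (RingHom.ext fun c => ?_)
    exact Polynomial.aeval_algHom_apply (Polynomial.CAlgHom (R := ℂ) (A := S)) (D.a 0) c
  have hroot : (ψ f₂).IsRoot (D.a 2) := by
    rw [hψ₂, Polynomial.IsRoot, Polynomial.eval_map]
    exact D.evalPair_curvePoly 0 2
  obtain ⟨G, hG⟩ := Polynomial.dvd_iff_isRoot.2 hroot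
  have hGmonic : G.Monic := (Polynomial.monic_X_sub_C (D.a 2)).of_mul_monic_left
    (by rw [← hG, hψ₂]; exact (D.monic_curvePoly 0 2).map _)
  have hψg : ψ g = Polynomial.C (Polynomial.aeval (D.a 0) r) *
      (Polynomial.X - Polynomial.C (D.a 2)) := by
    have h1 : ψ (X 1) = Polynomial.C (D.a 1) := MvPolynomial.aeval_X _ _
    have h2 : ψ (X 2) = Polynomial.X := MvPolynomial.aeval_X _ _
    simp only [g, map_sub, map_mul, hψp, h1, h2]
    have h3 := congrArg (Polynomial.C : S →+* Polynomial S) hsq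
    simp only [map_add, map_mul] at h3
    linear_combination -h3
  have hdvd : G ∣ ψ η := by
    refine dvd_of_dvd_C_mul hGmonic (D.aeval_zero_ne_zero hr)
      ⟨ψ (η * y + z * h * substPair ℂ 1 2 e * β),
        mul_left_cancel₀ (Polynomial.X_sub_C_ne_zero (D.a 2)) ?_⟩
    have h1 := congrArg ψ hηg
    rw [map_mul, map_add, map_mul, map_mul, hψ₁, hψg, hG] at h1
    linear_combination h1
  obtain ⟨w, hw⟩ := hdvd
  have hunit : G.eval (D.a 2) * w.eval (D.a 2) = 1 := by
    rw [← Polynomial.eval_mul, ← hw, hev, hη1]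
  -- Since η is 1 in S, evaluation of G w = ψ(η) at a₂ makes G(a₂) a unit; differentiating (X - a₂)G
  -- shows that G(a₂) is the derivative of the cubic at a₂.
  refine D.evalPair_derivative_curvePoly_mul_ne_one (k := 2) (by decide) (w.eval (D.a 2)) ?_
  rw [← hunit]
  congr 1
  have h1 := congrArg (fun F => (Polynomial.derivative F).eval (D.a 2)) hG
  simp only [hψ₂, Polynomial.derivative_map, Polynomial.eval_map, Polynomial.derivative_mul,
    Polynomial.derivative_X_sub_C, Polynomial.eval_add, Polynomial.eval_mul, one_mul,
    Polynomial.eval_sub, Polynomial.eval_X, Polynomial.eval_C, sub_self, zero_mul, add_zero] at h1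
  exact h1

end SpectralData

end Bsq

/-! ### Greatest common right divisors and spectral factorizations -/

namespace DiffOp

/-- The product of a quadratic and a linear operator. -/
theorem quadratic_mul_linear {R : Type*} [CommRing R] [Differential R] (b c φ : R) :
    (partial' ^ 2 + const b * partial' + const c) * (partial' + const φ) =
      partial' ^ 3 + const (b + φ) * partial' ^ 2 + const (c + φ′ + φ′ + b * φ) * partial' +
        const (c * φ + b * φ′ + φ′′) := by
  have h1 := partial_mul_const φ
  have h2 : partial' ^ 2 * const φ =
      const φ * partial' ^ 2 + const φ′ * partial' + const φ′ * partial' + const φ′′ := by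
    rw [pow_two, mul_assoc, h1, mul_add, ← mul_assoc, h1, partial_mul_const, add_mul, mul_assoc]
    abel
  rw [mul_add, add_mul, add_mul, add_mul, add_mul, h2, mul_assoc, mul_assoc, h1]
  simp only [const_add, const_mul]
  noncomm_ring

end DiffOp

namespace Bsq

open DiffOp MvPolynomial

/-- The centralizer of `L = ∂³ + u ∂ + v` as a commutative `ℂ`-algebra. -/
theorem exists_spectralData.{w} {K : Type w} [Field K] [Differential K] [CharZero K] [Algebra ℂ K]
    (hK : ∀ a : K, a′ = 0 ↔ a ∈ Set.range (algebraMap ℂ K)) {u v : K} {A₁ A₂ : DiffOp K}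
    (h₁ : IsMinimalCommuting (opL u v) 1 A₁) (h₂ : IsMinimalCommuting (opL u v) 2 A₂) :
    ∃ (S : Type w) (_ : CommRing S) (_ : Algebra ℂ S) (D : SpectralData K S),
      D.u = u ∧ D.v = v ∧ D.toOp (D.a 1) = A₁ ∧ D.toOp (D.a 2) = A₂ := by
  have hmem : ∀ {B : DiffOp K}, B ∈ Subring.centralizer {opL u v} ↔
      B * opL u v = opL u v * B := fun {B} => by
    rw [Subring.mem_centralizer_iff]
    simp [eq_comm]
  let _ : CommRing (Subring.centralizer {opL u v}) :=
    { (inferInstance : Ring (Subring.centralizer {opL u v})) with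
      mul_comm := fun B C => Subtype.ext
        (centralizer_commute hK h₁ h₂ (hmem.1 B.2) (hmem.1 C.2)) }
  let f : ℂ →+* Subring.centralizer {opL u v} :=
    (constHom.comp (algebraMap ℂ K)).codRestrict _ fun c =>
      hmem.2 (const_algebraMap_mul_comm hK c _).symm
  let _ : Algebra ℂ (Subring.centralizer {opL u v}) := f.toAlgebra
  let toOp : Subring.centralizer {opL u v} →+* DiffOp K := Subring.subtype _
  have htoOp : ∀ c : ℂ, toOp (algebraMap ℂ _ c) = const (algebraMap ℂ K c) := fun c => rfl
  have hpoly := map_aeval_eq_polyAt hK htoOp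
  let a : Fin 3 → Subring.centralizer {opL u v} :=
    ![⟨opL u v, hmem.2 rfl⟩, ⟨A₁, hmem.2 h₁.1⟩, ⟨A₂, hmem.2 h₂.1⟩]
  have hsum : ∀ p q r : Polynomial ℂ, toOp (Polynomial.aeval (a 0) p +
      Polynomial.aeval (a 0) q * a 1 + Polynomial.aeval (a 0) r * a 2) =
        polyAt hK (opL u v) p + polyAt hK (opL u v) q * A₁ + polyAt hK (opL u v) r * A₂ :=
    fun p q r => by
      rw [map_add, map_add, map_mul, map_mul, hpoly, hpoly, hpoly]
      rfl
  refine ⟨Subring.centralizer {opL u v}, inferInstance, inferInstance,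
    { constants := hK
      toOp := toOp
      toOp_injective := Subtype.val_injective
      toOp_algebraMap := htoOp
      a := a
      u := u
      v := v
      toOp_zero := rfl
      exists_toOp_eq := fun B hB => ⟨⟨B, hmem.2 hB⟩, rfl⟩
      generates := fun s => ?_
      order_one := h₁.2.1
      order_two := h₂.2.1
      sq_eq := ?_ }, rfl, rfl, rfl, rfl⟩
  · obtain ⟨p, q, r, h⟩ := exists_eq_polyAt_add hK h₁ h₂ (hmem.1 s.2)
    refine ⟨p, q, r, Subtype.val_injective (h.trans (hsum p q r).symm)⟩
  · obtain ⟨p, q, r, hr, h⟩ := exists_sq_eq hK h₁ h₂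
    refine ⟨p, q, r, hr, Subtype.val_injective (h.trans (hsum p q r).symm)⟩

namespace SpectralData

variable {K S : Type*} [Field K] [Differential K] [CharZero K] [Algebra ℂ K] [CommRing S]
  [Algebra ℂ S] (D : SpectralData K S)

theorem generatedRing_eq :
    generatedRing (D.toOp (D.a 0)) (D.toOp (D.a 1)) (D.toOp (D.a 2)) =
      Subring.centralizer {D.toOp (D.a 0)} := by
  refine le_antisymm ?_ fun B hB => ?_
  · refine Subring.closure_le.2 ?_
    have hmem : ∀ s, D.toOp s ∈ Subring.centralizer {D.toOp (D.a 0)} := fun s => by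
      rw [Subring.mem_centralizer_iff]
      rintro _ rfl
      exact D.commute _ _
    rintro _ (⟨c, rfl⟩ | rfl | rfl | rfl)
    · rw [SetLike.mem_coe]
      dsimp only
      rw [← D.toOp_algebraMap]
      exact hmem _
    all_goals exact hmem _
  · have hc : B * opL D.u D.v = opL D.u D.v * B := by
      rw [← D.toOp_zero]
      exact ((Subring.mem_centralizer_iff.1 hB) _ rfl).symm
    obtain ⟨s, rfl⟩ := D.exists_toOp_eq B hc
    have hC : ∀ c : ℂ, D.toOp (algebraMap ℂ S c) ∈
        generatedRing (D.toOp (D.a 0)) (D.toOp (D.a 1)) (D.toOp (D.a 2)) := fun c => by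
      rw [D.toOp_algebraMap]
      exact Subring.subset_closure (Or.inl ⟨c, rfl⟩)
    have ha : ∀ k, D.toOp (D.a k) ∈
        generatedRing (D.toOp (D.a 0)) (D.toOp (D.a 1)) (D.toOp (D.a 2)) := fun k =>
      Subring.subset_closure (Or.inr (by fin_cases k <;> simp))
    obtain ⟨p, rfl⟩ := D.evalGen_surjective s
    induction p using MvPolynomial.induction_on with
    | C c =>
      rw [← MvPolynomial.algebraMap_eq, AlgHom.commutes]
      exact hC c
    | add p q hp hq =>
      rw [map_add, map_add]
      exact add_mem (hp (by rw [Subring.mem_centralizer_iff]; rintro _ rfl; exact D.commute _ _)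
        (D.commute_opL _)) (hq (by
          rw [Subring.mem_centralizer_iff]; rintro _ rfl; exact D.commute _ _) (D.commute_opL _))
    | mul_X p k hp =>
      rw [map_mul, map_mul, evalGen_X]
      exact mul_mem (hp (by rw [Subring.mem_centralizer_iff]; rintro _ rfl; exact D.commute _ _)
        (D.commute_opL _)) (ha k)

/-! #### The ideal of the differential resultants -/

/-- The ideal generated by the differential resultants. -/
abbrev resIdeal : Ideal (MvPolynomial (Fin 3) ℂ) :=
  bcIdeal (D.toOp (D.a 0)) (D.toOp (D.a 1)) (D.toOp (D.a 2))

/-- The zero set of the differential resultants. -/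
abbrev resCurve : Set (Fin 3 → ℂ) :=
  curve (D.toOp (D.a 0)) (D.toOp (D.a 1)) (D.toOp (D.a 2))

/-- The index of the first variable of a pair of pencils. -/
def fstIndex : Fin 3 → Fin 3 := ![0, 0, 1]

/-- The index of the second variable of a pair of pencils. -/
def sndIndex : Fin 3 → Fin 3 := ![1, 2, 2]

theorem pencilPair_eq (i : Fin 3) :
    pencilPair (D.toOp (D.a 0)) (D.toOp (D.a 1)) (D.toOp (D.a 2)) i =
      (pencil (D.toOp (D.a (fstIndex i))) (fstIndex i),
        pencil (D.toOp (D.a (sndIndex i))) (sndIndex i)) := by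
  fin_cases i <;> rfl

/-- The relation between two generators given by their curve polynomial. -/
def pairRelation (i : Fin 3) : MvPolynomial (Fin 3) ℂ :=
  substPair ℂ (fstIndex i) (sndIndex i) (D.curvePoly (fstIndex i) (sndIndex i))

theorem bcRes_eq (i : Fin 3) : ∃ c : ℂ, c ≠ 0 ∧
    bcRes (D.toOp (D.a 0)) (D.toOp (D.a 1)) (D.toOp (D.a 2)) i =
      MvPolynomial.map (algebraMap ℂ K) (MvPolynomial.C c * D.pairRelation i) := by
  rw [bcRes, pencilPair_eq]
  exact D.dRes_pencil _ _

theorem pairRelation_mem (i : Fin 3) : D.pairRelation i ∈ D.resIdeal := by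
  obtain ⟨c, hc, h⟩ := D.bcRes_eq i
  have h1 : MvPolynomial.C c * D.pairRelation i ∈ D.resIdeal := Ideal.subset_span ⟨i, h.symm⟩
  have h2 := Ideal.mul_mem_left _ (MvPolynomial.C c⁻¹) h1
  rwa [← mul_assoc, ← map_mul, inv_mul_cancel₀ hc, map_one, one_mul] at h2

theorem resIdeal_eq : D.resIdeal = Ideal.span (Set.range D.pairRelation) := by
  refine le_antisymm (Ideal.span_le.2 ?_) (Ideal.span_le.2 ?_)
  · rintro p ⟨i, hp⟩
    obtain ⟨c, -, h⟩ := D.bcRes_eq i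
    rw [MvPolynomial.map_injective _ (algebraMap ℂ K).injective (hp.trans h)]
    exact Ideal.mul_mem_left _ _ (Ideal.subset_span ⟨i, rfl⟩)
  · rintro _ ⟨i, rfl⟩
    exact D.pairRelation_mem i

theorem resIdeal_le_relations : D.resIdeal ≤ D.relations := by
  rw [resIdeal_eq, Ideal.span_le]
  rintro _ ⟨i, rfl⟩
  exact D.substPair_curvePoly_mem _ _

theorem points_subset_resCurve : D.points ⊆ D.resCurve :=
  zeroLocus_anti_mono D.resIdeal_le_relations

variable {D}

/-- The radical is a prime inside the relations that contains the cubics of A₁ and A₂, so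
incomparability applies. When the ideal itself is prime, it equals the ideal of relations. -/
theorem relations_le_radical (h : D.resIdeal.radical.IsPrime) :
    D.relations ≤ D.resIdeal.radical := by
  have := D.isPrime_relations
  refine D.relations_le_of_isPrime (this.radical_le_iff.2 D.resIdeal_le_relations) fun k hk => ?_
  refine Ideal.le_radical ?_
  fin_cases k
  · exact absurd rfl hk
  · exact D.pairRelation_mem 0
  · exact D.pairRelation_mem 1

theorem resCurve_eq_points (h : D.resIdeal.radical.IsPrime) : D.resCurve = D.points := by
  refine Set.Subset.antisymm (fun P hP => ?_) D.points_subset_resCurve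
  refine mem_zeroLocus_iff.2 fun p hp => ?_
  obtain ⟨n, hn⟩ := relations_le_radical h hp
  have h1 := mem_zeroLocus_iff.1 hP _ hn
  rw [map_pow] at h1
  exact eq_zero_of_pow_eq_zero h1

variable (D)

/-! #### The right factors -/

theorem evalAt_phiPoly (P : Fin 3 → ℂ) (i : Fin 3) (l : Fin 2) :
    evalAt P (phiPoly (D.toOp (D.a 0)) (D.toOp (D.a 1)) (D.toOp (D.a 2)) i l) =
      subres (D.opAt P (fstIndex i)) (D.opAt P (sndIndex i)) l := by
  rw [phiPoly, pencilPair_eq]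
  exact D.evalAt_subres _ _ _ _

/-- The first subresultant is a left combination of two of the operators at P; dividing on the left
by its leading coefficient makes it monic. -/
theorem partial_add_phi_mem {P : Fin 3 → ℂ} {i : Fin 3}
    (h : evalAt P (phiPoly (D.toOp (D.a 0)) (D.toOp (D.a 1)) (D.toOp (D.a 2)) i 1) ≠ 0) :
    partial' + const (phi (D.toOp (D.a 0)) (D.toOp (D.a 1)) (D.toOp (D.a 2)) i P) ∈
      D.leftIdeal P := by
  have h1 := D.order_one
  have h2 := D.order_two
  have h0 : (D.toOp (D.a 0)).order = 3 := by rw [D.toOp_zero]; exact order_opL _ _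
  have hord : 3 ≤ (D.opAt P (fstIndex i)).order + (D.opAt P (sndIndex i)).order := by
    rw [D.order_opAt, D.order_opAt]
    fin_cases i
    · change 3 ≤ (D.toOp (D.a 0)).order + (D.toOp (D.a 1)).order; omega
    · change 3 ≤ (D.toOp (D.a 0)).order + (D.toOp (D.a 2)).order; omega
    · change 3 ≤ (D.toOp (D.a 1)).order + (D.toOp (D.a 2)).order; omega
  obtain ⟨U, V, hUV⟩ := exists_subres_eq (P := D.opAt P (fstIndex i))
    (Q := D.opAt P (sndIndex i)) (by rw [D.order_opAt]; exact D.order_pos _) hord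
  rw [phi]
  rw [D.evalAt_phiPoly] at h
  rw [D.evalAt_phiPoly, D.evalAt_phiPoly]
  have h3 : const (subres (D.opAt P (fstIndex i)) (D.opAt P (sndIndex i)) 1) * partial' +
      const (subres (D.opAt P (fstIndex i)) (D.opAt P (sndIndex i)) 0) ∈ D.leftIdeal P := by
    rw [hUV]
    exact (D.leftIdeal P).add_mem ((D.leftIdeal P).mul_mem_left _ (D.opAt_mem P _))
      ((D.leftIdeal P).mul_mem_left _ (D.opAt_mem P _))
  have h4 := (D.leftIdeal P).mul_mem_left
    (const (subres (D.opAt P (fstIndex i)) (D.opAt P (sndIndex i)) 1)⁻¹) h3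
  rwa [mul_add, ← mul_assoc, ← const_mul, ← const_mul, inv_mul_cancel₀ h, const_one, one_mul,
    mul_comm, ← div_eq_mul_inv] at h4

/-- A monic first-order element of a proper left ideal generates it, since remainders have order
zero and must vanish. A generator of the left ideal is a greatest common right divisor. -/
theorem isGCRD_of_mem {P : Fin 3 → ℂ} (hP : P ∈ D.points) {φ : K}
    (hφ : partial' + const φ ∈ D.leftIdeal P) :
    IsGCRD (partial' + const φ) {D.toOp (D.a 0) - const (algebraMap ℂ K (P 0)),
      D.toOp (D.a 1) - const (algebraMap ℂ K (P 1)),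
      D.toOp (D.a 2) - const (algebraMap ℂ K (P 2))} := by
  refine ⟨Polynomial.monic_X_add_C φ, ?_, fun H hH => ?_⟩
  · rintro _ (rfl | rfl | rfl)
    · exact D.exists_eq_mul_of_mem hP hφ (D.opAt_mem P 0)
    · exact D.exists_eq_mul_of_mem hP hφ (D.opAt_mem P 1)
    · exact D.exists_eq_mul_of_mem hP hφ (D.opAt_mem P 2)
  · have hle : D.leftIdeal P ≤ Ideal.span {H} := by
      refine Ideal.span_le.2 ?_
      rintro _ ⟨k, rfl⟩
      obtain ⟨Q, hQ⟩ := hH (D.opAt P k) (by fin_cases k <;> simp [opAt])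
      exact Ideal.mem_span_singleton'.2 ⟨Q, hQ.symm⟩
    obtain ⟨Q, hQ⟩ := Ideal.mem_span_singleton'.1 (hle hφ)
    exact ⟨Q, hQ.symm⟩

/-- The spectral factorization of `L - λ` at a point of the curve. -/
theorem eq_quadratic_mul_linear {P : Fin 3 → ℂ} (hP : P ∈ D.points) {φ : K}
    (hφ : partial' + const φ ∈ D.leftIdeal P) :
    D.toOp (D.a 0) - const (algebraMap ℂ K (P 0)) =
      (partial' ^ 2 + const (-φ) * partial' + const (φ ^ 2 - 2 * φ′ + D.u)) *
        (partial' + const φ) := by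
  -- The quadratic factor is chosen so that the product agrees with L - P₀ in every positive order.
  -- The difference is an order-zero element of a proper left ideal, hence zero.
  have h1 := (D.leftIdeal P).sub_mem (D.opAt_mem P 0) ((D.leftIdeal P).mul_mem_left
    (partial' ^ 2 + const (-φ) * partial' + const (φ ^ 2 - 2 * φ′ + D.u)) hφ)
  have h2 := quadratic_mul_linear (-φ) (φ ^ 2 - 2 * φ′ + D.u) φ
  rw [neg_add_cancel, const_zero, zero_mul, add_zero,
    show φ ^ 2 - 2 * φ′ + D.u + φ′ + φ′ + -φ * φ = D.u by ring] at h2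
  rw [h2, opAt, D.toOp_zero, opL, add_sub_assoc, add_sub_add_left_eq_sub, ← const_sub,
    ← const_sub] at h1
  rw [h2, D.toOp_zero, opL, add_sub_assoc, ← const_sub,
    sub_eq_zero.1 (D.eq_zero_of_const_mem hP h1)]

/-! #### The exceptional points -/

variable {D}

/-- Only the pair (A₁, A₂) needs a hypothesis; for pairs containing L the cubic argument is
unconditional. -/
theorem exists_evalAt_phiPoly_ne_zero (h : D.resIdeal.IsPrime ∨
    Squarefree (bcRes (D.toOp (D.a 0)) (D.toOp (D.a 1)) (D.toOp (D.a 2)) 2)) (i : Fin 3) :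
    ∃ P ∈ D.points,
      evalAt P (phiPoly (D.toOp (D.a 0)) (D.toOp (D.a 1)) (D.toOp (D.a 2)) i 1) ≠ 0 := by
  simp only [evalAt_phiPoly]
  fin_cases i
  · exact D.exists_subres_ne_zero (k := 1) (by decide)
  · exact D.exists_subres_ne_zero (k := 2) (by decide)
  · rcases h with h | h
    · refine D.exists_subres_one_two_ne_zero_of_relations_le ?_
      have h1 := relations_le_radical (h.isRadical.radical.symm ▸ h)
      rw [h.isRadical.radical, resIdeal_eq] at h1
      refine h1.trans (Ideal.span_mono ?_)
      rintro _ ⟨k, rfl⟩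
      fin_cases k
      · exact Or.inl rfl
      · exact Or.inr (Or.inl rfl)
      · exact Or.inr (Or.inr rfl)
    · exact D.exists_subres_one_two_ne_zero_of_squarefree h

/-- With the radical prime, Γ is the set of points of S. Singular points are zeros of the derivative
of one of the two cubics, and neither these derivatives nor the φ_{k,1} vanish identically. -/
theorem finite_exceptionalSet (hrad : D.resIdeal.radical.IsPrime) (h : D.resIdeal.IsPrime ∨
    Squarefree (bcRes (D.toOp (D.a 0)) (D.toOp (D.a 1)) (D.toOp (D.a 2)) 2)) :
    (exceptionalSet (D.toOp (D.a 0)) (D.toOp (D.a 1)) (D.toOp (D.a 2))).Finite := by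
  have hcurve := resCurve_eq_points hrad
  refine Set.Finite.union ?_ ?_
  · have hfin : ∀ k : Fin 3, {P ∈ D.points | k ≠ 0 ∧ MvPolynomial.eval P
        (substPair ℂ 0 k (D.curvePoly 0 k).derivative) = 0}.Finite := fun k => by
      by_cases hk : k = 0
      · simp [hk]
      · refine (D.finite_zeros (p := substPair ℂ 0 k (D.curvePoly 0 k).derivative)
          fun hp => ?_).subset fun P hP => ⟨hP.1, hP.2.2⟩
        exact D.evalPair_derivative_curvePoly_ne_zero hk
          ((D.evalGen_substPair 0 k _).symm.trans hp)
    refine (Set.finite_iUnion hfin).subset ?_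
    rintro P ⟨hP, hrank⟩
    rw [show curve (D.toOp (D.a 0)) (D.toOp (D.a 1)) (D.toOp (D.a 2)) = D.points from hcurve]
      at hP hrank
    rw [D.vanishingIdeal_points] at hrank
    by_contra hnot
    simp only [Set.mem_iUnion, Set.mem_ofPred_eq, not_exists, not_and] at hnot
    exact absurd (D.finrank_tangentSpace_le_one fun k hk => hnot k hP hk) (not_le.2 hrank)
  · have hfin := fun i => (exists_evalAt_phiPoly_ne_zero h i).elim fun P hP =>
      D.finite_zeros_evalAt hP.1 hP.2
    refine (Set.finite_iUnion hfin).subset ?_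
    rintro P ⟨hP, i, hi⟩
    exact Set.mem_iUnion.2 ⟨i, hcurve ▸ hP, hi⟩

/-- The right factors at the points outside the exceptional set. -/
theorem mem_of_notMem_exceptionalSet (hrad : D.resIdeal.radical.IsPrime) {P : Fin 3 → ℂ}
    (hP : P ∈ D.resCurve)
    (hZ : P ∉ exceptionalSet (D.toOp (D.a 0)) (D.toOp (D.a 1)) (D.toOp (D.a 2))) :
    P ∈ D.points ∧ ∀ i, partial' + const
      (phi (D.toOp (D.a 0)) (D.toOp (D.a 1)) (D.toOp (D.a 2)) i P) ∈ D.leftIdeal P :=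
  ⟨resCurve_eq_points hrad ▸ hP, fun i => D.partial_add_phi_mem fun h => hZ (Or.inr ⟨hP, i, h⟩)⟩

end SpectralData

end Bsq

end

open DiffOp Bsq in
theorem theoremC {K : Type*} [Field K] [Algebra ℂ K] [Differential K]
    (hK : ∀ a : K, a′ = 0 ↔ a ∈ Set.range (algebraMap ℂ K))
    (u₁ u₀ : K) (hBsq : IsBoussinesq u₁ u₀) (L : DiffOp K) (hL : L = opL u₁ u₀) (lam₀ : ℂ) :
    (∃ A₁ A₂ : DiffOp K,
      IsMinimalCommuting L 1 A₁ ∧ IsMinimalCommuting L 2 A₂ ∧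
      IsBsqOperator u₁ u₀ 1 A₁ ∧ IsBsqOperator u₁ u₀ 2 A₂) ∧
    ∀ A₁ A₂ : DiffOp K, IsMinimalCommuting L 1 A₁ → IsMinimalCommuting L 2 A₂ →
      generatedRing L A₁ A₂ = Subring.centralizer {L} ∧
      (∀ i, ∃ f : MvPolynomial (Fin 3) ℂ,
        MvPolynomial.map (algebraMap ℂ K) f = bcRes L A₁ A₂ i) ∧
      (∃ out, SpFRun L lam₀ A₁ A₂ out) ∧
      (¬ (bcIdeal L A₁ A₂).IsPrime →
        ∀ out, SpFRun L lam₀ A₁ A₂ out → out = SpFOutput.notGeometricallyReducible) ∧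
      ((bcIdeal L A₁ A₂).IsPrime →
        ∀ out, SpFRun L lam₀ A₁ A₂ out →
          (out = SpFOutput.noFactorization ∧
            ¬ ∃ P ∈ curve L A₁ A₂ \ exceptionalSet L A₁ A₂, P 0 = lam₀) ∨
          ∃ P₀ ∈ curve L A₁ A₂ \ exceptionalSet L A₁ A₂, P₀ 0 = lam₀ ∧
            out = SpFOutput.result (bcIdeal L A₁ A₂) P₀ (partial' + const (phi L A₁ A₂ 0 P₀)) ∧
            IsGCRD (partial' + const (phi L A₁ A₂ 0 P₀))
              {L - const (algebraMap ℂ K lam₀), A₁ - const (algebraMap ℂ K (P₀ 1)),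
                A₂ - const (algebraMap ℂ K (P₀ 2))}) ∧
      ((bcIdeal L A₁ A₂).IsPrime ∨
          ((bcIdeal L A₁ A₂).radical.IsPrime ∧ Squarefree (bcRes L A₁ A₂ 2)) →
        (exceptionalSet L A₁ A₂).Finite ∧
        ∀ P₀ ∈ curve L A₁ A₂ \ exceptionalSet L A₁ A₂, ∃ φ₀ : K,
          (∀ i, phi L A₁ A₂ i P₀ = φ₀) ∧
          IsGCRD (partial' + const φ₀)
            {L - const (algebraMap ℂ K (P₀ 0)), A₁ - const (algebraMap ℂ K (P₀ 1)),
              A₂ - const (algebraMap ℂ K (P₀ 2))} ∧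
          L - const (algebraMap ℂ K (P₀ 0)) =
            (partial' ^ 2 + const (-φ₀) * partial' + const (φ₀ ^ 2 - 2 * φ₀′ + u₁)) *
              (partial' + const φ₀)) := by
  have : CharZero K := charZero_of_injective_algebraMap (algebraMap ℂ K).injective
  subst hL
  refine ⟨exists_minimal_bsqOperators hK hBsq, fun A₁ A₂ h₁ h₂ => ?_⟩
  obtain ⟨S, _, _, D, rfl, rfl, rfl, rfl⟩ := exists_spectralData hK h₁ h₂
  clear h₁ h₂ hBsq
  rw [← D.toOp_zero]
  have hradical : (D.resIdeal).IsPrime → D.resIdeal.radical.IsPrime := fun h =>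
    h.isRadical.radical.symm ▸ h
  refine ⟨D.generatedRing_eq, fun i => ?_, ?_, fun hI out hout => ?_, fun hI out hout => ?_,
    fun hI => ?_⟩
  · obtain ⟨c, -, h⟩ := D.bcRes_eq i
    exact ⟨_, h.symm⟩
  · by_cases hI : D.resIdeal.IsPrime
    · by_cases hZ : ∃ P ∈ D.resCurve, P 0 = lam₀ ∧
          P ∉ exceptionalSet (D.toOp (D.a 0)) (D.toOp (D.a 1)) (D.toOp (D.a 2))
      · obtain ⟨P, hP, h0, hPZ⟩ := hZ
        exact ⟨_, SpFRun.factor hI P hP h0 hPZ⟩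
      · push Not at hZ
        -- Giving up requires a point over λ₀ to search; one always exists because L - λ₀ is not a
        -- unit of S.
        obtain ⟨P, hP, h0⟩ := D.exists_point lam₀
        exact ⟨_, SpFRun.giveUp hI P (D.points_subset_resCurve hP) h0 hZ⟩
    · exact ⟨_, SpFRun.notPrime hI⟩
  · cases hout with
    | notPrime h => rfl
    | giveUp h => exact absurd h hI
    | factor h => exact absurd h hI
  · cases hout with
    | notPrime h => exact absurd hI h
    | giveUp h P hP h0 hZ =>
      exact Or.inl ⟨rfl, fun ⟨P, hP, h0⟩ => hP.2 (hZ P hP.1 h0)⟩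
    | factor h P hP h0 hZ =>
      obtain ⟨hPD, hmem⟩ := SpectralData.mem_of_notMem_exceptionalSet (hradical hI) hP hZ
      refine Or.inr ⟨P, ⟨hP, hZ⟩, h0, rfl, ?_⟩
      rw [← h0]
      exact D.isGCRD_of_mem hPD (hmem 0)
  · have hrad : D.resIdeal.radical.IsPrime := hI.elim hradical fun h => h.1
    refine ⟨SpectralData.finite_exceptionalSet hrad (hI.imp_right fun h => h.2), fun P hP => ?_⟩
    obtain ⟨hPD, hmem⟩ := SpectralData.mem_of_notMem_exceptionalSet hrad hP.1 hP.2
    exact ⟨_, fun i => D.eq_of_partial_add_const_mem hPD (hmem i) (hmem 0),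
      D.isGCRD_of_mem hPD (hmem 0), D.eq_quadratic_mul_linear hPD (hmem 0)⟩
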